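/- **Setting.** Circuits are sequences of layers of gates acting on disjoint sets of qubits; a gate is a one-qubit unitary with any number of control qubits; the depth is the number of layers. Let $X(t)$, $0\le t<T$ ($T\in\mathbb N$), be a stochastic process every path of which has $n\ge 1$ constant pieces: $X(t)=X_j$ for $T_{j-1}\le t<T_j$, with integers $0=T_0<T_1<\dots<T_n=T$. Its holding time representation is the sequence $(X_j,\tau_j)_{1\le j\le n}$, $\tau_j=T_j-T_{j-1}$; its increment representation is $(Y_j,T_j)_{1\le j\le n}$, $Y_1=X_1$, $Y_j=X_j-X_{j-1}$. A representation is *given* by a circuit of depth $\mathcal P$ that maps $|0\dots0\rangle$ to a state whose $n$ pairs of registers (a value register and a time register for each $j$; index and work qubits are allowed) have, when measured, the joint law of the $n$ pairs. Times are stored in binary; values are stored in two's complement as integer multiples of a fixed positive unit. Let $g$ be integrable on $[0,T]$, $G(s)=\int_s^T g(t)\,dt$, $F(s)=\int_{T-s}^T g(t)\,dt$, and $J=\int_0^T g(t)X(t)\,dt$. A circuit *prepares* $F$ (or $G$) on $l$-qubit registers if, from an integer time $0\le s\le T$ in its input register and $0$ in all other qubits, it ends with the exact value $F(s)$ (or $G(s)$),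 an integer multiple of a fixed positive unit in two's complement, in its output register. Let $f:\mathbb R\to\mathbb R$ be integrable on $[a,a+P]$, $P>0$, let $c_l=\frac1P\int_a^{a+P}f(x)e^{-2\pi i l x/P}dx$, and let $f_{P,L}(x)=\sum_{l=-L}^{L}c_l e^{2\pi i l x/P}$ be the $P$-periodic Fourier approximation of order $L$. Let $K$ be such that $\sum_{0<|l|\le L}|c_l|^2\le (KP)^2$, i.e. the root mean square fluctuation of $f_{P,L}$ over a period is at most $KP$ (for instance $K$ a Lipschitz constant of $f$ on $[a,a+P]$, or $K=\sup|f|/P$), and let $0<\varepsilon\le KP$. **Theorem.** For every $\delta\in(0,1)$ there is a constant $C$, depending on $\delta$ only, such that the following holds. i) Let the holding time representation be given with $l_x,l_\tau\ge1$ qubits for each pair $X_j,\tau_j$, where $T<2^{l_\tau}$, by a circuit of depth $\mathcal P$, and let $F$ be prepared on $l_\tau$-qubit registers by a circuit of depth $\mathcal F$. Then every path satisfies $J=\sum_{j=1}^n Y_j\,G(T_{j-1})$, and $E[f(J)]$ can be estimated by an algorithm that uses the two circuits as black boxes (it is chosen from $n,l_x,l_\tau$, the register layout, the units, $f,a,P,L,K,\varepsilon,\delta$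 alone). It has evaluation circuits of depth at most $$\mathcal P+\mathcal F+C\big(n l_x l_\tau+n\max(l_x,l_\tau)\big),$$ whose own gates have at most two controls and whose target qubit is measured as $1$ with probability $\frac12(1+E[\cos\frac{2\pi l}{P}J])$, respectively $\frac12(1+E[\sin\frac{2\pi l}{P}J])$, for each $1\le l\le L$. From finitely many independent runs composed of these circuits, their inverses and further gates, all started in $|0\dots0\rangle$ and measured at the end, of total depth (time complexity) at most $$C K\,\frac{LP}{\varepsilon}\big(\mathcal P+\mathcal F+n l_x l_\tau+n\max(l_x,l_\tau)\big),$$ it computes an estimate that, with probability at least $1-\delta$, is within $\varepsilon$ of $E[f_{P,L}(J)]$ and hence within $\varepsilon+E|f(J)-f_{P,L}(J)|$ of $E[f(J)]$. ii) Let the increment representation be given with $l_Y,l_T\ge 1$ qubits for each pair $Y_j,T_j$ by a circuit of depth $\mathcal P$, and let $G$ be prepared on $l_T$-qubit registers by a circuit of depth $\mathcal G$. Then the same holds with evaluation circuits of depth at most $\mathcal P+\mathcal G+C\,n l_Y l_T$ and time complexity at most $C K\,\frac{LP}{\varepsilon}\big(\mathcal P+\mathcal G+n l_Y l_T\big)$.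 -/

import Mathlib

open MeasureTheory

namespace QCTSP

noncomputable section

/-! ### Quantum circuits and their depth

The wires (qubits) of a circuit form a finite type `W`; the computational basis is `W → Bool`;
an operator is its matrix, `M x y` being the amplitude `⟨x| M |y⟩`. -/

/-- An elementary gate: a one-qubit unitary on `target`, applied when all the qubits in `controls`
are in state `1` (rotations, phases, X, H, CNOT, Toffoli, (multi-)controlled rotations). -/
structure Gate (W : Type) [DecidableEq W] where
  target : W
  controls : Finset W
  target_notMem : target ∉ controls
  op : Matrix.unitaryGroup Bool ℂ

/-- The qubits that a gate touches. -/
def Gate.support {W : Type} [DecidableEq W] (g : Gate W) : Finset W :=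
  insert g.target g.controls

def Gate.matrix {W : Type} [Fintype W] [DecidableEq W] (g : Gate W) :
    Matrix (W → Bool) (W → Bool) ℂ :=
  Matrix.of fun x y =>
    if ∀ w, w ≠ g.target → x w = y w then
      if ∀ c ∈ g.controls, y c = true then (g.op : Matrix Bool Bool ℂ) (x g.target) (y g.target)
      else if x g.target = y g.target then 1 else 0
    else 0

/-- A layer: gates on pairwise disjoint sets of qubits, executed in one time step. -/
structure Layer (W : Type) [DecidableEq W] where
  gates : List (Gate W)
  disjoint : gates.Pairwise fun g h => Disjoint g.support h.support

def Layer.matrix {W : Type} [Fintype W] [DecidableEq W] (s : Layer W) :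
    Matrix (W → Bool) (W → Bool) ℂ :=
  (s.gates.map Gate.matrix).prod

/-- The operator of a sequence of operators, the head of the list being executed first. -/
def seqMatrix {B : Type} [Fintype B] [DecidableEq B] : List (Matrix B B ℂ) → Matrix B B ℂ
  | [] => 1
  | M :: rest => seqMatrix rest * M

/-- A circuit: a sequence of layers. -/
structure Circuit (W : Type) [DecidableEq W] where
  layers : List (Layer W)

/-- Circuit depth: the number of layers. -/
def Circuit.depth {W : Type} [DecidableEq W] (c : Circuit W) : ℕ := c.layers.length

def Circuit.matrix {W : Type} [Fintype W] [DecidableEq W] (c : Circuit W) :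
    Matrix (W → Bool) (W → Bool) ℂ :=
  seqMatrix (c.layers.map Layer.matrix)

/-- The operator `M` on the qubits `Q`, acting on the wires `e q` of a larger set of wires. -/
def embedMatrix {Q W : Type} [Fintype Q] [DecidableEq Q] [Fintype W] [DecidableEq W]
    (e : Q ↪ W) (M : Matrix (Q → Bool) (Q → Bool) ℂ) : Matrix (W → Bool) (W → Bool) ℂ :=
  Matrix.of fun x y =>
    if ∀ w, (∀ q, e q ≠ w) → x w = y w then M (fun q => x (e q)) (fun q => y (e q)) else 0

/-- `n` copies of `M` side by side (the tensor power). -/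
def parallelMatrix {R : Type} [Fintype R] [DecidableEq R] (n : ℕ)
    (M : Matrix (R → Bool) (R → Bool) ℂ) :
    Matrix (Fin n × R → Bool) (Fin n × R → Bool) ℂ :=
  Matrix.of fun x y => ∏ k, M (fun r => x (k, r)) (fun r => y (k, r))

/-- Probability of reading `b` when all qubits are measured after applying `M` to `|0…0⟩`. -/
def outcomeProb {W : Type} (M : Matrix (W → Bool) (W → Bool) ℂ) (b : W → Bool) : ℝ :=
  ‖M b (fun _ => false)‖ ^ 2

/-- The number stored in a binary register, qubit `i` having weight `2 ^ i`. -/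
def unsignedVal {l : ℕ} (v : Fin l → Bool) : ℕ := ∑ i, if v i then 2 ^ (i : ℕ) else 0

/-- The integer stored in a binary register in two's complement. -/
def signedVal {l : ℕ} (v : Fin l → Bool) : ℤ :=
  if 2 * unsignedVal v < 2 ^ l then (unsignedVal v : ℤ) else (unsignedVal v : ℤ) - 2 ^ l

/-! ### Continuous time stochastic processes with `n` pieces and their two representations -/

/-- The beginning time `T_{j-1}` of the `j`-th piece, from the ending times; `T_0 = 0`. -/
def startTime {Ω : Type*} {n : ℕ} (S : Fin n → Ω → ℕ) (j : Fin n) (ω : Ω) : ℕ :=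
  if (j : ℕ) = 0 then 0 else S ⟨(j : ℕ) - 1, lt_of_le_of_lt (Nat.sub_le _ _) j.isLt⟩ ω

/-- The value before the `j`-th piece, with the convention that it is `0` for the first piece. -/
def prevValue {Ω : Type*} {n : ℕ} (Z : Fin n → Ω → ℝ) (j : Fin n) (ω : Ω) : ℝ :=
  if (j : ℕ) = 0 then 0 else Z ⟨(j : ℕ) - 1, lt_of_le_of_lt (Nat.sub_le _ _) j.isLt⟩ ω

/-- Every path of `X` on `[0, T)` consists of `n` constant pieces: its value is `Z j` from the
beginning time to the ending time `S j` of piece `j`; the last piece ends at `T`. -/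
structure IsPieces {Ω : Type*} (X : ℝ → Ω → ℝ) (T : ℕ) {n : ℕ}
    (Z : Fin n → Ω → ℝ) (S : Fin n → Ω → ℕ) : Prop where
  start_lt : ∀ ω j, startTime S j ω < S j ω
  last : ∀ ω (j : Fin n), (j : ℕ) + 1 = n → S j ω = T
  value : ∀ ω j (t : ℝ), (startTime S j ω : ℝ) ≤ t → t < (S j ω : ℝ) → X t ω = Z j ω

/-- Holding time representation `(X_j, τ_j)`: `τ_j = T_j - T_{j-1}`. -/
def IsHoldingTimeRep {Ω : Type*} (X : ℝ → Ω → ℝ) (T : ℕ) {n : ℕ}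
    (Z : Fin n → Ω → ℝ) (τ : Fin n → Ω → ℕ) : Prop :=
  ∃ S : Fin n → Ω → ℕ, IsPieces X T Z S ∧ ∀ j ω, S j ω = startTime S j ω + τ j ω

/-- Increment representation `(Y_j, T_j)`: `Y_1 = X_1` and `Y_j = X_j - X_{j-1}`. -/
def IsIncrementRep {Ω : Type*} (X : ℝ → Ω → ℝ) (T : ℕ) {n : ℕ}
    (Y : Fin n → Ω → ℝ) (S : Fin n → Ω → ℕ) : Prop :=
  ∃ Z : Fin n → Ω → ℝ, IsPieces X T Z S ∧ ∀ j ω, Y j ω = Z j ω - prevValue Z j ω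

/-- The weighted integral `J(X, T) = ∫_0^T g(t) X(t) dt`. -/
def weightedIntegral {Ω : Type*} (g : ℝ → ℝ) (X : ℝ → Ω → ℝ) (T : ℕ) (ω : Ω) : ℝ :=
  ∫ t in (0 : ℝ)..T, g t * X t ω

/-- The circuit `prep` prepares the process from `|0…0⟩`. For each of the `n` pieces, `reg` singles
out a value register of `lv` qubits and a time register of `lt` qubits (the remaining qubits being
the index register and work space), and the contents of these registers are distributed as the
`n` pairs `(V j, S j)`. Values are fixed point numbers, integer multiples of `r`. -/
def PreparesProcess {Ω : Type*} [MeasurableSpace Ω] {Q : Type} [Fintype Q] [DecidableEq Q]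
    {n lv lt : ℕ} (reg : (Fin n × Fin lv) ⊕ (Fin n × Fin lt) ↪ Q) (r : ℝ) (prep : Circuit Q)
    (μ : Measure Ω) (V : Fin n → Ω → ℝ) (S : Fin n → Ω → ℕ) : Prop :=
  ∀ (x : Fin n → Fin lv → Bool) (t : Fin n → Fin lt → Bool),
    (∑ b : Q → Bool,
      if (∀ j i, b (reg (Sum.inl (j, i))) = x j i) ∧ (∀ j i, b (reg (Sum.inr (j, i))) = t j i)
      then outcomeProb prep.matrix b else 0) =
    μ.real {ω | ∀ j, V j ω = r * signedVal (x j) ∧ S j ω = unsignedVal (t j)}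

/-- The circuit `c` prepares the function `h` of a time `s ≤ T`: when `s` is in the register `inp`
and all other qubits are `0`, the register `out` ends with the fixed point number `h s`, an integer
multiple of `r`. The two registers may be the same, and the other qubits end in any state. -/
def PreparesFunction {R : Type} [Fintype R] [DecidableEq R] {l : ℕ} (inp out : Fin l ↪ R) (r : ℝ)
    (c : Circuit R) (T : ℕ) (h : ℕ → ℝ) : Prop :=
  ∀ (v : Fin l → Bool) (b : R → Bool), unsignedVal v ≤ T →
    c.matrix b (Function.extend inp v fun _ => false) ≠ 0 →
    h (unsignedVal v) = r * signedVal fun i => b (out i)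

/-! ### Fourier approximation -/

/-- Fourier coefficient `c_l` of the `P`-periodic extension of `f` restricted to `[a, a + P]`. -/
def fourierCoef (f : ℝ → ℝ) (a P : ℝ) (l : ℤ) : ℂ :=
  (1 / P : ℂ) * ∫ x in a..(a + P),
    (f x : ℂ) * Complex.exp (-(2 * Real.pi * l * x / P : ℝ) * Complex.I)

/-- The `P`-periodic Fourier approximation `f_{P,L}` of order `L`. -/
def fourierApprox (f : ℝ → ℝ) (a P : ℝ) (L : ℕ) (x : ℝ) : ℂ :=
  ∑ l ∈ Finset.Icc (-(L : ℤ)) L,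
    fourierCoef f a P l * Complex.exp ((2 * Real.pi * l * x / P : ℝ) * Complex.I)

/-! ### Estimation algorithms

An algorithm uses the preparation circuit (on qubits `Q`) and the circuit for the integral of the
weight (on qubits `R`) as black boxes: it is fixed before these two circuits are given. -/

/-- A step of an evaluation circuit: a layer of gates, the preparation circuit, or the integral
circuit applied in parallel to `n` disjoint sets of qubits. -/
inductive EvalInstr (W Q R : Type) [DecidableEq W] (n : ℕ) where
  | gates (s : Layer W)
  | prepare (e : Q ↪ W)
  | integrate (e : Fin n × R ↪ W)

/-- The operator of a step, given the operators `U`, `V` of the two circuits. -/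
def EvalInstr.matrix {W Q R : Type} [Fintype W] [DecidableEq W] [Fintype Q] [DecidableEq Q]
    [Fintype R] [DecidableEq R] {n : ℕ} (U : Matrix (Q → Bool) (Q → Bool) ℂ)
    (V : Matrix (R → Bool) (R → Bool) ℂ) :
    EvalInstr W Q R n → Matrix (W → Bool) (W → Bool) ℂ
  | .gates s => s.matrix
  | .prepare e => embedMatrix e U
  | .integrate e => embedMatrix e (parallelMatrix n V)

/-- The depth of a step, given the depths `p`, `q` of the two circuits. -/
def EvalInstr.depth {W Q R : Type} [DecidableEq W] {n : ℕ} (p q : ℕ) : EvalInstr W Q R n → ℕ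
  | .gates _ => 1
  | .prepare _ => p
  | .integrate _ => q

/-- The gates of a step have at most two control qubits. -/
def EvalInstr.AtMostTwoControls {W Q R : Type} [DecidableEq W] {n : ℕ} :
    EvalInstr W Q R n → Prop
  | .gates s => ∀ g ∈ s.gates, g.controls.card ≤ 2
  | .prepare _ => True
  | .integrate _ => True

/-- A step of an amplitude estimation run: a layer of gates, an evaluation circuit (number `l`,
kind `k`), or the inverse of one. -/
inductive RunInstr (W : Type) [DecidableEq W] where
  | gates (s : Layer W)
  | eval (l : ℕ) (k : Bool)
  | evalInv (l : ℕ) (k : Bool)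

/-- An estimation algorithm: for each frequency `l` an evaluation circuit for the cosine
(`k = false`) and one for the sine (`k = true`), with a common target qubit; finitely many runs
built from these circuits, each started in `|0…0⟩` and measured at the end; and a classical function
turning the measured bits into the estimate. -/
structure Estimator (Q R : Type) (n : ℕ) where
  Wire : Type
  fintypeWire : Fintype Wire
  decidableEqWire : DecidableEq Wire
  target : Wire
  evalCircuit : ℕ → Bool → List (EvalInstr Wire Q R n)
  numRuns : ℕ
  run : Fin numRuns → List (RunInstr Wire)
  estimate : (Fin numRuns → Wire → Bool) → ℝ

attribute [instance] Estimator.fintypeWire Estimator.decidableEqWire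

/-- The depth of an evaluation circuit. -/
def Estimator.evalDepth {Q R : Type} {n : ℕ} (alg : Estimator Q R n) (p q l : ℕ) (k : Bool) : ℕ :=
  ((alg.evalCircuit l k).map (EvalInstr.depth p q)).sum

def Estimator.evalMatrix {Q R : Type} [Fintype Q] [DecidableEq Q] [Fintype R] [DecidableEq R]
    {n : ℕ} (alg : Estimator Q R n) (U : Matrix (Q → Bool) (Q → Bool) ℂ)
    (V : Matrix (R → Bool) (R → Bool) ℂ) (l : ℕ) (k : Bool) :
    Matrix (alg.Wire → Bool) (alg.Wire → Bool) ℂ :=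
  seqMatrix ((alg.evalCircuit l k).map (EvalInstr.matrix U V))

def Estimator.instrDepth {Q R : Type} {n : ℕ} (alg : Estimator Q R n) (p q : ℕ) :
    RunInstr alg.Wire → ℕ
  | .gates _ => 1
  | .eval l k => alg.evalDepth p q l k
  | .evalInv l k => alg.evalDepth p q l k

def Estimator.instrMatrix {Q R : Type} [Fintype Q] [DecidableEq Q] [Fintype R] [DecidableEq R]
    {n : ℕ} (alg : Estimator Q R n) (U : Matrix (Q → Bool) (Q → Bool) ℂ)
    (V : Matrix (R → Bool) (R → Bool) ℂ) :
    RunInstr alg.Wire → Matrix (alg.Wire → Bool) (alg.Wire → Bool) ℂ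
  | .gates s => s.matrix
  | .eval l k => alg.evalMatrix U V l k
  | .evalInv l k => (alg.evalMatrix U V l k).conjTranspose

/-- The time complexity: the total depth of all runs. -/
def Estimator.time {Q R : Type} {n : ℕ} (alg : Estimator Q R n) (p q : ℕ) : ℕ :=
  ∑ i, ((alg.run i).map (alg.instrDepth p q)).sum

def Estimator.runMatrix {Q R : Type} [Fintype Q] [DecidableEq Q] [Fintype R] [DecidableEq R]
    {n : ℕ} (alg : Estimator Q R n) (U : Matrix (Q → Bool) (Q → Bool) ℂ)
    (V : Matrix (R → Bool) (R → Bool) ℂ) (i : Fin alg.numRuns) :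
    Matrix (alg.Wire → Bool) (alg.Wire → Bool) ℂ :=
  seqMatrix ((alg.run i).map (alg.instrMatrix U V))

open Classical in
/-- The probability that the estimate lies in `A`, the runs being independent. -/
def Estimator.estimateProb {Q R : Type} [Fintype Q] [DecidableEq Q] [Fintype R] [DecidableEq R]
    {n : ℕ} (alg : Estimator Q R n) (U : Matrix (Q → Bool) (Q → Bool) ℂ)
    (V : Matrix (R → Bool) (R → Bool) ℂ) (A : Set ℝ) : ℝ :=
  ∑ o : Fin alg.numRuns → alg.Wire → Bool,
    if alg.estimate o ∈ A then ∏ i, outcomeProb (alg.runMatrix U V i) (o i) else 0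

/-- The probability that the target qubit of an evaluation circuit is measured as `1`. -/
def Estimator.targetProb {Q R : Type} [Fintype Q] [DecidableEq Q] [Fintype R] [DecidableEq R]
    {n : ℕ} (alg : Estimator Q R n) (U : Matrix (Q → Bool) (Q → Bool) ℂ)
    (V : Matrix (R → Bool) (R → Bool) ℂ) (l : ℕ) (k : Bool) : ℝ :=
  ∑ b : alg.Wire → Bool, if b alg.target then outcomeProb (alg.evalMatrix U V l k) b else 0

/-- The algorithm estimates `E[f(J)]` through the Fourier approximation `f_{P,L}`: the amplitudes of
its evaluation circuits carry `E[cos(2πlJ/P)]` and `E[sin(2πlJ/P)]`, and with probability at least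
`1 - δ` its estimate is within `ε` of `E[f_{P,L}(J)]`, hence within `ε` plus the mean error of the
Fourier approximation of `E[f(J)]`. -/
structure Estimator.Estimates {Q R : Type} [Fintype Q] [DecidableEq Q] [Fintype R] [DecidableEq R]
    {n : ℕ} (alg : Estimator Q R n) (prep : Circuit Q) (integral : Circuit R)
    {Ω : Type*} [MeasurableSpace Ω] (μ : Measure Ω) (J : Ω → ℝ)
    (f : ℝ → ℝ) (a P : ℝ) (L : ℕ) (ε δ : ℝ) : Prop where
  cos_amplitude : ∀ l, 1 ≤ l → l ≤ L →
    alg.targetProb prep.matrix integral.matrix l false =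
      (1 + ∫ ω, Real.cos (2 * Real.pi * l / P * J ω) ∂μ) / 2
  sin_amplitude : ∀ l, 1 ≤ l → l ≤ L →
    alg.targetProb prep.matrix integral.matrix l true =
      (1 + ∫ ω, Real.sin (2 * Real.pi * l / P * J ω) ∂μ) / 2
  accurate : 1 - δ ≤ alg.estimateProb prep.matrix integral.matrix
    {y : ℝ | ‖(y : ℂ) - ∫ ω, fourierApprox f a P L (J ω) ∂μ‖ ≤ ε ∧
      |y - ∫ ω, f (J ω) ∂μ| ≤ ε + ∫ ω, ‖(f (J ω) : ℂ) - fourierApprox f a P L (J ω)‖ ∂μ}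

end

end QCTSP

namespace QCTSP
open scoped Matrix
set_option linter.unusedSectionVars false

/-! ### Linear algebra of circuits -/

/-! The value of a path enters through one identity. Each constant piece contributes X_j (G(T_{j-1})
− G(T_j)), and summation by parts with G(T) = 0 gives J = ∑ Y_j G(T_{j-1})
(`IsPieces.weightedIntegral_eq`). A number in two's complement is linear in its bits, so each
summand is bilinear in the bits of a value register and of an output register of the integral
circuit. Hence no multiplier is needed: one doubly controlled phase per pair of bits puts exp(iκJ)
on a target qubit, and a Hadamard test turns it into the probability (1 + E cos κJ)/2 or (1 + E sin
κJ)/2 (`evalInstrs_targetProb`). The integral circuits may leave arbitrary states on their other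
qubits. This does no harm, because on the support of the state the phase depends only on the
contents of the preparation wires. The arguments of the integral circuits are suffix sums of holding
times, computed by a ripple adder, or copies of ending times.

Each mean c (of a cosine or a sine) is then estimated by a single run of phase estimation. If G is
the Grover iterate and ψ the state of the evaluation circuit, then χ_m = G^m ψ satisfies χ_{m+2} +
χ_m = 2c χ_{m+1} and Re⟨χ_m, χ_{m+1}⟩ = c. Let N be the size of the phase register, let its initial
amplitudes be proportional to sin(πm/N), and let k be the number read at the end. The estimate
cos(2πk/N) / cos(π/N) is exactly unbiased (`sum_phaseEstimate_sub`) and has mean squared error at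
most 2 tan²(π/N) (`sum_phaseEstimate_sub_sq`). Indeed, multiplication by 2 cos(2πk/N) after the
Fourier transform is a sum of two cyclic shifts before it, and the sine window is an eigenvector of
this sum up to a small residual whose inner product with χ_m has real part zero.

Since the errors of different runs are independent and centred, their variances add with the squared
Fourier coefficients as weights. These weights sum to at most 2(KP)², so N of order KP/(ε√δ)
suffices for Chebyshev's inequality (`one_sub_le_sum_prod`). There are 2L runs with fewer than N
iterates each, so the time is of order L·KP/ε evaluation circuits, with no repetitions and no
logarithmic factors. -/

theorem sum_ite_eq_sum_of_range {A B M : Type*} [Fintype A] [Fintype B] [AddCommMonoid M]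
    (φ : A → B) (hφ : Function.Injective φ) (p : B → Prop) [DecidablePred p]
    (hp : ∀ y, p y ↔ ∃ a, φ a = y) (f : B → M) :
    (∑ y, if p y then f y else 0) = ∑ a, f (φ a) := by
  rw [← Finset.sum_filter]
  symm
  apply Finset.sum_nbij φ
  · intro a _
    simp [hp]
  · exact hφ.injOn
  · intro y hy
    simpa [hp] using hy
  · intros; rfl

section
variable {Q W W' : Type} [Fintype Q] [DecidableEq Q] [Fintype W] [DecidableEq W]
  [Fintype W'] [DecidableEq W']

theorem matrix_ext_mulVec {B : Type*} [Fintype B] [DecidableEq B] {M N : Matrix B B ℂ}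
    (h : ∀ v, M *ᵥ v = N *ᵥ v) : M = N := by
  ext i j
  have := congrFun (h (Pi.single j 1)) i
  simpa using this

/-- Only the two basis states that agree with `x` off the target contribute. Since the target is not
a control, the control condition may be tested on the row index. Operators are compared through this
pointwise action below. -/
theorem Gate.mulVec_apply (g : Gate W) (v : (W → Bool) → ℂ) (x : W → Bool) :
    (g.matrix *ᵥ v) x = if ∀ c ∈ g.controls, x c = true then
      ∑ b, (g.op : Matrix Bool Bool ℂ) (x g.target) b * v (Function.update x g.target b)
      else v x := by
  have key : (g.matrix *ᵥ v) x = ∑ y, if (∀ w, w ≠ g.target → x w = y w) then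
      ((if ∀ c ∈ g.controls, y c = true then (g.op : Matrix Bool Bool ℂ) (x g.target) (y g.target)
      else if x g.target = y g.target then 1 else 0) * v y) else 0 := by
    simp only [Matrix.mulVec, dotProduct, Gate.matrix, Matrix.of_apply, ite_mul, zero_mul]
  rw [key, sum_ite_eq_sum_of_range (Function.update x g.target)
    (Function.update_injective x g.target)]
  · have hc : ∀ b, (∀ c ∈ g.controls, Function.update x g.target b c = true) ↔
        ∀ c ∈ g.controls, x c = true := by
      intro b
      refine forall₂_congr fun c hc => ?_
      rw [Function.update_of_ne]
      rintro rfl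
      exact g.target_notMem hc
    simp only [hc, Function.update_self]
    split_ifs with h
    · rfl
    · cases hx : x g.target <;> simp [← hx]
  · intro y
    constructor
    · intro h
      refine ⟨y g.target, ?_⟩
      ext w
      by_cases hw : w = g.target
      · subst hw; simp
      · rw [Function.update_of_ne hw]; exact h w hw
    · rintro ⟨b, rfl⟩ w hw
      rw [Function.update_of_ne hw]

/-- The inverse gate. -/
noncomputable def Gate.inv (g : Gate W) : Gate W := { g with op := g.op⁻¹ }

theorem Gate.inv_matrix (g : Gate W) : g.inv.matrix = g.matrixᴴ := by
  obtain ⟨t, C, ht, u⟩ := g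
  ext x y
  change (if ∀ w, w ≠ t → x w = y w then if ∀ c ∈ C, y c = true then
      ((u⁻¹ : Matrix.unitaryGroup Bool ℂ) : Matrix Bool Bool ℂ) (x t) (y t)
      else if x t = y t then 1 else 0 else 0) =
    star (if ∀ w, w ≠ t → y w = x w then if ∀ c ∈ C, x c = true then
      (u : Matrix Bool Bool ℂ) (y t) (x t) else if y t = x t then 1 else 0 else 0)
  by_cases h : ∀ w, w ≠ t → x w = y w
  · have h' : ∀ w, w ≠ t → y w = x w := fun w hw => (h w hw).symm
    have hc : (∀ c ∈ C, y c = true) ↔ ∀ c ∈ C, x c = true := by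
      refine forall₂_congr fun c hc => ?_
      rw [h c]
      rintro rfl
      exact ht hc
    rw [if_pos h, if_pos h']
    simp only [hc]
    by_cases hC : ∀ c ∈ C, x c = true
    · rw [if_pos hC, if_pos hC]
      rfl
    · rw [if_neg hC, if_neg hC]
      simp only [eq_comm (a := y t), apply_ite star, star_one, star_zero]
  · have h' : ¬ ∀ w, w ≠ t → y w = x w := fun h' => h fun w hw => (h' w hw).symm
    rw [if_neg h, if_neg h', star_zero]

theorem Gate.matrix_mem_unitary (g : Gate W) : g.matrix ∈ Matrix.unitaryGroup (W → Bool) ℂ := by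
  rw [Matrix.mem_unitaryGroup_iff', Matrix.star_eq_conjTranspose, ← Gate.inv_matrix]
  refine matrix_ext_mulVec fun v => ?_
  ext x
  rw [← Matrix.mulVec_mulVec, Gate.mulVec_apply, Matrix.one_mulVec]
  have hg : g.inv.target = g.target ∧ g.inv.controls = g.controls ∧ g.inv.op = g.op⁻¹ :=
    ⟨rfl, rfl, rfl⟩
  rw [hg.1, hg.2.1, hg.2.2]
  simp only [Gate.mulVec_apply]
  split_ifs with h
  · have hc : ∀ b, (∀ c ∈ g.controls, Function.update x g.target b c = true) := by
      intro b c hc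
      rw [Function.update_of_ne, h c hc]
      rintro rfl
      exact g.target_notMem hc
    have hu : ((g.op⁻¹ : Matrix.unitaryGroup Bool ℂ) : Matrix Bool Bool ℂ) * g.op = 1 := by
      rw [← Submonoid.coe_mul, inv_mul_cancel]; rfl
    simp only [if_pos (hc _), Function.update_self, Function.update_idem, Finset.mul_sum]
    rw [Finset.sum_comm]
    calc _ = ∑ y, (1 : Matrix Bool Bool ℂ) (x g.target) y * v (Function.update x g.target y) := by
          rw [← hu]
          simp only [Matrix.mul_apply, Finset.sum_mul, mul_assoc]
      _ = _ := by simp [Matrix.one_apply]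
  · rfl

theorem seqMatrix_append {B : Type} [Fintype B] [DecidableEq B] (l₁ l₂ : List (Matrix B B ℂ)) :
    seqMatrix (l₁ ++ l₂) = seqMatrix l₂ * seqMatrix l₁ := by
  induction l₁ with
  | nil => simp [seqMatrix]
  | cons a l ih => simp [seqMatrix, ih, mul_assoc]

theorem seqMatrix_mem_unitary {B : Type} [Fintype B] [DecidableEq B] (l : List (Matrix B B ℂ))
    (h : ∀ M ∈ l, M ∈ Matrix.unitaryGroup B ℂ) : seqMatrix l ∈ Matrix.unitaryGroup B ℂ := by
  induction l with
  | nil => exact one_mem _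
  | cons a l ih =>
    exact mul_mem (ih fun M hM => h M (List.mem_cons_of_mem _ hM)) (h a List.mem_cons_self)

theorem Layer.matrix_mem_unitary (s : Layer W) :
    s.matrix ∈ Matrix.unitaryGroup (W → Bool) ℂ := by
  apply list_prod_mem
  intro M hM
  obtain ⟨g, -, rfl⟩ := List.mem_map.1 hM
  exact g.matrix_mem_unitary

theorem Circuit.matrix_mem_unitary (c : Circuit W) :
    c.matrix ∈ Matrix.unitaryGroup (W → Bool) ℂ := by
  apply seqMatrix_mem_unitary
  intro M hM
  obtain ⟨g, -, rfl⟩ := List.mem_map.1 hM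
  exact g.matrix_mem_unitary

/-! ### Embedded operators -/

theorem extend_comp_embedding (e : Q ↪ W) (q : Q → Bool) (x : W → Bool) :
    (fun a => Function.extend e q x (e a)) = q :=
  funext fun a => e.injective.extend_apply q x a

theorem extend_extend (e : Q ↪ W) (q q' : Q → Bool) (x : W → Bool) :
    Function.extend e q' (Function.extend e q x) = Function.extend e q' x := by
  ext w
  by_cases h : ∃ a, e a = w
  · obtain ⟨a, rfl⟩ := h
    rw [e.injective.extend_apply, e.injective.extend_apply]
  · rw [Function.extend_apply' _ _ _ h, Function.extend_apply' _ _ _ h,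
      Function.extend_apply' _ _ _ h]

theorem extend_self (e : Q ↪ W) (x : W → Bool) :
    Function.extend e (fun a => x (e a)) x = x := by
  ext w
  by_cases h : ∃ a, e a = w
  · obtain ⟨a, rfl⟩ := h
    rw [e.injective.extend_apply]
  · rw [Function.extend_apply' _ _ _ h]

theorem embedMatrix_mulVec (e : Q ↪ W) (M : Matrix (Q → Bool) (Q → Bool) ℂ)
    (v : (W → Bool) → ℂ) (x : W → Bool) :
    (embedMatrix e M *ᵥ v) x = ∑ q, M (fun a => x (e a)) q * v (Function.extend e q x) := by
  have key : (embedMatrix e M *ᵥ v) x = ∑ y, if (∀ w, (∀ q, e q ≠ w) → x w = y w) then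
      M (fun a => x (e a)) (fun a => y (e a)) * v y else 0 := by
    simp only [Matrix.mulVec, dotProduct, embedMatrix, Matrix.of_apply, ite_mul, zero_mul]
  rw [key, sum_ite_eq_sum_of_range (fun q => Function.extend e q x)]
  · simp only [extend_comp_embedding]
  · intro q q' h
    have := congrArg (fun y => fun a => y (e a)) h
    simpa only [extend_comp_embedding] using this
  · intro y
    constructor
    · intro h
      refine ⟨fun a => y (e a), ?_⟩
      ext w
      by_cases hw : ∃ a, e a = w
      · obtain ⟨a, rfl⟩ := hw
        rw [e.injective.extend_apply]
      · rw [Function.extend_apply' _ _ _ hw]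
        exact h w (by simpa using hw)
    · rintro ⟨q, rfl⟩ w hw
      rw [Function.extend_apply' _ _ _ (by simpa using hw)]

theorem embedMatrix_mul (e : Q ↪ W) (M N : Matrix (Q → Bool) (Q → Bool) ℂ) :
    embedMatrix e (M * N) = embedMatrix e M * embedMatrix e N := by
  refine matrix_ext_mulVec fun v => ?_
  ext x
  rw [← Matrix.mulVec_mulVec]
  simp only [embedMatrix_mulVec, extend_comp_embedding, extend_extend, Finset.mul_sum,
    Matrix.mul_apply, Finset.sum_mul, mul_assoc]
  rw [Finset.sum_comm]

theorem embedMatrix_one (e : Q ↪ W) :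
    embedMatrix e (1 : Matrix (Q → Bool) (Q → Bool) ℂ) = 1 := by
  refine matrix_ext_mulVec fun v => ?_
  ext x
  simp [embedMatrix_mulVec, Matrix.one_apply, extend_self]

theorem embedMatrix_conjTranspose (e : Q ↪ W) (M : Matrix (Q → Bool) (Q → Bool) ℂ) :
    embedMatrix e Mᴴ = (embedMatrix e M)ᴴ := by
  ext x y
  simp only [embedMatrix, Matrix.of_apply, Matrix.conjTranspose_apply, apply_ite star, star_zero]
  simp only [eq_comm (a := x _)]

theorem embedMatrix_mem_unitary (e : Q ↪ W) {M : Matrix (Q → Bool) (Q → Bool) ℂ}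
    (hM : M ∈ Matrix.unitaryGroup (Q → Bool) ℂ) :
    embedMatrix e M ∈ Matrix.unitaryGroup (W → Bool) ℂ := by
  rw [Matrix.mem_unitaryGroup_iff', Matrix.star_eq_conjTranspose] at hM ⊢
  rw [← embedMatrix_conjTranspose, ← embedMatrix_mul, hM, embedMatrix_one]

theorem embedMatrix_trans (e : Q ↪ W) (e' : W ↪ W') (M : Matrix (Q → Bool) (Q → Bool) ℂ) :
    embedMatrix (e.trans e') M = embedMatrix e' (embedMatrix e M) := by
  ext x y
  simp only [embedMatrix, Matrix.of_apply, Function.Embedding.trans_apply]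
  by_cases h1 : ∀ w, (∀ q, e' q ≠ w) → x w = y w
  · rw [if_pos h1]
    by_cases h2 : ∀ w, (∀ q, e q ≠ w) → x (e' w) = y (e' w)
    · rw [if_pos h2, if_pos]
      intro w hw
      by_cases h : ∃ a, e' a = w
      · obtain ⟨a, rfl⟩ := h
        exact h2 a fun q hq => hw q (by rw [hq])
      · exact h1 w (by simpa using h)
    · rw [if_neg h2, if_neg]
      intro h
      exact h2 fun w hw => h _ fun q hq => hw q (e'.injective hq)
  · rw [if_neg h1, if_neg]
    intro h
    exact h1 fun w hw => h w fun q => hw (e q)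

theorem embedMatrix_seqMatrix (e : Q ↪ W) (l : List (Matrix (Q → Bool) (Q → Bool) ℂ)) :
    embedMatrix e (seqMatrix l) = seqMatrix (l.map (embedMatrix e)) := by
  induction l with
  | nil => exact embedMatrix_one e
  | cons a l ih => simp [seqMatrix, embedMatrix_mul, ih]

/-- Inner products of columns of the tensor power factor over the copies, by exchanging the product
over copies with the sum over states of each copy. -/
theorem parallelMatrix_mem_unitary (n : ℕ) {M : Matrix (Q → Bool) (Q → Bool) ℂ}
    (hM : M ∈ Matrix.unitaryGroup (Q → Bool) ℂ) :
    parallelMatrix n M ∈ Matrix.unitaryGroup (Fin n × Q → Bool) ℂ := by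
  rw [Matrix.mem_unitaryGroup_iff', Matrix.star_eq_conjTranspose] at hM ⊢
  ext x z
  have hMe : ∀ a b, ∑ y, star (M y a) * M y b = if a = b then 1 else 0 := by
    intro a b
    rw [← Matrix.one_apply, ← hM, Matrix.mul_apply]
    rfl
  simp only [Matrix.mul_apply, Matrix.conjTranspose_apply, parallelMatrix, Matrix.of_apply]
  rw [← (Equiv.curry (Fin n) Q Bool).symm.sum_comp]
  simp only [Equiv.curry_symm_apply, Function.uncurry, star_prod, ← Finset.prod_mul_distrib]
  have h1 := Fintype.prod_sum (fun (k : Fin n) (y : Q → Bool) =>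
    star (M y (fun r => x (k, r))) * M y (fun r => z (k, r)))
  have h2 : (∑ y : Fin n → Q → Bool, ∏ k,
      star (M (fun r => y k r) (fun r => x (k, r))) * M (fun r => y k r) (fun r => z (k, r))) =
      ∏ k, if (fun r => x (k, r)) = (fun r => z (k, r)) then (1 : ℂ) else 0 := by
    rw [← h1]
    simp only [hMe]
  rw [h2, Matrix.one_apply]
  split_ifs with h
  · subst h; simp
  · obtain ⟨⟨k, r⟩, hk⟩ := Function.ne_iff.1 h
    refine Finset.prod_eq_zero (Finset.mem_univ k) ?_
    rw [if_neg]
    intro h'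
    exact hk (congrFun h' r)

/-! ### Renaming the wires of gates and layers -/

/-- A gate on the image of its wires under an embedding. -/
def Gate.map (e : W ↪ W') (g : Gate W) : Gate W' where
  target := e g.target
  controls := g.controls.map e
  target_notMem := by simpa using g.target_notMem
  op := g.op

theorem Gate.map_matrix (e : W ↪ W') (g : Gate W) :
    (g.map e).matrix = embedMatrix e g.matrix := by
  refine matrix_ext_mulVec fun v => ?_
  ext x
  rw [Gate.mulVec_apply, embedMatrix_mulVec]
  have h1 : (∑ q, g.matrix (fun a => x (e a)) q * v (Function.extend e q x)) =
    (g.matrix *ᵥ fun q => v (Function.extend e q x)) (fun a => x (e a)) := rfl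
  rw [h1, Gate.mulVec_apply]
  simp only [Gate.map, Finset.mem_map, forall_exists_index, and_imp, forall_apply_eq_imp_iff₂,
    extend_self]
  have h2 : ∀ b, Function.extend e (Function.update (fun a => x (e a)) g.target b) x =
      Function.update x (e g.target) b := by
    intro b
    ext w
    by_cases h : ∃ a, e a = w
    · obtain ⟨a, rfl⟩ := h
      rw [e.injective.extend_apply]
      simp only [Function.update_apply, e.injective.eq_iff]
    · rw [Function.extend_apply' _ _ _ h, Function.update_of_ne]
      rintro rfl
      exact h ⟨_, rfl⟩
  simp only [h2]

/-- A layer on the image of its wires under an embedding. -/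
def Layer.map (e : W ↪ W') (s : Layer W) : Layer W' where
  gates := s.gates.map (Gate.map e)
  disjoint := by
    rw [List.pairwise_map]
    refine s.disjoint.imp fun {g h} hgh => ?_
    have : ∀ g : Gate W, (g.map e).support = g.support.map e := by
      intro g
      simp [Gate.support, Gate.map, Finset.map_insert]
    rw [this, this]
    exact (Finset.disjoint_map e).2 hgh

theorem Layer.map_matrix (e : W ↪ W') (s : Layer W) :
    (s.map e).matrix = embedMatrix e s.matrix := by
  simp only [Layer.matrix, Layer.map, List.map_map]
  induction s.gates with
  | nil => exact (embedMatrix_one e).symm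
  | cons g l ih => simp [embedMatrix_mul, ih, Gate.map_matrix]

/-- The layer consisting of one gate. -/
def Layer.single (g : Gate W) : Layer W := ⟨[g], List.pairwise_singleton _ _⟩

theorem Layer.single_matrix (g : Gate W) : (Layer.single g).matrix = g.matrix := by
  simp [Layer.single, Layer.matrix]

/-- A step of an evaluation circuit, on the image of its wires under an embedding. -/
def EvalInstr.map {R : Type} {n : ℕ} (e : W ↪ W') : EvalInstr W Q R n → EvalInstr W' Q R n
  | .gates s => .gates (s.map e)
  | .prepare i => .prepare (i.trans e)
  | .integrate i => .integrate (i.trans e)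

theorem EvalInstr.map_matrix {R : Type} [Fintype R] [DecidableEq R] {n : ℕ} (e : W ↪ W')
    (U : Matrix (Q → Bool) (Q → Bool) ℂ) (V : Matrix (R → Bool) (R → Bool) ℂ)
    (i : EvalInstr W Q R n) : (i.map e).matrix U V = embedMatrix e (i.matrix U V) := by
  cases i with
  | gates s => exact s.map_matrix e
  | prepare i => exact embedMatrix_trans i e U
  | integrate i => exact embedMatrix_trans i e _

theorem EvalInstr.map_depth {R : Type} {n : ℕ} (e : W ↪ W') (p q : ℕ)
    (i : EvalInstr W Q R n) : (i.map e).depth p q = i.depth p q := by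
  cases i <;> rfl

theorem EvalInstr.map_atMostTwoControls {R : Type} {n : ℕ} (e : W ↪ W')
    {i : EvalInstr W Q R n} (h : i.AtMostTwoControls) : (i.map e).AtMostTwoControls := by
  cases i with
  | gates s =>
    intro g hg
    obtain ⟨g', hg', rfl⟩ := List.mem_map.1 hg
    simpa [Gate.map] using h g' hg'
  | prepare i => trivial
  | integrate i => trivial

theorem EvalInstr.matrix_mem_unitary {R : Type} [Fintype R] [DecidableEq R] {n : ℕ}
    {U : Matrix (Q → Bool) (Q → Bool) ℂ} {V : Matrix (R → Bool) (R → Bool) ℂ}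
    (hU : U ∈ Matrix.unitaryGroup (Q → Bool) ℂ) (hV : V ∈ Matrix.unitaryGroup (R → Bool) ℂ)
    (i : EvalInstr W Q R n) : i.matrix U V ∈ Matrix.unitaryGroup (W → Bool) ℂ := by
  cases i with
  | gates s => exact s.matrix_mem_unitary
  | prepare e => exact embedMatrix_mem_unitary e hU
  | integrate e => exact embedMatrix_mem_unitary e (parallelMatrix_mem_unitary n hV)

end

/-! ### Norms under unitary operators -/

section
variable {Q W W' : Type} [Fintype Q] [DecidableEq Q] [Fintype W] [DecidableEq W]
  [Fintype W'] [DecidableEq W']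

theorem star_mulVec_dotProduct_mulVec {B : Type*} [Fintype B] [DecidableEq B] {M : Matrix B B ℂ}
    (hM : M ∈ Matrix.unitaryGroup B ℂ) (v w : B → ℂ) :
    star (M *ᵥ v) ⬝ᵥ (M *ᵥ w) = star v ⬝ᵥ w := by
  rw [Matrix.mem_unitaryGroup_iff', Matrix.star_eq_conjTranspose] at hM
  rw [Matrix.star_mulVec, Matrix.dotProduct_mulVec, Matrix.vecMul_vecMul, hM, Matrix.vecMul_one]

/-- In this form a unitary can be cancelled against its adjoint; `d` is a classical observable. -/
theorem sum_mul_norm_sq_eq_dotProduct {B : Type*} [Fintype B] (d : B → ℝ) (v : B → ℂ) :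
    ((∑ x, d x * ‖v x‖ ^ 2 : ℝ) : ℂ) = star v ⬝ᵥ fun x => (d x : ℂ) * v x := by
  simp only [dotProduct, Pi.star_apply]
  push_cast
  refine Finset.sum_congr rfl fun x _ => ?_
  rw [← Complex.conj_mul']
  simp only [RCLike.star_def]
  ring

theorem sum_norm_sq_mulVec {B : Type*} [Fintype B] [DecidableEq B] {M : Matrix B B ℂ}
    (hM : M ∈ Matrix.unitaryGroup B ℂ) (v : B → ℂ) :
    ∑ x, ‖(M *ᵥ v) x‖ ^ 2 = ∑ x, ‖v x‖ ^ 2 := by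
  have h1 := sum_mul_norm_sq_eq_dotProduct (fun _ => 1) (M *ᵥ v)
  have h2 := sum_mul_norm_sq_eq_dotProduct (fun _ => 1) v
  simp only [one_mul, Complex.ofReal_one] at h1 h2
  have h3 := star_mulVec_dotProduct_mulVec hM v v
  have : (fun x => (M *ᵥ v) x) = M *ᵥ v := rfl
  rw [this] at h1
  exact_mod_cast h1.trans (h3.trans h2.symm)

/-- An embedded unitary preserves the squared norm with weights that do not depend on the wires
it acts on. -/
theorem sum_mul_norm_sq_embedMatrix (e : Q ↪ W) {M : Matrix (Q → Bool) (Q → Bool) ℂ}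
    (hM : M ∈ Matrix.unitaryGroup (Q → Bool) ℂ) (d : (W → Bool) → ℝ)
    (hd : ∀ q x, d (Function.extend e q x) = d x) (v : (W → Bool) → ℂ) :
    ∑ x, d x * ‖(embedMatrix e M *ᵥ v) x‖ ^ 2 = ∑ x, d x * ‖v x‖ ^ 2 := by
  have h1 := sum_mul_norm_sq_eq_dotProduct d (embedMatrix e M *ᵥ v)
  have h2 := sum_mul_norm_sq_eq_dotProduct d v
  -- The observable is constant along the wires that are acted on, so it commutes with the embedded
  -- operator.
  have h3 : (fun x => (d x : ℂ) * (embedMatrix e M *ᵥ v) x) =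
      embedMatrix e M *ᵥ fun x => (d x : ℂ) * v x := by
    ext x
    simp only [embedMatrix_mulVec, hd, Finset.mul_sum]
    exact Finset.sum_congr rfl fun q _ => by ring
  rw [h3, star_mulVec_dotProduct_mulVec (embedMatrix_mem_unitary e hM)] at h1
  exact_mod_cast h1.trans h2.symm

/-! ### Elementary gates -/

theorem notMatrix_mem : (Matrix.of fun a b : Bool => if a = b then (0 : ℂ) else 1) ∈
    Matrix.unitaryGroup Bool ℂ := by
  rw [Matrix.mem_unitaryGroup_iff']
  ext a b
  cases a <;> cases b <;> simp [Matrix.mul_apply, Matrix.star_eq_conjTranspose]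

theorem phaseMatrix_mem (φ : ℝ) : (Matrix.of fun a b : Bool =>
    if a = b then (if a then Complex.exp (φ * Complex.I) else 1) else 0) ∈
    Matrix.unitaryGroup Bool ℂ := by
  rw [Matrix.mem_unitaryGroup_iff']
  have h : (starRingEnd ℂ) (Complex.exp (φ * Complex.I)) * Complex.exp (φ * Complex.I) = 1 := by
    rw [Complex.conj_mul', Complex.norm_exp_ofReal_mul_I]; simp
  ext a b
  cases a <;> cases b <;> simp [Matrix.mul_apply, Matrix.star_eq_conjTranspose, h]

theorem hadamardMatrix_mem : (Matrix.of fun a b : Bool =>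
    ((√2)⁻¹ : ℂ) * if a && b then -1 else 1) ∈ Matrix.unitaryGroup Bool ℂ := by
  rw [Matrix.mem_unitaryGroup_iff']
  have h : ((√2 : ℝ) : ℂ)⁻¹ * ((√2 : ℝ) : ℂ)⁻¹ = 1 / 2 := by
    rw [← mul_inv, ← Complex.ofReal_mul, Real.mul_self_sqrt (by norm_num)]; norm_num
  ext a b
  cases a <;> cases b <;> simp [Matrix.mul_apply, Matrix.star_eq_conjTranspose, h]
  all_goals norm_num

/-- The (multi-)controlled NOT gate. -/
noncomputable def notGate (t : W) (C : Finset W) : Gate W :=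
  -- Erasing the target makes the gate meaningful for every `C`; a target listed among its own
  -- controls is ignored.
  ⟨t, C.erase t, Finset.notMem_erase t C, ⟨_, notMatrix_mem⟩⟩

/-- The (multi-)controlled phase gate. -/
noncomputable def phaseGate (t : W) (C : Finset W) (φ : ℝ) : Gate W :=
  ⟨t, C.erase t, Finset.notMem_erase t C, ⟨_, phaseMatrix_mem φ⟩⟩

/-- The Hadamard gate. -/
noncomputable def hadamardGate (t : W) : Gate W :=
  ⟨t, ∅, Finset.notMem_empty t, ⟨_, hadamardMatrix_mem⟩⟩

/-- The action of `notGate` on basis states. -/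
def flipIf (t : W) (C : Finset W) (x : W → Bool) : W → Bool :=
  if ∀ c ∈ C.erase t, x c = true then Function.update x t (!x t) else x

theorem flipIf_involutive (t : W) (C : Finset W) : Function.Involutive (flipIf t C) := by
  intro x
  by_cases h : ∀ c ∈ C.erase t, x c = true
  · have h' : ∀ c ∈ C.erase t, Function.update x t (!x t) c = true := by
      intro c hc
      rw [Function.update_of_ne (Finset.ne_of_mem_erase hc), h c hc]
    have h1 : flipIf t C x = Function.update x t (!x t) := if_pos h
    rw [h1, flipIf, if_pos h']
    simp
  · have h1 : flipIf t C x = x := if_neg h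
    rw [h1, h1]

theorem flipIf_of_ne {t w : W} (h : w ≠ t) (C : Finset W) (x : W → Bool) :
    flipIf t C x w = x w := by
  unfold flipIf
  split_ifs
  · rw [Function.update_of_ne h]
  · rfl

theorem notGate_mulVec (t : W) (C : Finset W) (v : (W → Bool) → ℂ) (x : W → Bool) :
    ((notGate t C).matrix *ᵥ v) x = v (flipIf t C x) := by
  rw [Gate.mulVec_apply]
  simp only [notGate, flipIf, Fintype.sum_bool, Matrix.of_apply]
  split_ifs <;> cases h : x t <;> simp_all

theorem phaseGate_mulVec (t : W) (C : Finset W) (φ : ℝ) (v : (W → Bool) → ℂ) (x : W → Bool) :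
    ((phaseGate t C φ).matrix *ᵥ v) x =
      (if x t = true ∧ ∀ c ∈ C, x c = true then Complex.exp (φ * Complex.I) else 1) * v x := by
  rw [Gate.mulVec_apply]
  simp only [phaseGate, Fintype.sum_bool, Matrix.of_apply]
  have hC : (x t = true ∧ ∀ c ∈ C, x c = true) ↔
      x t = true ∧ ∀ c ∈ C.erase t, x c = true := by
    refine and_congr_right fun ht => ⟨fun h c hc => h c (Finset.mem_of_mem_erase hc),
      fun h c hc => ?_⟩
    by_cases hct : c = t
    · rw [hct, ht]
    · exact h c (Finset.mem_erase.2 ⟨hct, hc⟩)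
  simp only [hC]
  by_cases h : ∀ c ∈ C.erase t, x c = true
  · rw [if_pos h]
    cases hx : x t
    · have := Function.update_eq_self t x
      rw [hx] at this
      simp [this]
    · have := Function.update_eq_self t x
      rw [hx] at this
      have h' : (true = true ∧ ∀ c ∈ C.erase t, x c = true) := ⟨rfl, h⟩
      rw [if_pos h']
      simp [this]
  · rw [if_neg h, if_neg (fun h' => h h'.2), one_mul]

theorem hadamardGate_mulVec (t : W) (v : (W → Bool) → ℂ) (x : W → Bool) :
    ((hadamardGate t).matrix *ᵥ v) x = (√2 : ℂ)⁻¹ * (v (Function.update x t false) +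
      (if x t then -1 else 1) * v (Function.update x t true)) := by
  rw [Gate.mulVec_apply]
  simp only [hadamardGate, Fintype.sum_bool, Matrix.of_apply]
  rw [if_pos (by simp)]
  cases x t <;> simp <;> ring

/-- The layer of NOT gates on the image of `e`. -/
noncomputable def flipLayer (e : Q ↪ W) : Layer W where
  gates := Finset.univ.toList.map fun a => notGate (e a) ∅
  disjoint := by
    rw [List.pairwise_map]
    refine (Finset.nodup_toList (Finset.univ : Finset Q)).imp fun {a b} h => ?_
    simpa [Gate.support, notGate] using h

theorem flipLayer_mulVec (e : Q ↪ W) (v : (W → Bool) → ℂ) (x : W → Bool) :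
    ((flipLayer e).matrix *ᵥ v) x = v (Function.extend e (fun a => !x (e a)) x) := by
  -- The order of `Finset.univ.toList` is unknown, so the induction runs over arbitrary
  -- duplicate-free lists; no wire is flipped twice.
  have key : ∀ l : List Q, l.Nodup → ∀ x,
      (((l.map fun a => notGate (e a) ∅).map Gate.matrix).prod *ᵥ v) x =
        v fun w => if w ∈ l.map e then !x w else x w := by
    intro l
    induction l with
    | nil => intro _ x; simp
    | cons a l ih =>
      intro hl x
      obtain ⟨ha, hl⟩ := List.nodup_cons.1 hl
      rw [List.map_cons, List.map_cons, List.prod_cons, ← Matrix.mulVec_mulVec, notGate_mulVec,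
        ih hl]
      congr 1
      ext w
      have hf : flipIf (e a) ∅ x = Function.update x (e a) (!x (e a)) := by simp [flipIf]
      rw [hf]
      by_cases hw : w = e a
      · subst hw
        simp [ha]
      · simp [hw]
  have h := key _ (Finset.nodup_toList (Finset.univ : Finset Q)) x
  refine h.trans ?_
  congr 1
  ext w
  by_cases hw : ∃ a, e a = w
  · obtain ⟨a, rfl⟩ := hw
    rw [e.injective.extend_apply]
    simp
  · rw [Function.extend_apply' _ _ _ hw, if_neg]
    simpa using hw

/-! ### Reversible classical computations -/

/-- The action of a sequence of NOT gates, given by their targets and controls, on basis states. -/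
def runFlips : List (W × Finset W) → (W → Bool) → W → Bool
  | [], x => x
  | g :: l, x => runFlips l (flipIf g.1 g.2 x)

theorem runFlips_append (l₁ l₂ : List (W × Finset W)) (x : W → Bool) :
    runFlips (l₁ ++ l₂) x = runFlips l₂ (runFlips l₁ x) := by
  induction l₁ generalizing x with
  | nil => rfl
  | cons g l ih => exact ih _

theorem runFlips_bijective (l : List (W × Finset W)) : Function.Bijective (runFlips l) := by
  induction l with
  | nil => exact Function.bijective_id
  | cons g l ih => exact ih.comp (flipIf_involutive g.1 g.2).bijective

theorem runFlips_of_ne {w : W} {l : List (W × Finset W)} (h : ∀ g ∈ l, g.1 ≠ w)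
    (x : W → Bool) : runFlips l x w = x w := by
  induction l generalizing x with
  | nil => rfl
  | cons g l ih =>
    rw [runFlips, ih fun g' hg' => h g' (List.mem_cons_of_mem _ hg'),
      flipIf_of_ne (h g List.mem_cons_self).symm]

/-- NOT gates permute the basis states and carry the amplitudes along; evaluating at the image of
`x` avoids the inverse permutation. -/
theorem seqMatrix_notGate_mulVec (l : List (W × Finset W)) (v : (W → Bool) → ℂ) (x : W → Bool) :
    (seqMatrix (l.map fun g => (Layer.single (notGate g.1 g.2)).matrix) *ᵥ v) (runFlips l x) =
      v x := by
  induction l generalizing x v with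
  | nil => simp [seqMatrix, runFlips]
  | cons g l ih =>
    rw [List.map_cons, seqMatrix, ← Matrix.mulVec_mulVec, runFlips, ih, Layer.single_matrix,
      notGate_mulVec, flipIf_involutive]

/-- The exclusive or of the conjunctions of the bits in each of the given sets. -/
def xorOfAnds (C : List (Finset W)) (z : W → Bool) : Bool :=
  C.foldr (fun c b => xor (decide (∀ w ∈ c, z w = true)) b) false

/-- No monomial contains the target, so the bits read by later gates are not disturbed by earlier
ones, and the flips accumulate modulo 2. -/
theorem runFlips_same_target {t : W} {z : W → Bool} {C : List (Finset W)} {x : W → Bool}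
    (ht : ∀ c ∈ C, t ∉ c) (hx : ∀ c ∈ C, ∀ w ∈ c, x w = z w) :
    runFlips (C.map (Prod.mk t)) x = Function.update x t (xor (xorOfAnds C z) (x t)) := by
  induction C generalizing x with
  | nil => simp [runFlips, xorOfAnds]
  | cons c C ih =>
    have htc := ht c List.mem_cons_self
    have hxc := hx c List.mem_cons_self
    rw [List.map_cons, runFlips, ih fun c' hc' => ht c' (List.mem_cons_of_mem _ hc')]
    · have h1 : (∀ w ∈ c.erase t, x w = true) ↔ ∀ w ∈ c, z w = true := by
        rw [Finset.erase_eq_of_notMem htc]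
        exact forall₂_congr fun w hw => by rw [hxc w hw]
      ext w
      by_cases hw : w = t
      · subst hw
        simp only [Function.update_self, flipIf, h1, xorOfAnds, List.foldr_cons]
        by_cases h : ∀ w ∈ c, z w = true
        · rw [if_pos h]
          rw [decide_eq_true h]
          simp
        · rw [if_neg h]
          rw [decide_eq_false h]
          simp
      · rw [Function.update_of_ne hw, Function.update_of_ne hw, flipIf_of_ne hw]
    · intro c' hc' w hw
      rw [flipIf_of_ne, hx c' (List.mem_cons_of_mem _ hc') w hw]
      rintro rfl
      exact ht c' (List.mem_cons_of_mem _ hc') hw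

/-- The gates of a straight-line program: each step `(t, C)` adds `xorOfAnds C` to the bit `t`. -/
def programFlips (p : List (W × List (Finset W))) : List (W × Finset W) :=
  p.flatMap fun b => b.2.map (Prod.mk b.1)

/-- This reduces the verification of a reversible computation to checking equations in its final
state `z`. No step reads its own target or a later one, so every wire already has its final value
when it is read. -/
theorem runFlips_programFlips {p : List (W × List (Finset W))} {z : W → Bool}
    (hz : ∀ b ∈ p, z b.1 = xorOfAnds b.2 z) (hself : ∀ b ∈ p, ∀ c ∈ b.2, b.1 ∉ c)
    (hord : p.Pairwise fun b b' => b.1 ≠ b'.1 ∧ ∀ c ∈ b.2, b'.1 ∉ c) :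
    runFlips (programFlips p) (fun w => if w ∈ p.map Prod.fst then false else z w) = z := by
  induction p with
  | nil => simp [programFlips, runFlips]
  | cons b p ih =>
    obtain ⟨hb, hord⟩ := List.pairwise_cons.1 hord
    have hstep : programFlips (b :: p) = b.2.map (Prod.mk b.1) ++ programFlips p := by
      simp [programFlips]
    rw [hstep, runFlips_append, runFlips_same_target (z := z) (hself b List.mem_cons_self)]
    · rw [← hz b List.mem_cons_self]
      -- After the first block the target `b.1` holds its final value and only the later targets are
      -- still cleared: this is the initial state of the remaining program.
      conv_rhs => rw [← ih (fun b' hb' => hz b' (List.mem_cons_of_mem _ hb'))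
        (fun b' hb' => hself b' (List.mem_cons_of_mem _ hb')) hord]
      congr 1
      ext w
      by_cases hw : w = b.1
      · subst hw
        have : b.1 ∉ p.map Prod.fst := by
          intro h
          obtain ⟨b', hb', h⟩ := List.mem_map.1 h
          exact (hb b' hb').1 h.symm
        simp only [Function.update_self, if_neg this]
        simp
      · rw [Function.update_of_ne hw, List.map_cons]
        simp only [List.mem_cons, hw, false_or]
    · intro c hc w hw
      rw [if_neg]
      simp only [List.map_cons, List.mem_cons, not_or, List.mem_map, not_exists, not_and]
      refine ⟨?_, ?_⟩
      · rintro rfl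
        exact hself b List.mem_cons_self c hc hw
      · rintro b' hb' rfl
        exact (hb b' hb').2 c hc hw

end

/-! ### Evaluation circuits -/

section
variable {Q R W : Type} [Fintype Q] [DecidableEq Q] [Fintype R] [DecidableEq R]
  [Fintype W] [DecidableEq W] {n : ℕ}

/-- Prepare the process, run the NOT gates `p`, apply the integral circuits, and do a Hadamard test
on the qubit `t` with the phases `κ * a` controlled by pairs of wires, and the phase `φ`. -/
noncomputable def evalInstrs (eQ : Q ↪ W) (eR : Fin n × R ↪ W) (t : W) (p : List (W × Finset W))
    (ph : List (W × W × ℝ)) (κ φ : ℝ) : List (EvalInstr W Q R n) :=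
  .prepare eQ :: (p.map (fun g => .gates (Layer.single (notGate g.1 g.2))) ++
    (.integrate eR :: .gates (Layer.single (hadamardGate t)) ::
    (ph.map (fun a => .gates (Layer.single (phaseGate t {a.1, a.2.1} (κ * a.2.2)))) ++
    [.gates (Layer.single (phaseGate t ∅ φ)), .gates (Layer.single (hadamardGate t))])))

theorem evalInstrs_depth (eQ : Q ↪ W) (eR : Fin n × R ↪ W) (t : W) (p : List (W × Finset W))
    (ph : List (W × W × ℝ)) (κ φ : ℝ) (dp dq : ℕ) :
    ((evalInstrs eQ eR t p ph κ φ).map (EvalInstr.depth dp dq)).sum =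
      dp + dq + p.length + ph.length + 3 := by
  simp [evalInstrs, EvalInstr.depth, Function.comp_def]
  ring

theorem evalInstrs_atMostTwoControls (eQ : Q ↪ W) (eR : Fin n × R ↪ W) (t : W)
    {p : List (W × Finset W)} (hp : ∀ g ∈ p, g.2.card ≤ 2)
    (ph : List (W × W × ℝ)) (κ φ : ℝ) :
    ∀ s ∈ evalInstrs eQ eR t p ph κ φ, s.AtMostTwoControls := by
  intro s hs
  simp only [evalInstrs, List.mem_cons, List.mem_append, List.mem_map, List.not_mem_nil,
    or_false] at hs
  rcases hs with rfl | ⟨g, hg, rfl⟩ | rfl | rfl | ⟨a, -, rfl⟩ | rfl | rfl <;>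
    simp only [EvalInstr.AtMostTwoControls, Layer.single, List.mem_singleton, forall_eq]
  · exact (Finset.card_erase_le).trans (hp g hg)
  · simp [hadamardGate]
  · exact (Finset.card_erase_le).trans Finset.card_le_two
  · simp [phaseGate]
  · simp [hadamardGate]

/-- The sum of the numbers whose two wires are set. -/
noncomputable def phaseSum (ph : List (W × W × ℝ)) (x : W → Bool) : ℝ :=
  (ph.map fun a => if x a.1 = true ∧ x a.2.1 = true then a.2.2 else 0).sum

/-- The gates are diagonal, so their exponents add. The factor `κ` is kept apart from the list so
that one list serves all frequencies, and with `κ = 1` the Fourier transform. -/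
theorem phases_mulVec (t : W) (ph : List (W × W × ℝ)) (κ : ℝ) (v : (W → Bool) → ℂ)
    (x : W → Bool) :
    (seqMatrix (ph.map fun a => (Layer.single (phaseGate t {a.1, a.2.1} (κ * a.2.2))).matrix)
      *ᵥ v) x =
      (if x t then Complex.exp ((κ * phaseSum ph x : ℝ) * Complex.I) else 1) * v x := by
  induction ph generalizing v with
  | nil => simp [seqMatrix, phaseSum]
  | cons a ph ih =>
    rw [List.map_cons, seqMatrix, ← Matrix.mulVec_mulVec, ih, Layer.single_matrix,
      phaseGate_mulVec, ← mul_assoc]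
    congr 1
    have hc : (∀ c ∈ ({a.1, a.2.1} : Finset W), x c = true) ↔
        (x a.1 = true ∧ x a.2.1 = true) := by simp
    simp only [hc, phaseSum, List.map_cons, List.sum_cons]
    by_cases h1 : x t = true
    · by_cases h2 : x a.1 = true ∧ x a.2.1 = true
      · rw [if_pos h1, if_pos ⟨h1, h2⟩, if_pos h1, if_pos h2, ← Complex.exp_add]
        congr 1
        push_cast
        ring
      · rw [if_pos h1, if_neg (fun h => h2 h.2), if_pos h1, if_neg h2]
        simp
    · rw [if_neg h1, if_neg (fun h => h1 h.1), if_neg h1, mul_one]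

theorem mulVec_single_zero (M : Matrix (W → Bool) (W → Bool) ℂ) (b : W → Bool) :
    (M *ᵥ Pi.single (fun _ => false) 1) b = M b fun _ => false := by
  simp

/-- The state after the preparation of the process and the classical computation, whose result is
`z`. -/
theorem prepared_mulVec (eQ : Q ↪ W) (U : Matrix (Q → Bool) (Q → Bool) ℂ)
    (p : List (W × Finset W)) (hp : ∀ g ∈ p, ∀ a, g.1 ≠ eQ a) (z : (Q → Bool) → W → Bool)
    (hz : ∀ q, runFlips p (Function.extend eQ q fun _ => false) = z q) (x : W → Bool) :
    (seqMatrix (p.map fun g => (Layer.single (notGate g.1 g.2)).matrix) *ᵥ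
      (embedMatrix eQ U *ᵥ Pi.single (fun _ => false) 1)) x =
      if x = z (fun a => x (eQ a)) then U (fun a => x (eQ a)) fun _ => false else 0 := by
  obtain ⟨y, rfl⟩ := (runFlips_bijective p).2 x
  rw [seqMatrix_notGate_mulVec]
  have hQ : (fun a => runFlips p y (eQ a)) = fun a => y (eQ a) :=
    funext fun a => runFlips_of_ne (fun g hg => hp g hg a) y
  rw [hQ, ← hz, if_congr (runFlips_bijective p).1.eq_iff rfl rfl,
    mulVec_single_zero (embedMatrix eQ U) y]
  simp only [embedMatrix, Matrix.of_apply]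
  refine if_congr ⟨fun h => ?_, fun h w hw => ?_⟩ rfl rfl
  · ext w
    by_cases hw : ∃ a, eQ a = w
    · obtain ⟨a, rfl⟩ := hw
      rw [eQ.injective.extend_apply]
    · rw [Function.extend_apply' _ _ _ hw]
      exact h w (by simpa using hw)
  · rw [h, Function.extend_apply' _ _ _ (by simpa using hw)]

/-- The probability to measure `1` in a Hadamard test. -/
theorem evalInstrs_targetProb (eQ : Q ↪ W) (eR : Fin n × R ↪ W) (t : W)
    (hQR : ∀ a b, eQ a ≠ eR b) (htR : ∀ b, eR b ≠ t)
    {U : Matrix (Q → Bool) (Q → Bool) ℂ} {V : Matrix (R → Bool) (R → Bool) ℂ}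
    (hV : V ∈ Matrix.unitaryGroup (R → Bool) ℂ)
    (p : List (W × Finset W)) (hp : ∀ g ∈ p, ∀ a, g.1 ≠ eQ a) (z : (Q → Bool) → W → Bool)
    (hz : ∀ q, runFlips p (Function.extend eQ q fun _ => false) = z q) (hzt : ∀ q, z q t = false)
    (ph : List (W × W × ℝ)) (hph : ∀ a ∈ ph, a.1 ≠ t ∧ a.2.1 ≠ t)
    (Jq : (Q → Bool) → ℝ)
    (hJ : ∀ q x, U q (fun _ => false) ≠ 0 → (∀ a, x (eQ a) = q a) →
      (∀ j, V (fun r => x (eR (j, r))) (fun r => z q (eR (j, r))) ≠ 0) → phaseSum ph x = Jq q)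
    (κ φ : ℝ) :
    (∑ x : W → Bool, if x t then
      outcomeProb (seqMatrix ((evalInstrs eQ eR t p ph κ φ).map (EvalInstr.matrix U V))) x else 0) =
    ∑ q, outcomeProb U q * ((1 - Real.cos (κ * Jq q + φ)) / 2) := by
  set v2 := seqMatrix (p.map fun g => (Layer.single (notGate g.1 g.2)).matrix) *ᵥ
      (embedMatrix eQ U *ᵥ Pi.single (fun _ => false) 1) with hv2
  have hv2x := prepared_mulVec eQ U p hp z hz
  rw [← hv2] at hv2x
  set v3 := embedMatrix eR (parallelMatrix n V) *ᵥ v2 with hv3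
  have hzQ : ∀ q a, z q (eQ a) = q a := by
    intro q a
    rw [← hz, runFlips_of_ne (fun g hg => hp g hg a), eQ.injective.extend_apply]
  have hext : ∀ ρ (x : W → Bool), (fun a => Function.extend eR ρ x (eQ a)) = fun a => x (eQ a) := by
    intro ρ x
    ext a
    rw [Function.extend_apply']
    rintro ⟨b, hb⟩
    exact hQR a b hb.symm
  -- The integral circuits may entangle their wires with garbage, so only the support of the state
  -- is controlled: each copy is in a state reachable from its classical input. By `hJ` this
  -- determines the phase.
  have hsupp : ∀ x, v3 x ≠ 0 → x t = false ∧ U (fun a => x (eQ a)) (fun _ => false) ≠ 0 ∧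
      ∀ j, V (fun r => x (eR (j, r))) (fun r => z (fun a => x (eQ a)) (eR (j, r))) ≠ 0 := by
    intro x hx
    rw [hv3, embedMatrix_mulVec] at hx
    obtain ⟨ρ, -, hρ⟩ := Finset.exists_ne_zero_of_sum_ne_zero hx
    rw [hv2x, hext] at hρ
    obtain ⟨hρ1, hρ2⟩ := mul_ne_zero_iff.1 hρ
    have h3 : Function.extend eR ρ x = z (fun a => x (eQ a)) := by
      by_contra h
      exact hρ2 (if_neg h)
    rw [if_pos h3] at hρ2
    refine ⟨?_, hρ2, fun j => ?_⟩
    · have := congrFun h3 t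
      rw [hzt, Function.extend_apply'] at this
      · exact this
      · rintro ⟨b, hb⟩
        exact htR b hb
    · simp only [parallelMatrix, Matrix.of_apply] at hρ1
      have h4 := (Finset.prod_ne_zero_iff.1 hρ1) j (Finset.mem_univ j)
      have h5 : (fun r => z (fun a => x (eQ a)) (eR (j, r))) = fun r => ρ (j, r) := by
        ext r
        rw [← h3, eR.injective.extend_apply]
      rw [h5]
      exact h4
  -- The integral circuits do not touch the preparation wires, and the NOT gates only append a
  -- function of them; the law of these wires is still that of the prepared state.
  have hsum : ∀ d : (Q → Bool) → ℝ, ∑ x, d (fun a => x (eQ a)) * ‖v3 x‖ ^ 2 =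
      ∑ q, d q * outcomeProb U q := by
    intro d
    rw [hv3, sum_mul_norm_sq_embedMatrix eR (parallelMatrix_mem_unitary n hV)
      (fun x => d fun a => x (eQ a)) (fun q x => by rw [hext])]
    have h1 : ∀ x, d (fun a => x (eQ a)) * ‖v2 x‖ ^ 2 = if x = z (fun a => x (eQ a)) then
        d (fun a => x (eQ a)) * outcomeProb U (fun a => x (eQ a)) else 0 := by
      intro x
      rw [hv2x]
      split_ifs
      · rfl
      · simp
    simp only [h1]
    rw [sum_ite_eq_sum_of_range z]
    · simp only [hzQ]
    · intro q q' h
      ext a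
      rw [← hzQ q, h, hzQ]
    · intro x
      constructor
      · exact fun h => ⟨_, h.symm⟩
      · rintro ⟨q, rfl⟩
        simp only [hzQ]
  have hps : ∀ x b, phaseSum ph (Function.update x t b) = phaseSum ph x := by
    intro x b
    unfold phaseSum
    congr 1
    refine List.map_congr_left fun a ha => ?_
    rw [Function.update_of_ne (hph a ha).1, Function.update_of_ne (hph a ha).2]
  have hfinal : ∀ x, seqMatrix ((evalInstrs eQ eR t p ph κ φ).map (EvalInstr.matrix U V)) x
      (fun _ => false) = ((√2 : ℂ)⁻¹ * (√2 : ℂ)⁻¹) * ((1 + (if x t then -1 else 1) *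
        Complex.exp ((κ * phaseSum ph x + φ : ℝ) * Complex.I)) *
        v3 (Function.update x t false)) := by
    intro x
    -- The target is still 0 before the first Hadamard gate, so only one of the two branches of that
    -- gate survives.
    have hw : ∀ y : W → Bool, v3 (Function.update y t true) = 0 := by
      intro y
      by_contra h
      have := (hsupp _ h).1
      simp at this
    rw [← mulVec_single_zero (seqMatrix _) x]
    simp only [evalInstrs, List.map_cons, List.map_append, List.map_map, Function.comp_def,
      EvalInstr.matrix, seqMatrix, seqMatrix_append, List.map_nil, one_mul, mul_assoc,
      ← Matrix.mulVec_mulVec]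
    rw [← hv2, ← hv3]
    simp only [Layer.single_matrix (hadamardGate t), Layer.single_matrix (phaseGate t ∅ φ),
      hadamardGate_mulVec, phaseGate_mulVec, phases_mulVec, Function.update_self,
      Function.update_idem, hps, hw]
    simp only [Finset.notMem_empty, false_imp_iff, implies_true, and_true, Bool.false_eq_true,
      if_false, if_true, one_mul, mul_zero, add_zero]
    have : Complex.exp ((κ * phaseSum ph x + φ : ℝ) * Complex.I) =
        Complex.exp (φ * Complex.I) * Complex.exp ((κ * phaseSum ph x : ℝ) * Complex.I) := by
      rw [← Complex.exp_add]
      congr 1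
      push_cast
      ring
    rw [this]
    ring
  have hs2 : ‖(√2 : ℂ)⁻¹ * (√2 : ℂ)⁻¹‖ = 1 / 2 := by
    rw [← mul_inv, ← Complex.ofReal_mul, Real.mul_self_sqrt (by norm_num)]; norm_num
  have hcos : ∀ θ : ℝ, ‖1 - Complex.exp (θ * Complex.I)‖ ^ 2 = 2 * (1 - Real.cos θ) := by
    intro θ
    have h : 1 - Complex.exp (θ * Complex.I) =
        ((1 - Real.cos θ : ℝ) : ℂ) + ((-Real.sin θ : ℝ) : ℂ) * Complex.I := by
      rw [Complex.exp_mul_I]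
      push_cast
      ring
    rw [h, Complex.sq_norm, Complex.normSq_add_mul_I]
    nlinarith [Real.sin_sq_add_cos_sq θ]
  have hterm : ∀ x : W → Bool, (if x t = true then
      outcomeProb (seqMatrix ((evalInstrs eQ eR t p ph κ φ).map (EvalInstr.matrix U V))) x else 0) =
      if x t = true then ((1 - Real.cos (κ * Jq (fun a => flipIf t ∅ x (eQ a)) + φ)) / 2) *
        ‖v3 (flipIf t ∅ x)‖ ^ 2 else 0 := by
    intro x
    refine if_ctx_congr Iff.rfl (fun hx => ?_) fun _ => rfl
    have hfl : flipIf t ∅ x = Function.update x t false := by simp [flipIf, hx]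
    rw [outcomeProb, hfinal, if_pos hx, hfl]
    by_cases hv : v3 (Function.update x t false) = 0
    · simp [hv]
    · obtain ⟨-, hU, hVj⟩ := hsupp _ hv
      have := hJ _ _ hU (fun a => rfl) hVj
      rw [hps] at this
      rw [← this, norm_mul (_ * _), norm_mul (1 + _), hs2, mul_pow, mul_pow, neg_one_mul, ← sub_eq_add_neg, hcos]
      ring
  rw [Finset.sum_congr rfl fun x _ => hterm x]
  -- Flipping the target matches the final states with target 1 to states with target 0, which carry
  -- all of the norm of `v3`.
  have hre := Equiv.sum_comp (flipIf_involutive t (∅ : Finset W)).toPerm fun x => if x t = true then 0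
    else ((1 - Real.cos (κ * Jq (fun a => x (eQ a)) + φ)) / 2) * ‖v3 x‖ ^ 2
  have hflt : ∀ x : W → Bool, flipIf t ∅ x t = !x t := by intro x; simp [flipIf]
  refine Eq.trans ?_ (hre.trans ?_)
  · refine Finset.sum_congr rfl fun x _ => ?_
    simp only [Function.Involutive.coe_toPerm, hflt]
    cases x t <;> simp
  · have h0 : ∀ x : W → Bool, (if x t = true then 0
        else ((1 - Real.cos (κ * Jq (fun a => x (eQ a)) + φ)) / 2) * ‖v3 x‖ ^ 2) =
        ((1 - Real.cos (κ * Jq (fun a => x (eQ a)) + φ)) / 2) * ‖v3 x‖ ^ 2 := by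
      intro x
      split_ifs with hx
      · have : v3 x = 0 := by
          by_contra h
          have := (hsupp x h).1
          simp [hx] at this
        simp [this]
      · rfl
    rw [Finset.sum_congr rfl fun x _ => h0 x, hsum fun q => (1 - Real.cos (κ * Jq q + φ)) / 2]
    exact Finset.sum_congr rfl fun q _ => mul_comm _ _

end

/-! ### The quantum Fourier transform -/

section
variable {K : ℕ}

/-- The controlled phases of one stage of the quantum Fourier transform. -/
noncomputable def qftPhases (j : Fin K) : List (Fin K × Fin K × ℝ) :=
  (List.finRange K).map fun i => (i, i, if i < j then Real.pi * 2 ^ (i : ℕ) / 2 ^ (j : ℕ) else 0)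

/-- One stage of the quantum Fourier transform. -/
noncomputable def qftStage (j : Fin K) : List (Gate (Fin K)) :=
  hadamardGate j :: (qftPhases j).map fun a => phaseGate j {a.1, a.2.1} (1 * a.2.2)

/-- The last `m` stages of the quantum Fourier transform. -/
noncomputable def qftStages (K : ℕ) : ℕ → List (Gate (Fin K))
  | 0 => []
  | m + 1 => (if h : m < K then qftStage ⟨m, h⟩ else []) ++ qftStages K m

/-- The operator of a sequence of gates. -/
noncomputable def gatesMatrix {W : Type} [Fintype W] [DecidableEq W] (l : List (Gate W)) :
    Matrix (W → Bool) (W → Bool) ℂ :=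
  seqMatrix (l.map fun g => (Layer.single g).matrix)

theorem gatesMatrix_cons {W : Type} [Fintype W] [DecidableEq W] (g : Gate W)
    (l : List (Gate W)) : gatesMatrix (g :: l) = gatesMatrix l * g.matrix := by
  simp [gatesMatrix, seqMatrix, Layer.single_matrix]

theorem gatesMatrix_append {W : Type} [Fintype W] [DecidableEq W]
    (l l' : List (Gate W)) : gatesMatrix (l ++ l') = gatesMatrix l' * gatesMatrix l := by
  simp [gatesMatrix, seqMatrix_append]

theorem gatesMatrix_mem_unitary {W : Type} [Fintype W] [DecidableEq W] (l : List (Gate W)) :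
    gatesMatrix l ∈ Matrix.unitaryGroup (W → Bool) ℂ := by
  apply seqMatrix_mem_unitary
  intro M hM
  obtain ⟨g, -, rfl⟩ := List.mem_map.1 hM
  exact (Layer.single g).matrix_mem_unitary

/-- The phase that the stage `j` of the quantum Fourier transform contributes. -/
noncomputable def qftAngle (x y : Fin K → Bool) (j : Fin K) : ℝ :=
  if y j then ∑ i, if i ≤ j ∧ x i = true then Real.pi * 2 ^ (i : ℕ) / 2 ^ (j : ℕ) else 0 else 0

/-- Here `v` is the state halfway through the transform: the qubits up to `j` still hold bits of
`x`, and `h` collects the amplitudes of the stages already done. The Hadamard sign is the term i = j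
of `qftAngle`, and the controlled phases are the terms i < j. -/
theorem qftStage_mulVec (j : Fin K) (x : Fin K → Bool) (v h : (Fin K → Bool) → ℂ)
    (hv : ∀ y, v y = if ∀ i ≤ j, y i = x i then h y else 0)
    (hh : ∀ y i b, i ≤ j → h (Function.update y i b) = h y) (y : Fin K → Bool) :
    (gatesMatrix (qftStage j) *ᵥ v) y = if ∀ i < j, y i = x i then
      ((√2 : ℂ)⁻¹ * Complex.exp (qftAngle x y j * Complex.I)) * h y else 0 := by
  have hm : gatesMatrix (qftStage j) = seqMatrix ((qftPhases j).map fun a =>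
      (Layer.single (phaseGate j {a.1, a.2.1} (1 * a.2.2))).matrix) * (hadamardGate j).matrix := by
    rw [qftStage, gatesMatrix_cons, gatesMatrix, List.map_map]
    rfl
  rw [hm, ← Matrix.mulVec_mulVec, phases_mulVec, hadamardGate_mulVec]
  have hup : ∀ b, v (Function.update y j b) =
      if (∀ i < j, y i = x i) ∧ b = x j then h y else 0 := by
    intro b
    rw [hv, hh _ _ _ le_rfl]
    refine if_congr ⟨fun H => ⟨fun i hi => ?_, ?_⟩, fun H i hi => ?_⟩ rfl rfl
    · rw [← H i hi.le, Function.update_of_ne hi.ne]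
    · rw [← H j le_rfl, Function.update_self]
    · rcases hi.lt_or_eq with hi | rfl
      · rw [Function.update_of_ne hi.ne, H.1 i hi]
      · rw [Function.update_self, H.2]
  by_cases hy : ∀ i < j, y i = x i
  · have hup' : ∀ b, v (Function.update y j b) = if b = x j then h y else 0 := by
      intro b
      rw [hup]
      exact if_congr (and_iff_right hy) rfl rfl
    rw [hup', hup', if_pos hy]
    have hps : phaseSum (qftPhases j) y =
        ∑ i, if i < j ∧ x i = true then Real.pi * 2 ^ (i : ℕ) / 2 ^ (j : ℕ) else 0 := by
      rw [phaseSum, qftPhases, List.map_map, ← List.ofFn_eq_map, List.sum_ofFn]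
      refine Finset.sum_congr rfl fun i _ => ?_
      simp only [Function.comp, and_self]
      by_cases hi : i < j
      · simp [hi, hy i hi]
      · simp [hi]
    have hang : (∑ i, if i ≤ j ∧ x i = true then Real.pi * 2 ^ (i : ℕ) / 2 ^ (j : ℕ) else 0) =
        (∑ i, if i < j ∧ x i = true then Real.pi * 2 ^ (i : ℕ) / 2 ^ (j : ℕ) else 0) +
        if x j = true then Real.pi else 0 := by
      have : (if x j = true then Real.pi else 0) =
          ∑ i, if i = j then (if x j = true then Real.pi else 0) else 0 := by simp
      rw [this, ← Finset.sum_add_distrib]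
      refine Finset.sum_congr rfl fun i _ => ?_
      rcases lt_trichotomy i j with hi | rfl | hi
      · simp [hi, hi.le, hi.ne]
      · simp
      · simp [hi.not_gt, hi.not_ge, hi.ne']
    rw [one_mul, hps]
    simp only [qftAngle, hang]
    cases hyj : y j <;> cases hxj : x j <;>
      simp [Complex.exp_add, add_mul, Complex.exp_pi_mul_I] <;> ring
  · have hup' : ∀ b, v (Function.update y j b) = 0 := by
      intro b
      rw [hup]
      exact if_neg fun h => hy h.1
    rw [hup', hup', if_neg hy]
    simp

/-- The stages go from the highest qubit down, so the controls of each stage still carry input bits,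
and each amplitude factor depends only on output bits that are no longer changed. -/
theorem qftStages_mulVec (m : ℕ) (hm : m ≤ K) (x : Fin K → Bool) (v h : (Fin K → Bool) → ℂ)
    (hv : ∀ y, v y = if ∀ i : Fin K, (i : ℕ) < m → y i = x i then h y else 0)
    (hh : ∀ y (i : Fin K) b, (i : ℕ) < m → h (Function.update y i b) = h y) (y : Fin K → Bool) :
    (gatesMatrix (qftStages K m) *ᵥ v) y = (∏ j : Fin K, if (j : ℕ) < m then
      ((√2 : ℂ)⁻¹ * Complex.exp (qftAngle x y j * Complex.I)) else 1) * h y := by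
  induction m generalizing v h with
  | zero =>
    simp [qftStages, gatesMatrix, seqMatrix, hv]
  | succ m ih =>
    have hmK : m < K := hm
    rw [qftStages, dif_pos hmK, gatesMatrix_append, ← Matrix.mulVec_mulVec,
      ih hmK.le _ (fun y => ((√2 : ℂ)⁻¹ *
        Complex.exp (qftAngle x y ⟨m, hmK⟩ * Complex.I)) * h y)]
    · rw [← mul_assoc]
      congr 1
      have h1 : ((√2 : ℂ)⁻¹ * Complex.exp (qftAngle x y ⟨m, hmK⟩ * Complex.I)) =
          ∏ j : Fin K, if j = ⟨m, hmK⟩ then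
            ((√2 : ℂ)⁻¹ * Complex.exp (qftAngle x y j * Complex.I)) else 1 := by simp
      rw [h1, ← Finset.prod_mul_distrib]
      refine Finset.prod_congr rfl fun j _ => ?_
      rcases lt_trichotomy (j : ℕ) m with hj | hj | hj
      · have : j ≠ ⟨m, hmK⟩ := fun h => hj.ne (congrArg Fin.val h)
        rw [if_pos hj, if_neg this, if_pos (by omega), mul_one]
      · have : j = ⟨m, hmK⟩ := Fin.ext hj
        rw [if_neg (by omega), if_pos this, if_pos (by omega), one_mul]
      · have : j ≠ ⟨m, hmK⟩ := fun h => hj.ne' (congrArg Fin.val h)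
        rw [if_neg (by omega), if_neg this, if_neg (by omega), mul_one]
    · intro y
      have := qftStage_mulVec ⟨m, hmK⟩ x v h (fun y => ?_) (fun y i b hi => hh y i b ?_) y
      · rw [this]
        rfl
      · rw [hv]
        simp only [Fin.le_def, Nat.lt_succ_iff]
      · exact Nat.lt_succ_of_le hi
    · intro y i b hi
      have h1 : qftAngle x (Function.update y i b) ⟨m, hmK⟩ = qftAngle x y ⟨m, hmK⟩ := by
        unfold qftAngle
        rw [Function.update_of_ne]
        exact fun h => hi.ne' (congrArg Fin.val h)
      simp only [h1, hh y i b (Nat.lt_succ_of_lt hi)]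

theorem qftStages_length (m : ℕ) : (qftStages K m).length ≤ m * (K + 1) := by
  induction m with
  | zero => simp [qftStages]
  | succ m ih =>
    rw [qftStages, List.length_append, Nat.succ_mul, add_comm]
    refine Nat.add_le_add ih ?_
    split_ifs
    · simp [qftStage, qftPhases]
    · simp

theorem unsignedVal_rev (y : Fin K → Bool) :
    unsignedVal (fun i => y i.rev) = ∑ j : Fin K, if y j then 2 ^ (K - 1 - (j : ℕ)) else 0 := by
  rw [unsignedVal, ← Equiv.sum_comp Fin.revPerm]
  refine Finset.sum_congr rfl fun j _ => ?_
  have : K - ((j : ℕ) + 1) = K - 1 - j := by omega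
  simp [Fin.val_rev, this]

/-- The quantum Fourier transform. -/
noncomputable def qftMatrix (K : ℕ) : Matrix (Fin K → Bool) (Fin K → Bool) ℂ :=
  gatesMatrix (qftStages K K)

/-- The circuit has no final swaps, hence the reversed output bits. The full angle is a sum of π 2^i
/ 2^j over pairs of set bits; the pairs with i > j, which the circuit leaves out, contribute
multiples of 2π. -/
theorem qftMatrix_apply (x y : Fin K → Bool) :
    qftMatrix K y x = (√2 : ℂ)⁻¹ ^ K * Complex.exp
      ((2 * Real.pi * unsignedVal x * unsignedVal (fun i => y i.rev) / 2 ^ K : ℝ) * Complex.I) := by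
  have h0 : qftMatrix K y x = (qftMatrix K *ᵥ Pi.single x 1) y := by simp
  rw [h0, qftMatrix, qftStages_mulVec K le_rfl x _ (fun _ => 1)]
  · simp only [Fin.is_lt, if_true, mul_one, Finset.prod_mul_distrib, Finset.prod_const,
      Finset.card_univ, Fintype.card_fin]
    congr 1
    have hr : 2 * Real.pi * unsignedVal x * unsignedVal (fun i => y i.rev) / 2 ^ K =
        ∑ j : Fin K, if y j then ∑ i : Fin K, if x i then
          Real.pi * 2 ^ (i : ℕ) / 2 ^ (j : ℕ) else 0 else 0 := by
      rw [unsignedVal_rev, unsignedVal]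
      push_cast
      rw [Finset.mul_sum Finset.univ (fun j : Fin K => if y j = true then _ else _),
        Finset.sum_div]
      refine Finset.sum_congr rfl fun j _ => ?_
      cases hy : y j
      · simp
      · simp only [if_true]
        rw [Finset.mul_sum, Finset.sum_mul, Finset.sum_div]
        refine Finset.sum_congr rfl fun i _ => ?_
        cases hx : x i
        · simp
        · simp only [if_true]
          have h2 : (2 : ℝ) ^ K = 2 * 2 ^ (K - 1 - (j : ℕ)) * 2 ^ (j : ℕ) := by
            rw [mul_assoc, ← pow_add, ← pow_succ']
            congr 1
            omega
          rw [h2]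
          field_simp
    rw [hr]
    push_cast
    rw [Finset.sum_mul, Complex.exp_sum]
    refine Finset.prod_congr rfl fun j _ => ?_
    unfold qftAngle
    cases hy : y j
    · simp
    · simp only [if_true]
      push_cast
      rw [Finset.sum_mul, Finset.sum_mul, Complex.exp_sum, Complex.exp_sum]
      refine Finset.prod_congr rfl fun i _ => ?_
      by_cases hij : i ≤ j
      · simp [hij]
      · have hlt : (j : ℕ) < i := by simpa using hij
        obtain ⟨d, hd⟩ := Nat.exists_eq_add_of_lt hlt
        cases hx : x i
        · simp
        · simp only [hij, false_and, if_false, if_true]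
          have : (Real.pi : ℂ) * 2 ^ (i : ℕ) / 2 ^ (j : ℕ) * Complex.I =
              ((2 ^ d : ℕ) : ℂ) * (2 * Real.pi * Complex.I) := by
            rw [hd, pow_add, pow_add]
            push_cast
            field_simp
          push_cast at this ⊢
          rw [this]
          simpa using (Complex.exp_nat_mul_two_pi_mul_I (2 ^ d)).symm
  · intro y
    simp only [Fin.is_lt, forall_true_left, Pi.single_apply, funext_iff]
  · intros; rfl

end

/-! ### Unbiased phase estimation -/

theorem qftMatrix_mem_unitary (K : ℕ) :
    qftMatrix K ∈ Matrix.unitaryGroup (Fin K → Bool) ℂ :=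
  gatesMatrix_mem_unitary _

theorem sum_unsignedVal {M : Type*} [AddCommMonoid M] (K : ℕ) (G : ℕ → M) :
    ∑ a : Fin K → Bool, G (unsignedVal a) = ∑ m ∈ Finset.range (2 ^ K), G m := by
  rw [← Fin.sum_univ_eq_sum_range, ← Equiv.sum_comp
    ((Equiv.arrowCongr (Equiv.refl (Fin K)) finTwoEquiv.symm).trans finFunctionFinEquiv)]
  refine Finset.sum_congr rfl fun a _ => ?_
  congr 1
  rw [Equiv.trans_apply, finFunctionFinEquiv_apply, unsignedVal]
  refine Finset.sum_congr rfl fun i _ => ?_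
  cases h : a i <;> simp [Equiv.arrowCongr, h, finTwoEquiv]

section
variable {E : Type*} [NormedAddCommGroup E] [InnerProductSpace ℂ E]

local notation "⟪" x ", " y "⟫" => inner ℂ x y

/-- Parseval's identity with vector coefficients: the register of phase estimation is transformed
while the system keeps its states in `E`. -/
theorem sum_inner_unitary {B : Type*} [Fintype B] [DecidableEq B] {F : Matrix B B ℂ}
    (hF : F ∈ Matrix.unitaryGroup B ℂ) (u v : B → E) :
    ∑ b, ⟪∑ a, F b a • u a, ∑ a, F b a • v a⟫ = ∑ a, ⟪u a, v a⟫ := by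
  rw [Matrix.mem_unitaryGroup_iff', Matrix.star_eq_conjTranspose] at hF
  have hFe : ∀ a a', ∑ b, (starRingEnd ℂ) (F b a) * F b a' = if a = a' then 1 else 0 := by
    intro a a'
    rw [← Matrix.one_apply, ← hF, Matrix.mul_apply]
    rfl
  simp only [sum_inner, inner_sum, inner_smul_left, inner_smul_right, Finset.mul_sum]
  rw [Finset.sum_comm]
  refine Finset.sum_congr rfl fun a _ => ?_
  rw [Finset.sum_comm]
  have : ∀ a', ∑ b, F b a * ((starRingEnd ℂ) (F b a') * ⟪u a', v a⟫) =
      if a' = a then ⟪u a', v a⟫ else 0 := by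
    intro a'
    have h : ∀ b, F b a * ((starRingEnd ℂ) (F b a') * ⟪u a', v a⟫) =
        ((starRingEnd ℂ) (F b a') * F b a) * ⟪u a', v a⟫ := fun b => by ring
    simp only [h]
    rw [← Finset.sum_mul, hFe]
    split_ifs <;> simp
  simp only [this]
  simp

theorem re_inner_self (y : E) : (⟪y, y⟫).re = ‖y‖ ^ 2 := by
  rw [inner_self_eq_norm_sq_to_K]
  norm_cast

/-- Multiplication by ζ or ζ⁻¹ is a cyclic shift of the index. Because `u` vanishes at 0 and `N`,
the only visible wrap-around is the term `u (N - 1)` at m = 0. -/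
theorem sum_pow_smul_shift (N : ℕ) (hN : 0 < N) {ζ : ℂ} (hζ : ζ ^ N = 1) (u : ℕ → E)
    (h0 : u 0 = 0) (huN : u N = 0) :
    (ζ + ζ⁻¹) • ∑ m ∈ Finset.range N, ζ ^ m • u m =
      ∑ m ∈ Finset.range N, ζ ^ m • ((if m = 0 then u (N - 1) else u (m - 1)) + u (m + 1)) := by
  have hζ0 : ζ ≠ 0 := by
    rintro rfl
    rw [zero_pow hN.ne'] at hζ
    exact zero_ne_one hζ
  have key : ∀ G : ℕ → E, G N = G 0 → ∑ m ∈ Finset.range N, G (m + 1) =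
      ∑ m ∈ Finset.range N, G m := by
    intro G hG
    have h1 := Finset.sum_range_succ G N
    rw [Finset.sum_range_succ', hG] at h1
    exact add_right_cancel h1
  simp only [smul_add, Finset.sum_add_distrib]
  rw [add_smul]
  congr 1
  · rw [← key fun m => ζ ^ m • if m = 0 then u (N - 1) else u (m - 1), Finset.smul_sum]
    · refine Finset.sum_congr rfl fun m _ => ?_
      rw [if_neg (Nat.succ_ne_zero m), Nat.add_sub_cancel, smul_smul, pow_succ']
    · simp [hN.ne', hζ]
  · rw [Finset.smul_sum, ← key fun m => ζ⁻¹ • ζ ^ m • u m]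
    · refine Finset.sum_congr rfl fun m _ => ?_
      rw [smul_smul, pow_succ', inv_mul_cancel_left₀ hζ0]
    · simp [h0, huN]

/-- The initial amplitudes of phase estimation. -/
noncomputable def sineWindow (N m : ℕ) : ℝ := √(2 / N) * Real.sin (Real.pi * m / N)

/-- The estimate of phase estimation when `b` is measured. -/
noncomputable def phaseEstimate {K : ℕ} (b : Fin K → Bool) : ℝ :=
  Real.cos (2 * Real.pi * unsignedVal (fun i => b i.rev) / 2 ^ K) / Real.cos (Real.pi / 2 ^ K)

theorem cos_pi_div_pos {K : ℕ} (hK : 2 ≤ K) : 0 < Real.cos (Real.pi / 2 ^ K) := by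
  apply Real.cos_pos_of_mem_Ioo
  have h4 : (4 : ℝ) ≤ 2 ^ K := by
    calc (4 : ℝ) = 2 ^ 2 := by norm_num
      _ ≤ 2 ^ K := pow_le_pow_right₀ (by norm_num) hK
  have hpi := Real.pi_pos
  constructor
  · have : 0 < Real.pi / 2 ^ K := by positivity
    linarith
  · rw [div_lt_div_iff₀ (by positivity) (by norm_num)]
    nlinarith

section
variable {K : ℕ} {χ : ℕ → E} {c : ℝ}

/-- The residual of the approximate eigenvector equation of the window. -/
noncomputable def phaseResidual (K : ℕ) (χ : ℕ → E) (c : ℝ) (m : ℕ) : E :=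
  ((2 * Real.cos (Real.pi / 2 ^ K) : ℝ) : ℂ)⁻¹ •
    ((if m = 0 then (sineWindow (2 ^ K) (2 ^ K - 1) : ℂ) • χ (2 ^ K - 1) else
      (sineWindow (2 ^ K) (m - 1) : ℂ) • χ (m - 1)) +
      (sineWindow (2 ^ K) (m + 1) : ℂ) • χ (m + 1)) -
    (c : ℂ) • (sineWindow (2 ^ K) m : ℂ) • χ m

theorem sineWindow_zero (N : ℕ) : sineWindow N 0 = 0 := by simp [sineWindow]

theorem sineWindow_self {N : ℕ} (hN : 0 < N) : sineWindow N N = 0 := by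
  have : (N : ℝ) ≠ 0 := by positivity
  rw [sineWindow, mul_div_assoc, div_self this]
  simp

/-- Multiplying the final amplitude by the estimate amounts to shifting the index before the
transform. The error thus becomes the Fourier transform of the residual, and its moments become sums
of inner products by unitarity. -/
theorem phaseEstimate_sub_smul (hK : 2 ≤ K) (b : Fin K → Bool) :
    ((phaseEstimate b - c : ℝ) : ℂ) • ∑ a, qftMatrix K b a •
      (sineWindow (2 ^ K) (unsignedVal a) : ℂ) • χ (unsignedVal a) =
    ∑ a, qftMatrix K b a • phaseResidual K χ c (unsignedVal a) := by
  set k := unsignedVal (fun i => b i.rev) with hk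
  set ζ := Complex.exp ((2 * Real.pi * k / 2 ^ K : ℝ) * Complex.I) with hζ
  have hF : ∀ a, qftMatrix K b a = (√2 : ℂ)⁻¹ ^ K * ζ ^ unsignedVal a := by
    intro a
    rw [qftMatrix_apply, hζ, ← Complex.exp_nat_mul, ← hk]
    congr 2
    push_cast
    ring
  have hconv : ∀ u : ℕ → E, ∑ a, qftMatrix K b a • u (unsignedVal a) =
      (√2 : ℂ)⁻¹ ^ K • ∑ m ∈ Finset.range (2 ^ K), ζ ^ m • u m := by
    intro u
    rw [← sum_unsignedVal K fun m => ζ ^ m • u m, Finset.smul_sum]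
    refine Finset.sum_congr rfl fun a _ => ?_
    rw [hF, smul_smul]
  have hζN : ζ ^ (2 ^ K) = 1 := by
    rw [hζ, ← Complex.exp_nat_mul]
    have : ((2 ^ K : ℕ) : ℂ) * ((2 * Real.pi * k / 2 ^ K : ℝ) * Complex.I) =
        (k : ℂ) * (2 * Real.pi * Complex.I) := by
      push_cast
      field_simp
    rw [this, Complex.exp_nat_mul_two_pi_mul_I]
  have hsum : ((phaseEstimate b : ℝ) : ℂ) =
      ((2 * Real.cos (Real.pi / 2 ^ K) : ℝ) : ℂ)⁻¹ * (ζ + ζ⁻¹) := by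
    have h1 : ζ + ζ⁻¹ = ((2 * Real.cos (2 * Real.pi * k / 2 ^ K) : ℝ) : ℂ) := by
      rw [hζ, ← Complex.exp_neg, Complex.ofReal_mul, Complex.ofReal_cos, Complex.cos]
      push_cast
      ring_nf
    rw [h1, phaseEstimate, ← hk, ← Complex.ofReal_inv, ← Complex.ofReal_mul]
    have := (cos_pi_div_pos hK).ne'
    congr 1
    field_simp
  rw [hconv fun m => (sineWindow (2 ^ K) m : ℂ) • χ m, hconv, smul_comm]
  congr 1
  have hsh := sum_pow_smul_shift (2 ^ K) (by positivity) hζN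
    (fun m => (sineWindow (2 ^ K) m : ℂ) • χ m) (by simp [sineWindow_zero])
    (by simp [sineWindow_self])
  rw [Complex.ofReal_sub, sub_smul, hsum, mul_smul, hsh, Finset.smul_sum, Finset.smul_sum,
    ← Finset.sum_sub_distrib]
  refine Finset.sum_congr rfl fun m _ => ?_
  rw [phaseResidual, smul_sub, smul_comm _ (ζ ^ m), smul_comm _ (ζ ^ m)]

theorem sineWindow_add_one (N m : ℕ) : sineWindow N (m + 1) =
    Real.cos (Real.pi / N) * sineWindow N m +
      Real.sin (Real.pi / N) * (√(2 / N) * Real.cos (Real.pi * m / N)) := by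
  have : Real.pi * ((m + 1 : ℕ) : ℝ) / N = Real.pi * m / N + Real.pi / N := by
    push_cast; ring
  rw [sineWindow, this, Real.sin_add, sineWindow]
  ring

theorem sineWindow_sub_one (N : ℕ) {m : ℕ} (hm : m ≠ 0) : sineWindow N (m - 1) =
    Real.cos (Real.pi / N) * sineWindow N m -
      Real.sin (Real.pi / N) * (√(2 / N) * Real.cos (Real.pi * m / N)) := by
  have : Real.pi * ((m - 1 : ℕ) : ℝ) / N = Real.pi * m / N - Real.pi / N := by
    rw [Nat.cast_sub (Nat.one_le_iff_ne_zero.2 hm)]; push_cast; ring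
  rw [sineWindow, this, Real.sin_sub, sineWindow]
  ring

/-- The addition theorem splits the window at m ± 1 into cos(π/N) times its value at m, which the
recurrence of `χ` turns into exactly c, and an odd part of size sin(π/N). Dividing by cos(π/N) in
`phaseEstimate` is what makes the cancellation exact. -/
theorem phaseResidual_of_ne (hK : 2 ≤ K) (hχ : ∀ m, χ (m + 2) + χ m = (2 * c : ℂ) • χ (m + 1))
    {m : ℕ} (hm : m ≠ 0) : phaseResidual K χ c m =
      ((Real.sin (Real.pi / 2 ^ K) * (√(2 / 2 ^ K) * Real.cos (Real.pi * m / 2 ^ K)) /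
        (2 * Real.cos (Real.pi / 2 ^ K)) : ℝ) : ℂ) • (χ (m + 1) - χ (m - 1)) := by
  obtain ⟨m, rfl⟩ := Nat.exists_eq_succ_of_ne_zero hm
  have h1 := sineWindow_add_one (2 ^ K) m.succ
  have h2 := sineWindow_sub_one (2 ^ K) hm
  have hc : (c : ℂ) • χ (m + 1) = (2⁻¹ : ℂ) • (χ (m + 2) + χ m) := by
    rw [hχ, smul_smul]
    congr 1
    ring
  rw [phaseResidual, if_neg hm, h1, h2, smul_comm (c : ℂ)]
  simp only [Nat.succ_eq_add_one, Nat.add_sub_cancel]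
  rw [hc]
  have hl : ((Real.cos (Real.pi / 2 ^ K) : ℝ) : ℂ) ≠ 0 := by
    exact_mod_cast (cos_pi_div_pos hK).ne'
  push_cast
  push_cast at hl
  match_scalars <;> field_simp <;> ring

/-- A sum or difference of two unit vectors has norm at most 2, which offsets the factor 1/2 of the
residual. The index 0 is separate because its left neighbour wraps around to N − 1; there both
neighbours have the window value √(2/N) sin(π/N). -/
theorem norm_phaseResidual_sq_le (hK : 2 ≤ K) (hχ1 : ∀ m, ‖χ m‖ = 1)
    (hχ : ∀ m, χ (m + 2) + χ m = (2 * c : ℂ) • χ (m + 1)) (m : ℕ) :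
    ‖phaseResidual K χ c m‖ ^ 2 ≤ 2 / 2 ^ K * Real.tan (Real.pi / 2 ^ K) ^ 2 := by
  have hl := cos_pi_div_pos hK
  have hs : √(2 / 2 ^ K) ^ 2 = (2 : ℝ) / 2 ^ K := Real.sq_sqrt (by positivity)
  by_cases hm : m = 0
  · subst hm
    have h1 : sineWindow (2 ^ K) 1 = √(2 / 2 ^ K) * Real.sin (Real.pi / 2 ^ K) := by
      simp [sineWindow]
    have h2 : sineWindow (2 ^ K) (2 ^ K - 1) = √(2 / 2 ^ K) * Real.sin (Real.pi / 2 ^ K) := by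
      rw [sineWindow_sub_one _ (by positivity), sineWindow_self (by positivity)]
      have : Real.pi * ((2 ^ K : ℕ) : ℝ) / ((2 ^ K : ℕ) : ℝ) = Real.pi := by
        field_simp
      rw [this]
      push_cast
      simp
      ring
    have h3 : phaseResidual K χ c 0 = ((√(2 / 2 ^ K) * Real.tan (Real.pi / 2 ^ K) / 2 : ℝ) : ℂ) •
        (χ (2 ^ K - 1) + χ 1) := by
      rw [phaseResidual, if_pos rfl, zero_add, h1, h2, sineWindow_zero, Complex.ofReal_zero,
        zero_smul, smul_zero, sub_zero, ← smul_add, smul_smul, ← Complex.ofReal_inv,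
        ← Complex.ofReal_mul, Real.tan_eq_sin_div_cos]
      congr 2
      field_simp
    have h4 : ‖χ (2 ^ K - 1) + χ 1‖ ^ 2 ≤ 4 := by
      have := norm_add_le (χ (2 ^ K - 1)) (χ 1)
      rw [hχ1, hχ1] at this
      nlinarith [norm_nonneg (χ (2 ^ K - 1) + χ 1)]
    rw [h3, norm_smul, mul_pow, Complex.norm_real, Real.norm_eq_abs, sq_abs]
    calc _ = (2 / 2 ^ K * Real.tan (Real.pi / 2 ^ K) ^ 2) * (‖χ (2 ^ K - 1) + χ 1‖ ^ 2 / 4) := by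
          rw [div_pow, mul_pow, hs]; ring
      _ ≤ (2 / 2 ^ K * Real.tan (Real.pi / 2 ^ K) ^ 2) * 1 := by
          gcongr
          linarith
      _ = _ := mul_one _
  · rw [phaseResidual_of_ne hK hχ hm, norm_smul, mul_pow, Complex.norm_real, Real.norm_eq_abs,
      sq_abs]
    have h4 : ‖χ (m + 1) - χ (m - 1)‖ ^ 2 ≤ 4 := by
      have := norm_sub_le (χ (m + 1)) (χ (m - 1))
      rw [hχ1, hχ1] at this
      nlinarith [norm_nonneg (χ (m + 1) - χ (m - 1))]
    have hcos : Real.cos (Real.pi * m / 2 ^ K) ^ 2 ≤ 1 := Real.cos_sq_le_one _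
    calc _ = (2 / 2 ^ K * Real.tan (Real.pi / 2 ^ K) ^ 2) *
          (Real.cos (Real.pi * m / 2 ^ K) ^ 2 * (‖χ (m + 1) - χ (m - 1)‖ ^ 2 / 4)) := by
          rw [Real.tan_eq_sin_div_cos, div_pow, mul_pow, mul_pow, hs]
          ring
      _ ≤ (2 / 2 ^ K * Real.tan (Real.pi / 2 ^ K) ^ 2) * (1 * 1) := by
          gcongr
          linarith
      _ = _ := by ring

/-- The mean of phase estimation is exact. -/
theorem sum_phaseEstimate_sub (hK : 2 ≤ K)
    (hχ : ∀ m, χ (m + 2) + χ m = (2 * c : ℂ) • χ (m + 1))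
    (hc : ∀ m, (⟪χ m, χ (m + 1)⟫).re = c) :
    ∑ b : Fin K → Bool, (phaseEstimate b - c) * ‖∑ a, qftMatrix K b a •
      (sineWindow (2 ^ K) (unsignedVal a) : ℂ) • χ (unsignedVal a)‖ ^ 2 = 0 := by
  have h1 : ∀ b : Fin K → Bool, (phaseEstimate b - c) * ‖∑ a, qftMatrix K b a •
      (sineWindow (2 ^ K) (unsignedVal a) : ℂ) • χ (unsignedVal a)‖ ^ 2 =
      (⟪∑ a, qftMatrix K b a • (sineWindow (2 ^ K) (unsignedVal a) : ℂ) • χ (unsignedVal a),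
        ∑ a, qftMatrix K b a • phaseResidual K χ c (unsignedVal a)⟫).re := by
    intro b
    rw [← phaseEstimate_sub_smul hK, inner_smul_right, Complex.re_ofReal_mul,
      re_inner_self]
  rw [Finset.sum_congr rfl fun b _ => h1 b, ← Complex.re_sum,
    sum_inner_unitary (qftMatrix_mem_unitary K), Complex.re_sum]
  -- Every term vanishes: the residual is a real multiple of χ(m+1) − χ(m−1), and both neighbours
  -- have inner product with real part c with χ(m). At m = 0 the window itself is zero.
  refine Finset.sum_eq_zero fun a _ => ?_
  by_cases hm : unsignedVal a = 0
  · rw [hm, sineWindow_zero]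
    simp
  · rw [phaseResidual_of_ne hK hχ hm, inner_smul_left, inner_smul_right, Complex.conj_ofReal,
      Complex.re_ofReal_mul, Complex.re_ofReal_mul, inner_sub_right, Complex.sub_re, hc]
    obtain ⟨m, hm'⟩ := Nat.exists_eq_succ_of_ne_zero hm
    have h2 : (⟪χ (unsignedVal a), χ (unsignedVal a - 1)⟫).re = c := by
      rw [hm', Nat.succ_eq_add_one, Nat.add_sub_cancel, ← hc m, ← inner_conj_symm, Complex.conj_re]
    rw [h2]
    simp

/-- The mean squared error of phase estimation. -/
theorem sum_phaseEstimate_sub_sq (hK : 2 ≤ K) (hχ1 : ∀ m, ‖χ m‖ = 1)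
    (hχ : ∀ m, χ (m + 2) + χ m = (2 * c : ℂ) • χ (m + 1)) :
    ∑ b : Fin K → Bool, (phaseEstimate b - c) ^ 2 * ‖∑ a, qftMatrix K b a •
      (sineWindow (2 ^ K) (unsignedVal a) : ℂ) • χ (unsignedVal a)‖ ^ 2 ≤
      2 * Real.tan (Real.pi / 2 ^ K) ^ 2 := by
  have h1 : ∀ b : Fin K → Bool, (phaseEstimate b - c) ^ 2 * ‖∑ a, qftMatrix K b a •
      (sineWindow (2 ^ K) (unsignedVal a) : ℂ) • χ (unsignedVal a)‖ ^ 2 =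
      (⟪∑ a, qftMatrix K b a • phaseResidual K χ c (unsignedVal a),
        ∑ a, qftMatrix K b a • phaseResidual K χ c (unsignedVal a)⟫).re := by
    intro b
    rw [← phaseEstimate_sub_smul hK, re_inner_self, norm_smul, Complex.norm_real,
      Real.norm_eq_abs, mul_pow, sq_abs]
  rw [Finset.sum_congr rfl fun b _ => h1 b, ← Complex.re_sum,
    sum_inner_unitary (qftMatrix_mem_unitary K), Complex.re_sum]
  calc ∑ a : Fin K → Bool, (⟪phaseResidual K χ c (unsignedVal a),
        phaseResidual K χ c (unsignedVal a)⟫).re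
      ≤ ∑ _a : Fin K → Bool, 2 / 2 ^ K * Real.tan (Real.pi / 2 ^ K) ^ 2 := by
        refine Finset.sum_le_sum fun a _ => ?_
        rw [re_inner_self]
        exact norm_phaseResidual_sq_le hK hχ1 hχ (unsignedVal a)
    _ = _ := by
        rw [Finset.sum_const, Finset.card_univ, Fintype.card_fun, Fintype.card_bool,
          Fintype.card_fin, nsmul_eq_mul]
        push_cast
        field_simp

end
end

/-! ### Phase estimation circuits -/

theorem gatesMatrix_map {W W' : Type} [Fintype W] [DecidableEq W] [Fintype W'] [DecidableEq W']
    (e : W ↪ W') (l : List (Gate W)) :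
    gatesMatrix (l.map (Gate.map e)) = embedMatrix e (gatesMatrix l) := by
  rw [gatesMatrix, gatesMatrix, embedMatrix_seqMatrix, List.map_map, List.map_map]
  congr 1
  refine List.map_congr_left fun g _ => ?_
  simp only [Function.comp, Layer.single_matrix, Gate.map_matrix]

theorem gatesMatrix_phaseGate_mulVec {W : Type} [Fintype W] [DecidableEq W] (θ : W → ℝ)
    (l : List W) (v : (W → Bool) → ℂ) (x : W → Bool) :
    (gatesMatrix (l.map fun j => phaseGate j ∅ (θ j)) *ᵥ v) x =
      Complex.exp (((l.map fun j => if x j then θ j else 0).sum : ℝ) * Complex.I) * v x := by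
  induction l generalizing v with
  | nil => simp [gatesMatrix, seqMatrix]
  | cons j l ih =>
    rw [List.map_cons, gatesMatrix_cons, ← Matrix.mulVec_mulVec, ih, phaseGate_mulVec,
      List.map_cons, List.sum_cons, ← mul_assoc]
    congr 1
    cases x j
    · simp
    · simp only [Finset.notMem_empty, false_imp_iff, implies_true, and_true, if_true]
      rw [← Complex.exp_add, add_comm]
      push_cast
      rw [add_mul]

/-- The gates that prepare the state with amplitudes `sineWindow`. -/
noncomputable def windowGates (K : ℕ) : List (Gate (Fin (K + 1))) :=
  (notGate 0 ∅ :: hadamardGate 0 :: qftStages (K + 1) (K + 1)).map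
    (Gate.map Fin.revPerm.toEmbedding) ++
  (List.finRange (K + 1)).map fun j : Fin (K + 1) => phaseGate j ∅ (-(Real.pi * 2 ^ (j : ℕ) / 2 ^ (K + 1)))

/-- NOT and Hadamard prepare (|0⟩ − |1⟩)/√2, the Fourier transform makes this proportional to 1 −
exp(2iθ) with θ = πm/2^(K+1), and the phases −θ turn it into −2i sin θ. Reversing the wires of the
transform undoes its bit reversal. -/
theorem windowGates_apply (K : ℕ) (a : Fin (K + 1) → Bool) :
    gatesMatrix (windowGates K) a (fun _ => false) =
      -Complex.I * sineWindow (2 ^ (K + 1)) (unsignedVal a) := by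
  rw [← mulVec_single_zero (gatesMatrix _) a, windowGates, gatesMatrix_append,
    ← Matrix.mulVec_mulVec, gatesMatrix_phaseGate_mulVec, gatesMatrix_map,
    mulVec_single_zero (embedMatrix _ _)]
  have hemb : embedMatrix Fin.revPerm.toEmbedding
      (gatesMatrix (notGate 0 ∅ :: hadamardGate 0 :: qftStages (K + 1) (K + 1))) a
      (fun _ => false) =
      gatesMatrix (notGate 0 ∅ :: hadamardGate 0 :: qftStages (K + 1) (K + 1))
        (fun i => a i.rev) (fun _ => false) := by
    simp only [embedMatrix, Matrix.of_apply]
    rw [if_pos]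
    · rfl
    · intro w hw
      exact absurd (Fin.rev_rev w) (hw w.rev)
  set e0 : Fin (K + 1) → Bool := Function.update (fun _ => false) 0 true with he0
  have hsup : (hadamardGate (0 : Fin (K + 1))).matrix *ᵥ ((notGate (0 : Fin (K + 1)) ∅).matrix *ᵥ
      Pi.single (fun _ => false) 1) =
      (√2 : ℂ)⁻¹ • (Pi.single (fun _ => false) 1 - Pi.single e0 1) := by
    ext x
    rw [hadamardGate_mulVec, notGate_mulVec, notGate_mulVec]
    have h1 : flipIf 0 ∅ (Function.update x 0 false) = Function.update x 0 true := by
      simp [flipIf]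
    have h2 : flipIf 0 ∅ (Function.update x 0 true) = Function.update x 0 false := by
      simp [flipIf]
    have h3 : Function.update x 0 true ≠ fun _ => false := by
      intro h
      simpa using congrFun h 0
    rw [h1, h2]
    simp only [Pi.single_apply, Pi.smul_apply, Pi.sub_apply, if_neg h3, zero_add, smul_eq_mul]
    congr 1
    cases hx : x 0
    · have h4 : Function.update x 0 false = x := by rw [← hx, Function.update_eq_self]
      have h5 : x ≠ e0 := by
        rintro rfl
        simp [he0] at hx
      simp [h4, h5]
    · have h4 : x ≠ fun _ => false := by
        rintro rfl
        simp at hx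
      have h5 : Function.update x 0 false = (fun _ => false) ↔ x = e0 := by
        constructor
        · intro h
          have := congrArg (fun y => Function.update y 0 true) h
          simp only [Function.update_idem] at this
          rw [← hx, Function.update_eq_self] at this
          rw [this, he0, hx]
        · rintro rfl
          rw [he0, Function.update_idem]
          exact Function.update_eq_self (0 : Fin (K + 1)) (fun _ => false)
      simp [h4, h5]
      split_ifs <;> simp
  have hv0 : unsignedVal (fun _ : Fin (K + 1) => false) = 0 := by simp [unsignedVal]
  have hv1 : unsignedVal e0 = 1 := by
    rw [unsignedVal, Fin.sum_univ_succ]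
    simp [he0]
  rw [hemb, ← mulVec_single_zero (gatesMatrix _), gatesMatrix_cons, gatesMatrix_cons,
    ← Matrix.mulVec_mulVec, ← Matrix.mulVec_mulVec, hsup, Matrix.mulVec_smul, Matrix.mulVec_sub,
    Pi.smul_apply, Pi.sub_apply, Matrix.mulVec_single_one, Matrix.mulVec_single_one]
  change _ * ((√2 : ℂ)⁻¹ * (qftMatrix (K + 1) _ _ - qftMatrix (K + 1) _ _)) = _
  simp only [qftMatrix_apply, hv0, hv1, Fin.rev_rev]
  set m := unsignedVal a with hm
  have hang : ((List.finRange (K + 1)).map fun j : Fin (K + 1) => if a j = true then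
      -(Real.pi * 2 ^ (j : ℕ) / 2 ^ (K + 1)) else 0).sum = -(Real.pi * m / 2 ^ (K + 1)) := by
    rw [← List.ofFn_eq_map, List.sum_ofFn, hm, unsignedVal]
    push_cast
    rw [Finset.mul_sum, Finset.sum_div, ← Finset.sum_neg_distrib]
    refine Finset.sum_congr rfl fun j _ => ?_
    split_ifs <;> simp
  rw [hang, sineWindow]
  set θ : ℝ := Real.pi * m / 2 ^ (K + 1) with hθ
  have h1 : (2 * Real.pi * ((1 : ℕ) : ℝ) * (m : ℝ) / 2 ^ (K + 1) : ℝ) = 2 * θ := by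
    rw [hθ]; push_cast; ring
  have h2 : (Real.pi * (m : ℝ) / ((2 ^ (K + 1) : ℕ) : ℝ)) = θ := by
    rw [hθ]; push_cast; rfl
  have h3 : (√(2 / ((2 ^ (K + 1) : ℕ) : ℝ)) : ℝ) = 2 * ((√2)⁻¹ * (√2)⁻¹ ^ (K + 1)) := by
    have h2' : (0 : ℝ) < √2 := by positivity
    rw [Real.sqrt_eq_iff_mul_self_eq (by positivity) (by positivity)]
    have h4 : (√2)⁻¹ * (√2)⁻¹ = (2 : ℝ)⁻¹ := by
      rw [← mul_inv, Real.mul_self_sqrt (by norm_num)]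
    symm
    calc 2 * ((√2)⁻¹ * (√2)⁻¹ ^ (K + 1)) * (2 * ((√2)⁻¹ * (√2)⁻¹ ^ (K + 1)))
        = 4 * (((√2)⁻¹ * (√2)⁻¹) * ((√2)⁻¹ * (√2)⁻¹) ^ (K + 1)) := by ring
      _ = 2 / ((2 ^ (K + 1) : ℕ) : ℝ) := by
          rw [h4]; push_cast; rw [inv_pow]; ring
  rw [h1, h2, h3]
  have h5 : Complex.exp ((-θ : ℝ) * Complex.I) * (1 - Complex.exp ((2 * θ : ℝ) * Complex.I)) =
      -Complex.I * (2 * (Real.sin θ : ℂ)) := by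
    have : Complex.exp ((2 * θ : ℝ) * Complex.I) =
        Complex.exp ((θ : ℝ) * Complex.I) * Complex.exp ((θ : ℝ) * Complex.I) := by
      rw [← Complex.exp_add]; push_cast; ring_nf
    rw [this, mul_sub, ← mul_assoc, ← Complex.exp_add]
    have h0 : ((-θ : ℝ) : ℂ) * Complex.I + (θ : ℝ) * Complex.I = 0 := by push_cast; ring
    rw [h0, Complex.exp_zero, one_mul, mul_one, Complex.exp_mul_I, Complex.exp_mul_I,
      ← Complex.ofReal_cos, ← Complex.ofReal_sin, ← Complex.ofReal_cos, ← Complex.ofReal_sin,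
      Real.cos_neg, Real.sin_neg]
    push_cast
    ring
  have hz : (2 * Real.pi * ((0 : ℕ) : ℝ) * (m : ℝ) / 2 ^ (K + 1) : ℝ) = 0 := by simp
  rw [hz]
  simp only [Complex.ofReal_zero, zero_mul, Complex.exp_zero, mul_one]
  calc _ = ((√2 : ℂ)⁻¹ * (√2 : ℂ)⁻¹ ^ (K + 1)) * (Complex.exp ((-θ : ℝ) * Complex.I) *
        (1 - Complex.exp ((2 * θ : ℝ) * Complex.I))) := by ring
    _ = _ := by
      rw [h5]
      push_cast
      ring

section
variable {S : Type} [Fintype S] [DecidableEq S] {K : ℕ}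

/-- The vector on the wires `S ⊕ Fin K` given by one vector on `S` for each basis state of the
other register. -/
def joinState (Φ : (Fin K → Bool) → (S → Bool) → ℂ) (x : S ⊕ Fin K → Bool) : ℂ :=
  Φ (fun k => x (Sum.inr k)) fun s => x (Sum.inl s)

theorem embedMatrix_inl_joinState (A : Matrix (S → Bool) (S → Bool) ℂ)
    (Φ : (Fin K → Bool) → (S → Bool) → ℂ) :
    embedMatrix Function.Embedding.inl A *ᵥ joinState Φ = joinState fun a => A *ᵥ Φ a := by
  ext x
  rw [embedMatrix_mulVec]
  simp only [joinState, Matrix.mulVec, dotProduct]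
  refine Finset.sum_congr rfl fun q _ => ?_
  have h1 : ∀ k : Fin K, Function.extend (Function.Embedding.inl : S ↪ S ⊕ Fin K) q x
      (Sum.inr k) = x (Sum.inr k) := by
    intro k
    rw [Function.extend_apply']
    simp
  have h2 : ∀ s : S, Function.extend (Function.Embedding.inl : S ↪ S ⊕ Fin K) q x
      (Sum.inl s) = q s :=
    fun s => Function.Embedding.inl.injective.extend_apply q x s
  simp only [h1, h2]
  rfl

theorem embedMatrix_inr_joinState (M : Matrix (Fin K → Bool) (Fin K → Bool) ℂ)
    (Φ : (Fin K → Bool) → (S → Bool) → ℂ) :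
    embedMatrix Function.Embedding.inr M *ᵥ joinState Φ =
      joinState fun a => ∑ q, M a q • Φ q := by
  ext x
  rw [embedMatrix_mulVec]
  simp only [joinState, Finset.sum_apply, Pi.smul_apply, smul_eq_mul]
  refine Finset.sum_congr rfl fun q _ => ?_
  have h1 : ∀ s : S, Function.extend (Function.Embedding.inr : Fin K ↪ S ⊕ Fin K) q x
      (Sum.inl s) = x (Sum.inl s) := by
    intro s
    rw [Function.extend_apply']
    simp
  have h2 : ∀ k : Fin K, Function.extend (Function.Embedding.inr : Fin K ↪ S ⊕ Fin K) q x
      (Sum.inr k) = q k :=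
    fun s => Function.Embedding.inr.injective.extend_apply q x s
  simp only [h1, h2]
  rfl

theorem sum_joinState (g : (Fin K → Bool) → ℝ) (Φ : (Fin K → Bool) → (S → Bool) → ℂ) :
    ∑ x, g (fun k => x (Sum.inr k)) * ‖joinState Φ x‖ ^ 2 =
      ∑ b, g b * ‖WithLp.toLp 2 (Φ b)‖ ^ 2 := by
  rw [← Equiv.sum_comp (Equiv.sumArrowEquivProdArrow S (Fin K) Bool).symm,
    Fintype.sum_prod_type, Finset.sum_comm]
  refine Finset.sum_congr rfl fun b _ => ?_
  rw [EuclideanSpace.norm_sq_eq, Finset.mul_sum]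
  rfl

/-- The sign changes of the reflection about the basis state `0`. -/
def zeroReflection (S : Type) [Fintype S] [DecidableEq S] : Matrix (S → Bool) (S → Bool) ℂ :=
  Matrix.diagonal fun s => if s = fun _ => false then -1 else 1

/-- The sign changes of the basis states with a `1` in the target qubit. -/
def targetReflection (t : S) : Matrix (S → Bool) (S → Bool) ℂ :=
  Matrix.diagonal fun s => if s t then -1 else 1

/-- The Grover iterate. -/
def groverMatrix (t : S) (A : Matrix (S → Bool) (S → Bool) ℂ) :
    Matrix (S → Bool) (S → Bool) ℂ :=
  A * zeroReflection S * Aᴴ * targetReflection t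

/-- The operator of a step of a run, given the operators of the evaluation circuits. -/
def runInstrMatrix {W : Type} [Fintype W] [DecidableEq W]
    (M : ℕ → Bool → Matrix (W → Bool) (W → Bool) ℂ) :
    RunInstr W → Matrix (W → Bool) (W → Bool) ℂ
  | .gates s => s.matrix
  | .eval l k => M l k
  | .evalInv l k => (M l k)ᴴ

/-- The Grover iterate controlled by the qubit `j` of the other register. -/
noncomputable def groverInstrs (t : S) (l : ℕ) (k : Bool) (j : Fin K) :
    List (RunInstr (S ⊕ Fin K)) :=
  [.gates (Layer.single (phaseGate (Sum.inl t) {Sum.inr j} Real.pi)), .evalInv l k,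
    .gates (flipLayer Function.Embedding.inl),
    .gates (Layer.single (phaseGate (Sum.inl t)
      (insert (Sum.inr j) (Finset.univ.map Function.Embedding.inl)) Real.pi)),
    .gates (flipLayer Function.Embedding.inl), .eval l k]

theorem phaseGate_joinState (t : S) (j : Fin K) (Φ : (Fin K → Bool) → (S → Bool) → ℂ) :
    (phaseGate (Sum.inl t : S ⊕ Fin K) {Sum.inr j} Real.pi).matrix *ᵥ joinState Φ =
      joinState fun a => if a j then targetReflection t *ᵥ Φ a else Φ a := by
  ext x
  rw [phaseGate_mulVec, Complex.exp_pi_mul_I]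
  simp only [joinState, targetReflection, Finset.mem_singleton, forall_eq]
  by_cases hj : x (Sum.inr j) = true
  · simp [hj, Matrix.mulVec_diagonal]
  · simp [hj]

/-- Conjugation by NOT gates on all of `S` turns "all bits 0" into "all bits 1", which a phase π
controlled by all wires detects. The qubit `j` is one more control. -/
theorem zeroReflection_joinState (t : S) (j : Fin K) (Φ : (Fin K → Bool) → (S → Bool) → ℂ) :
    (flipLayer (Function.Embedding.inl : S ↪ S ⊕ Fin K)).matrix *ᵥ
      ((phaseGate (Sum.inl t : S ⊕ Fin K) (insert (Sum.inr j)
        (Finset.univ.map Function.Embedding.inl)) Real.pi).matrix *ᵥ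
      ((flipLayer (Function.Embedding.inl : S ↪ S ⊕ Fin K)).matrix *ᵥ joinState Φ)) =
      joinState fun a => if a j then zeroReflection S *ᵥ Φ a else Φ a := by
  ext x
  rw [flipLayer_mulVec, phaseGate_mulVec, flipLayer_mulVec, Complex.exp_pi_mul_I]
  set x' := Function.extend (Function.Embedding.inl : S ↪ S ⊕ Fin K)
    (fun a => !x (Function.Embedding.inl a)) x with hx'
  have h1 : ∀ s : S, x' (Sum.inl s) = !x (Sum.inl s) := by
    intro s
    exact Function.Embedding.inl.injective.extend_apply _ x s
  have h2 : ∀ k : Fin K, x' (Sum.inr k) = x (Sum.inr k) := by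
    intro k
    rw [hx', Function.extend_apply']
    simp
  have h3 : Function.extend (Function.Embedding.inl : S ↪ S ⊕ Fin K)
      (fun a => !x' (Function.Embedding.inl a)) x' = x := by
    ext w
    rcases w with s | k
    · refine (Function.Embedding.inl.injective.extend_apply _ x' s).trans ?_
      change (!x' (Sum.inl s)) = _
      rw [h1, Bool.not_not]
    · rw [Function.extend_apply', h2]
      simp
  rw [h3]
  have h4 : (x' (Sum.inl t) = true ∧ ∀ c ∈ insert (Sum.inr j : S ⊕ Fin K)
      (Finset.univ.map Function.Embedding.inl), x' c = true) ↔
      (x (Sum.inr j) = true ∧ (fun s => x (Sum.inl s)) = fun _ => false) := by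
    simp only [Finset.mem_insert, Finset.mem_map, Finset.mem_univ, true_and, forall_eq_or_imp,
      forall_exists_index, forall_apply_eq_imp_iff, Function.Embedding.inl_apply, h1, h2,
      funext_iff, Bool.not_eq_true']
    exact ⟨fun h => h.2, fun h => ⟨h.2 t, h⟩⟩
  rw [if_congr h4 rfl rfl]
  simp only [joinState, zeroReflection]
  by_cases hj : x (Sum.inr j) = true
  · simp [hj, Matrix.mulVec_diagonal]
  · simp [hj]

/-- Only the two reflections are controlled. When the control is 0, the uncontrolled evaluation
circuit and its inverse cancel, so the black boxes are never needed in controlled form. -/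
theorem groverInstrs_joinState (t : S) {A : Matrix (S → Bool) (S → Bool) ℂ}
    (hA : A ∈ Matrix.unitaryGroup (S → Bool) ℂ)
    {M : ℕ → Bool → Matrix (S ⊕ Fin K → Bool) (S ⊕ Fin K → Bool) ℂ} {l : ℕ} {k : Bool}
    (hM : M l k = embedMatrix Function.Embedding.inl A) (j : Fin K)
    (Φ : (Fin K → Bool) → (S → Bool) → ℂ) :
    seqMatrix ((groverInstrs t l k j).map (runInstrMatrix M)) *ᵥ joinState Φ =
      joinState fun a => if a j then groverMatrix t A *ᵥ Φ a else Φ a := by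
  rw [Matrix.mem_unitaryGroup_iff, Matrix.star_eq_conjTranspose] at hA
  simp only [groverInstrs, List.map_cons, List.map_nil, seqMatrix, runInstrMatrix, hM,
    ← embedMatrix_conjTranspose, one_mul, ← Matrix.mulVec_mulVec, Layer.single_matrix,
    phaseGate_joinState, embedMatrix_inl_joinState, zeroReflection_joinState]
  congr 1
  ext a s
  cases a j
  · simp [hA]
  · simp [groverMatrix, mul_assoc]

/-- A phase estimation run. -/
noncomputable def phaseRun (K : ℕ) (t : S) (l : ℕ) (k : Bool) :
    List (RunInstr (S ⊕ Fin (K + 1))) :=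
  (((windowGates K).map (Gate.map Function.Embedding.inr)).map
      fun g => .gates (Layer.single g)) ++
    .eval l k :: (((List.finRange (K + 1)).flatMap fun j : Fin (K + 1) =>
      (List.replicate (2 ^ (j : ℕ)) (groverInstrs t l k j)).flatten) ++
    ((qftStages (K + 1) (K + 1)).map (Gate.map Function.Embedding.inr)).map
      fun g => .gates (Layer.single g))

theorem replicate_groverInstrs_joinState (t : S) {A : Matrix (S → Bool) (S → Bool) ℂ}
    (hA : A ∈ Matrix.unitaryGroup (S → Bool) ℂ)
    {M : ℕ → Bool → Matrix (S ⊕ Fin K → Bool) (S ⊕ Fin K → Bool) ℂ} {l : ℕ} {k : Bool}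
    (hM : M l k = embedMatrix Function.Embedding.inl A) (j : Fin K) (r : ℕ)
    (Φ : (Fin K → Bool) → (S → Bool) → ℂ) :
    seqMatrix (((List.replicate r (groverInstrs t l k j)).flatten).map (runInstrMatrix M)) *ᵥ
      joinState Φ = joinState fun a => groverMatrix t A ^ (if a j then r else 0) *ᵥ Φ a := by
  induction r generalizing Φ with
  | zero => simp [seqMatrix]
  | succ r ih =>
    rw [List.replicate_succ, List.flatten_cons, List.map_append, seqMatrix_append,
      ← Matrix.mulVec_mulVec, groverInstrs_joinState t hA hM, ih]
    congr 1
    ext a s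
    cases a j
    · simp
    · simp [pow_succ]

theorem grover_joinState (t : S) {A : Matrix (S → Bool) (S → Bool) ℂ}
    (hA : A ∈ Matrix.unitaryGroup (S → Bool) ℂ)
    {M : ℕ → Bool → Matrix (S ⊕ Fin K → Bool) (S ⊕ Fin K → Bool) ℂ} {l : ℕ} {k : Bool}
    (hM : M l k = embedMatrix Function.Embedding.inl A)
    (L : List (Fin K)) (Φ : (Fin K → Bool) → (S → Bool) → ℂ) :
    seqMatrix ((L.flatMap fun j : Fin K =>
      (List.replicate (2 ^ (j : ℕ)) (groverInstrs t l k j)).flatten).map (runInstrMatrix M)) *ᵥ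
      joinState Φ = joinState fun a =>
        groverMatrix t A ^ (L.map fun j : Fin K => if a j then 2 ^ (j : ℕ) else 0).sum *ᵥ Φ a := by
  induction L generalizing Φ with
  | nil => simp [seqMatrix]
  | cons j L ih =>
    rw [List.flatMap_cons, List.map_append, seqMatrix_append, ← Matrix.mulVec_mulVec,
      replicate_groverInstrs_joinState t hA hM, ih]
    congr 1
    ext a s
    rw [List.map_cons, List.sum_cons, add_comm, pow_add, ← Matrix.mulVec_mulVec]

theorem seqMatrix_gates_inr (M : ℕ → Bool → Matrix (S ⊕ Fin K → Bool) (S ⊕ Fin K → Bool) ℂ)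
    (l : List (Gate (Fin K))) :
    seqMatrix (((l.map (Gate.map (Function.Embedding.inr : Fin K ↪ S ⊕ Fin K))).map
      fun g => RunInstr.gates (Layer.single g)).map (runInstrMatrix M)) =
      embedMatrix Function.Embedding.inr (gatesMatrix l) := by
  rw [← gatesMatrix_map, gatesMatrix, List.map_map]
  rfl

/-- The state at the end of a phase estimation run. -/
theorem phaseRun_mulVec (t : S) {A : Matrix (S → Bool) (S → Bool) ℂ}
    (hA : A ∈ Matrix.unitaryGroup (S → Bool) ℂ)
    {M : ℕ → Bool → Matrix (S ⊕ Fin (K + 1) → Bool) (S ⊕ Fin (K + 1) → Bool) ℂ} {l : ℕ} {k : Bool}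
    (hM : M l k = embedMatrix Function.Embedding.inl A) :
    seqMatrix ((phaseRun K t l k).map (runInstrMatrix M)) *ᵥ Pi.single (fun _ => false) 1 =
      joinState fun b => (-Complex.I) • ∑ a, qftMatrix (K + 1) b a •
        (sineWindow (2 ^ (K + 1)) (unsignedVal a) : ℂ) •
          (groverMatrix t A ^ unsignedVal a *ᵥ (A *ᵥ Pi.single (fun _ => false) 1)) := by
  have h0 : (Pi.single (fun _ => false) 1 : (S ⊕ Fin (K + 1) → Bool) → ℂ) =
      joinState fun a => (Pi.single (fun _ => false) 1 : (Fin (K + 1) → Bool) → ℂ) a •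
        Pi.single (fun _ => false) 1 := by
    ext x
    simp only [joinState, Pi.single_apply, Pi.smul_apply, smul_eq_mul, mul_ite, mul_one, mul_zero,
      ← ite_and]
    refine if_congr ?_ rfl rfl
    simp only [funext_iff, Sum.forall]
  have hval : ∀ a : Fin (K + 1) → Bool, ((List.finRange (K + 1)).map fun j : Fin (K + 1) =>
      if a j then 2 ^ (j : ℕ) else 0).sum = unsignedVal a := by
    intro a
    rw [← List.ofFn_eq_map, List.sum_ofFn, unsignedVal]
  rw [phaseRun, List.map_append, List.map_cons, List.map_append, seqMatrix_append, seqMatrix,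
    seqMatrix_append, seqMatrix_gates_inr, seqMatrix_gates_inr, runInstrMatrix, hM, h0]
  simp only [← Matrix.mulVec_mulVec, embedMatrix_inr_joinState, embedMatrix_inl_joinState,
    grover_joinState t hA hM, hval]
  congr 1
  ext b s
  have h1 : ∀ a : Fin (K + 1) → Bool, ∑ q, gatesMatrix (windowGates K) a q •
      (Pi.single (fun _ => false) 1 : (Fin (K + 1) → Bool) → ℂ) q •
        (Pi.single (fun _ => false) 1 : (S → Bool) → ℂ) =
      (-Complex.I * sineWindow (2 ^ (K + 1)) (unsignedVal a)) • Pi.single (fun _ => false) 1 := by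
    intro a
    rw [← windowGates_apply, Finset.sum_eq_single fun _ => false]
    · simp
    · intro q _ hq
      simp [hq]
    · simp
  simp only [h1, Matrix.mulVec_smul, Finset.smul_sum]
  simp only [Pi.smul_apply, smul_eq_mul, Finset.sum_apply]
  refine Finset.sum_congr rfl fun a _ => ?_
  rw [qftMatrix]
  ring

end

/-! ### The Grover iterate on the evaluation state -/

section
variable {S : Type} [Fintype S] [DecidableEq S] {K : ℕ}

theorem diagonal_sign_mem_unitary {B : Type*} [Fintype B] [DecidableEq B] (p : B → Prop)
    [DecidablePred p] : (Matrix.diagonal fun s => if p s then (-1 : ℂ) else 1) ∈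
      Matrix.unitaryGroup B ℂ := by
  rw [Matrix.mem_unitaryGroup_iff', Matrix.star_eq_conjTranspose, Matrix.diagonal_conjTranspose,
    Matrix.diagonal_mul_diagonal, ← Matrix.diagonal_one]
  congr 1
  ext s
  simp only [Pi.star_apply]
  split_ifs <;> simp

theorem groverMatrix_mem_unitary (t : S) {A : Matrix (S → Bool) (S → Bool) ℂ}
    (hA : A ∈ Matrix.unitaryGroup (S → Bool) ℂ) :
    groverMatrix t A ∈ Matrix.unitaryGroup (S → Bool) ℂ :=
  mul_mem (mul_mem (mul_mem hA (diagonal_sign_mem_unitary _)) (Unitary.star_mem hA))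
    (diagonal_sign_mem_unitary _)

/-- The squared norm of the component of the initial state with a `1` in the target qubit. -/
noncomputable def targetWeight (t : S) (ψ : (S → Bool) → ℂ) : ℝ :=
  ∑ s, if s t then ‖ψ s‖ ^ 2 else 0

theorem star_dotProduct_targetReflection (t : S) {ψ : (S → Bool) → ℂ}
    (hψ : ∑ s, ‖ψ s‖ ^ 2 = 1) :
    star ψ ⬝ᵥ (targetReflection t *ᵥ ψ) = ((1 - 2 * targetWeight t ψ : ℝ) : ℂ) := by
  have h : targetReflection t *ᵥ ψ =
      fun s => ((if s t then (-1 : ℝ) else 1 : ℝ) : ℂ) * ψ s := by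
    ext s
    rw [targetReflection, Matrix.mulVec_diagonal]
    split_ifs <;> simp
  rw [h, ← sum_mul_norm_sq_eq_dotProduct]
  congr 1
  rw [targetWeight, eq_sub_iff_add_eq, Finset.mul_sum, ← Finset.sum_add_distrib]
  refine Eq.trans ?_ hψ
  refine Finset.sum_congr rfl fun s _ => ?_
  split_ifs <;> ring

/-- Conjugating the sign change of the basis state 0 by `A` gives 1 − 2|ψ⟩⟨ψ|, where ψ is the column
of `A` at that state. -/
theorem reflection_mulVec {A : Matrix (S → Bool) (S → Bool) ℂ}
    (hA : A ∈ Matrix.unitaryGroup (S → Bool) ℂ) (y : (S → Bool) → ℂ) :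
    (A * zeroReflection S * Aᴴ) *ᵥ y = y - (2 * (star (A *ᵥ Pi.single (fun _ => false) 1) ⬝ᵥ y)) •
      (A *ᵥ Pi.single (fun _ => false) 1) := by
  have hz : ∀ u : (S → Bool) → ℂ, zeroReflection S *ᵥ u =
      u - (2 * u fun _ => false) • Pi.single (fun _ => false) 1 := by
    intro u
    ext s
    rw [zeroReflection, Matrix.mulVec_diagonal]
    by_cases h : s = fun _ => false
    · subst h
      simp
      ring
    · simp [h]
  have h1 : (Aᴴ *ᵥ y) (fun _ => false) = star (A *ᵥ Pi.single (fun _ => false) 1) ⬝ᵥ y := by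
    rw [Matrix.mulVec_single_one]
    rfl
  rw [Matrix.mem_unitaryGroup_iff, Matrix.star_eq_conjTranspose] at hA
  rw [← Matrix.mulVec_mulVec, ← Matrix.mulVec_mulVec, hz, Matrix.mulVec_sub, Matrix.mulVec_smul,
    Matrix.mulVec_mulVec, hA, Matrix.one_mulVec, h1]

theorem sum_norm_sq_column {A : Matrix (S → Bool) (S → Bool) ℂ}
    (hA : A ∈ Matrix.unitaryGroup (S → Bool) ℂ) :
    ∑ s, ‖(A *ᵥ Pi.single (fun _ => false) 1) s‖ ^ 2 = 1 := by
  rw [sum_norm_sq_mulVec hA, Finset.sum_eq_single fun _ => false]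
  · simp
  · intro s _ hs
    simp [hs]
  · simp

theorem groverMatrix_mulVec (t : S) {A : Matrix (S → Bool) (S → Bool) ℂ}
    (hA : A ∈ Matrix.unitaryGroup (S → Bool) ℂ) {ψ : (S → Bool) → ℂ}
    (hψ : ψ = A *ᵥ Pi.single (fun _ => false) 1) :
    groverMatrix t A *ᵥ ψ = targetReflection t *ᵥ ψ +
      ((2 * (2 * targetWeight t ψ - 1) : ℝ) : ℂ) • ψ := by
  have h1 : ∑ s, ‖ψ s‖ ^ 2 = 1 := by rw [hψ]; exact sum_norm_sq_column hA
  rw [groverMatrix, ← Matrix.mulVec_mulVec, reflection_mulVec hA, ← hψ,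
    star_dotProduct_targetReflection t h1, sub_eq_add_neg, ← neg_smul]
  congr 2
  push_cast
  ring

/-- A product of two reflections is a rotation of the plane spanned by ψ and its image under the
target reflection; this is its characteristic equation, obtained without eigenvectors and valid also
when the plane degenerates. It rests on G R ψ = −ψ for the target reflection R, since R² = 1. With w
the target weight, the cosine of the angle is 2w − 1, which is the mean to be estimated. -/
theorem groverMatrix_mulVec_mulVec (t : S) {A : Matrix (S → Bool) (S → Bool) ℂ}
    (hA : A ∈ Matrix.unitaryGroup (S → Bool) ℂ) {ψ : (S → Bool) → ℂ}
    (hψ : ψ = A *ᵥ Pi.single (fun _ => false) 1) :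
    groverMatrix t A *ᵥ (groverMatrix t A *ᵥ ψ) + ψ =
      ((2 * (2 * targetWeight t ψ - 1) : ℝ) : ℂ) • (groverMatrix t A *ᵥ ψ) := by
  have h1 : ∑ s, ‖ψ s‖ ^ 2 = 1 := by rw [hψ]; exact sum_norm_sq_column hA
  have h2 : groverMatrix t A *ᵥ (targetReflection t *ᵥ ψ) = -ψ := by
    have htt : targetReflection t * targetReflection t = 1 := by
      rw [targetReflection, Matrix.diagonal_mul_diagonal, ← Matrix.diagonal_one]
      congr 1
      ext s
      split_ifs <;> simp
    have hd := sum_mul_norm_sq_eq_dotProduct (fun _ => 1) ψ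
    simp only [one_mul, Complex.ofReal_one, h1] at hd
    change 1 = star ψ ⬝ᵥ ψ at hd
    rw [groverMatrix, ← Matrix.mulVec_mulVec, Matrix.mulVec_mulVec _ (targetReflection t), htt,
      Matrix.one_mulVec, reflection_mulVec hA, ← hψ, ← hd]
    ext s
    simp
    ring
  conv_lhs => rw [groverMatrix_mulVec t hA hψ, Matrix.mulVec_add, Matrix.mulVec_smul, h2]
  abel

/-- The states that phase estimation superposes. -/
noncomputable def groverState (t : S) (A : Matrix (S → Bool) (S → Bool) ℂ) (m : ℕ) :
    EuclideanSpace ℂ (S → Bool) :=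
  WithLp.toLp 2 (groverMatrix t A ^ m *ᵥ (A *ᵥ Pi.single (fun _ => false) 1))

theorem norm_groverState (t : S) {A : Matrix (S → Bool) (S → Bool) ℂ}
    (hA : A ∈ Matrix.unitaryGroup (S → Bool) ℂ) (m : ℕ) : ‖groverState t A m‖ = 1 := by
  rw [← sq_eq_sq₀ (norm_nonneg _) zero_le_one, EuclideanSpace.norm_sq_eq, one_pow,
    ← sum_norm_sq_column hA, ← sum_norm_sq_mulVec (pow_mem (groverMatrix_mem_unitary t hA) m)
      (A *ᵥ _)]
  rfl

theorem groverState_add_two (t : S) {A : Matrix (S → Bool) (S → Bool) ℂ}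
    (hA : A ∈ Matrix.unitaryGroup (S → Bool) ℂ) (m : ℕ) :
    groverState t A (m + 2) + groverState t A m =
      (2 * ((2 * targetWeight t (A *ᵥ Pi.single (fun _ => false) 1) - 1 : ℝ) : ℂ)) •
        groverState t A (m + 1) := by
  have h := congrArg (fun u => groverMatrix t A ^ m *ᵥ u) (groverMatrix_mulVec_mulVec t hA rfl)
  simp only [Matrix.mulVec_add, Matrix.mulVec_smul, Matrix.mulVec_mulVec, ← mul_assoc,
    ← pow_succ] at h
  rw [groverState, groverState, groverState, ← WithLp.toLp_add, ← WithLp.toLp_smul]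
  congr 1
  simp only [Matrix.mulVec_mulVec]
  rw [h]
  congr 1
  push_cast
  ring

/-- Unitarity removes the common power, leaving Re⟨ψ, Gψ⟩ = (1 − 2w) + 2(2w − 1). -/
theorem inner_groverState (t : S) {A : Matrix (S → Bool) (S → Bool) ℂ}
    (hA : A ∈ Matrix.unitaryGroup (S → Bool) ℂ) (m : ℕ) :
    (inner ℂ (groverState t A m) (groverState t A (m + 1))).re =
      2 * targetWeight t (A *ᵥ Pi.single (fun _ => false) 1) - 1 := by
  set ψ := A *ᵥ Pi.single (fun _ => false) 1 with hψ
  have h1 : ∑ s, ‖ψ s‖ ^ 2 = 1 := sum_norm_sq_column hA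
  have hd := sum_mul_norm_sq_eq_dotProduct (fun _ => 1) ψ
  simp only [one_mul, Complex.ofReal_one, h1] at hd
  change 1 = star ψ ⬝ᵥ ψ at hd
  have h2 : inner ℂ (groverState t A m) (groverState t A (m + 1)) =
      star ψ ⬝ᵥ (groverMatrix t A *ᵥ ψ) := by
    rw [groverState, groverState, EuclideanSpace.inner_toLp_toLp, dotProduct_comm, ← hψ, pow_succ,
      ← Matrix.mulVec_mulVec, star_mulVec_dotProduct_mulVec
        (pow_mem (groverMatrix_mem_unitary t hA) m)]
  rw [h2, groverMatrix_mulVec t hA hψ, dotProduct_add, dotProduct_smul, ← hd,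
    star_dotProduct_targetReflection t h1, smul_eq_mul, mul_one, ← Complex.ofReal_add,
    Complex.ofReal_re]
  ring

section
variable (t : S) {A : Matrix (S → Bool) (S → Bool) ℂ}
  (hA : A ∈ Matrix.unitaryGroup (S → Bool) ℂ)
  {M : ℕ → Bool → Matrix (S ⊕ Fin (K + 1) → Bool) (S ⊕ Fin (K + 1) → Bool) ℂ} {l : ℕ} {k : Bool}
  (hM : M l k = embedMatrix Function.Embedding.inl A)
include hA hM

/-- Only the phase register is read, so the system wires are summed into a squared norm; the global
factor −i of the window drops out. -/
theorem sum_phaseRun (g : (Fin (K + 1) → Bool) → ℝ) :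
    ∑ x, outcomeProb (seqMatrix ((phaseRun K t l k).map (runInstrMatrix M))) x *
      g (fun j => x (Sum.inr j)) =
    ∑ b, g b * ‖∑ a, qftMatrix (K + 1) b a • (sineWindow (2 ^ (K + 1)) (unsignedVal a) : ℂ) •
      groverState t A (unsignedVal a)‖ ^ 2 := by
  have h1 : ∀ x, outcomeProb (seqMatrix ((phaseRun K t l k).map (runInstrMatrix M))) x *
      g (fun j => x (Sum.inr j)) = g (fun j => x (Sum.inr j)) * ‖(joinState fun b =>
        (-Complex.I) • ∑ a, qftMatrix (K + 1) b a •
        (sineWindow (2 ^ (K + 1)) (unsignedVal a) : ℂ) •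
          (groverMatrix t A ^ unsignedVal a *ᵥ (A *ᵥ Pi.single (fun _ => false) 1))) x‖ ^ 2 := by
    intro x
    rw [← phaseRun_mulVec t hA hM, mulVec_single_zero (seqMatrix _), mul_comm]
    rfl
  rw [Finset.sum_congr rfl fun x _ => h1 x, sum_joinState]
  refine Finset.sum_congr rfl fun b _ => ?_
  rw [WithLp.toLp_smul, norm_smul, norm_neg, Complex.norm_I, one_mul, WithLp.toLp_sum]
  rfl

theorem sum_phaseRun_sub (hK : 1 ≤ K) :
    ∑ x, outcomeProb (seqMatrix ((phaseRun K t l k).map (runInstrMatrix M))) x *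
      (phaseEstimate (fun j => x (Sum.inr j)) -
        (2 * targetWeight t (A *ᵥ Pi.single (fun _ => false) 1) - 1)) = 0 := by
  rw [sum_phaseRun t hA hM fun b => phaseEstimate b -
    (2 * targetWeight t (A *ᵥ Pi.single (fun _ => false) 1) - 1)]
  exact sum_phaseEstimate_sub (by omega) (groverState_add_two t hA) (inner_groverState t hA)

theorem sum_phaseRun_sub_sq (hK : 1 ≤ K) :
    ∑ x, outcomeProb (seqMatrix ((phaseRun K t l k).map (runInstrMatrix M))) x *
      (phaseEstimate (fun j => x (Sum.inr j)) -
        (2 * targetWeight t (A *ᵥ Pi.single (fun _ => false) 1) - 1)) ^ 2 ≤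
      2 * Real.tan (Real.pi / 2 ^ (K + 1)) ^ 2 := by
  rw [sum_phaseRun t hA hM fun b => (phaseEstimate b -
    (2 * targetWeight t (A *ᵥ Pi.single (fun _ => false) 1) - 1)) ^ 2]
  exact sum_phaseEstimate_sub_sq (by omega) (norm_groverState t hA) (groverState_add_two t hA)

theorem sum_outcomeProb_phaseRun :
    ∑ x, outcomeProb (seqMatrix ((phaseRun K t l k).map (runInstrMatrix M))) x = 1 := by
  have hu : seqMatrix ((phaseRun K t l k).map (runInstrMatrix M)) ∈
      Matrix.unitaryGroup (S ⊕ Fin (K + 1) → Bool) ℂ := by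
    apply seqMatrix_mem_unitary
    intro N hN
    obtain ⟨i, hi, rfl⟩ := List.mem_map.1 hN
    have hMu : M l k ∈ Matrix.unitaryGroup (S ⊕ Fin (K + 1) → Bool) ℂ := by
      rw [hM]
      exact embedMatrix_mem_unitary _ hA
    simp only [phaseRun, groverInstrs, List.mem_append, List.mem_map, List.mem_cons,
      List.mem_flatMap, List.mem_flatten, List.mem_replicate] at hi
    rcases hi with ⟨g, -, rfl⟩ | rfl | ⟨j, -, L, ⟨-, rfl⟩, hi⟩ | ⟨g, -, rfl⟩
    · exact Layer.matrix_mem_unitary _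
    · exact hMu
    · simp only [List.mem_cons, List.not_mem_nil, or_false] at hi
      rcases hi with rfl | rfl | rfl | rfl | rfl | rfl
      · exact Layer.matrix_mem_unitary _
      · exact Unitary.star_mem hMu
      · exact Layer.matrix_mem_unitary _
      · exact Layer.matrix_mem_unitary _
      · exact Layer.matrix_mem_unitary _
      · exact hMu
    · exact Layer.matrix_mem_unitary _
  rw [← sum_norm_sq_column hu]
  refine Finset.sum_congr rfl fun x _ => ?_
  rw [mulVec_single_zero (seqMatrix _)]
  rfl

end

/-- The depth of a step of a run, given the depths of the evaluation circuits. -/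
def runInstrDepth {W : Type} [DecidableEq W] (D : ℕ → Bool → ℕ) : RunInstr W → ℕ
  | .gates _ => 1
  | .eval l k => D l k
  | .evalInv l k => D l k

/-- Fewer than 2^(K+1) iterates are applied, each with two evaluation circuits and four further
layers. The Fourier transform is charged twice, in the window and at the end. -/
theorem phaseRun_depth (t : S) (l : ℕ) (k : Bool) (D : ℕ → Bool → ℕ) :
    ((phaseRun K t l k).map (runInstrDepth D)).sum ≤
      (2 + (K + 1) * (K + 2) + (K + 1)) + D l k + 2 ^ (K + 1) * (2 * D l k + 4) +
        (K + 1) * (K + 2) := by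
  have hq : (qftStages (K + 1) (K + 1)).length ≤ (K + 1) * (K + 2) := qftStages_length (K + 1)
  have hw : (windowGates K).length ≤ 2 + (K + 1) * (K + 2) + (K + 1) := by
    simp only [windowGates, List.length_append, List.length_map, List.length_cons,
      List.length_finRange]
    omega
  have hg : ∀ L : List (Gate (Fin (K + 1))),
      (((L.map (Gate.map (Function.Embedding.inr : Fin (K + 1) ↪ S ⊕ Fin (K + 1)))).map
        fun g => RunInstr.gates (Layer.single g)).map (runInstrDepth D)).sum = L.length := by
    intro L
    simp [Function.comp_def, runInstrDepth]
  have hs : ∀ j : Fin (K + 1),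
      (((groverInstrs t l k j)).map (runInstrDepth D)).sum = 2 * D l k + 4 := by
    intro j
    simp [groverInstrs, runInstrDepth]
    ring
  have hr : ∀ (j : Fin (K + 1)) (r : ℕ), ((List.replicate r (groverInstrs t l k j)).flatten.map
      (runInstrDepth D)).sum = r * (2 * D l k + 4) := by
    intro j r
    induction r with
    | zero => simp
    | succ r ih =>
      rw [List.replicate_succ, List.flatten_cons, List.map_append, List.sum_append, ih, hs]
      ring
  have hf : ∀ L : List (Fin (K + 1)), ((L.flatMap fun j : Fin (K + 1) =>
      (List.replicate (2 ^ (j : ℕ)) (groverInstrs t l k j)).flatten).map (runInstrDepth D)).sum =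
      (L.map fun j : Fin (K + 1) => 2 ^ (j : ℕ)).sum * (2 * D l k + 4) := by
    intro L
    induction L with
    | nil => simp
    | cons j L ih =>
      rw [List.flatMap_cons, List.map_append, List.sum_append, ih, hr, List.map_cons,
        List.sum_cons]
      ring
  have h2 : ((List.finRange (K + 1)).map fun j : Fin (K + 1) => 2 ^ (j : ℕ)).sum
      ≤ 2 ^ (K + 1) := by
    rw [← List.ofFn_eq_map, List.sum_ofFn, Fin.sum_univ_eq_sum_range (fun i => 2 ^ i),
      Nat.geomSum_eq le_rfl]
    simp
  rw [phaseRun, List.map_append, List.sum_append, List.map_cons, List.sum_cons, List.map_append,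
    List.sum_append, hg, hg, hf]
  have h3 := Nat.mul_le_mul_right (2 * D l k + 4) h2
  simp only [runInstrDepth]
  omega

end

/-! ### Chebyshev's inequality for independent runs -/

section
variable {N : ℕ} {B : Type} [Fintype B]

/-- Both errors are written as products over all runs, so the expectation factors; for i ≠ j the
factor of run i is a mean, which is zero. -/
theorem sum_prod_mul_mul (p : Fin N → B → ℝ) (hp1 : ∀ i, ∑ b, p i b = 1) (e : Fin N → B → ℝ)
    (hmean : ∀ i, ∑ b, p i b * e i b = 0) (i j : Fin N) :
    ∑ o : Fin N → B, (∏ k, p k (o k)) * (e i (o i) * e j (o j)) =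
      if i = j then ∑ b, p i b * e i b ^ 2 else 0 := by
  classical
  have h1 : ∀ o : Fin N → B, (∏ k, p k (o k)) * (e i (o i) * e j (o j)) =
      ∏ k, (p k (o k) * ((if k = i then e k (o k) else 1) * if k = j then e k (o k) else 1)) := by
    intro o
    rw [Finset.prod_mul_distrib, Finset.prod_mul_distrib]
    simp
  simp only [h1]
  rw [← Fintype.prod_sum fun k b =>
    p k b * ((if k = i then e k b else 1) * if k = j then e k b else 1)]
  split_ifs with h
  · subst h
    rw [Finset.prod_eq_single i]
    · simp [sq]
    · intro k _ hk
      simp [hk, hp1]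
    · simp
  · apply Finset.prod_eq_zero (Finset.mem_univ i)
    simp [h, hmean]

theorem sum_prod_mul_sq_le (p : Fin N → B → ℝ) (hp1 : ∀ i, ∑ b, p i b = 1) (e : Fin N → B → ℝ)
    (hmean : ∀ i, ∑ b, p i b * e i b = 0) {v : ℝ} (hvar : ∀ i, ∑ b, p i b * e i b ^ 2 ≤ v)
    (a : Fin N → ℝ) :
    ∑ o : Fin N → B, (∏ k, p k (o k)) * (∑ i, a i * e i (o i)) ^ 2 ≤ (∑ i, a i ^ 2) * v := by
  have h1 : ∀ o : Fin N → B, (∏ k, p k (o k)) * (∑ i, a i * e i (o i)) ^ 2 =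
      ∑ i, ∑ j, a i * a j * ((∏ k, p k (o k)) * (e i (o i) * e j (o j))) := by
    intro o
    rw [sq, Finset.sum_mul_sum, Finset.mul_sum]
    refine Finset.sum_congr rfl fun i _ => ?_
    rw [Finset.mul_sum]
    exact Finset.sum_congr rfl fun j _ => by ring
  simp only [h1]
  rw [Finset.sum_comm, Finset.sum_mul]
  refine Finset.sum_le_sum fun i _ => ?_
  rw [Finset.sum_comm]
  simp only [← Finset.mul_sum, sum_prod_mul_mul p hp1 e hmean]
  simp only [mul_ite, mul_zero, Finset.sum_ite_eq, Finset.mem_univ, if_true]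
  rw [← sq]
  exact mul_le_mul_of_nonneg_left (hvar i) (sq_nonneg _)

open Classical in
/-- Chebyshev's inequality for a linear combination of independent variables. -/
theorem one_sub_le_sum_prod (p : Fin N → B → ℝ) (hp0 : ∀ i b, 0 ≤ p i b)
    (hp1 : ∀ i, ∑ b, p i b = 1) (e : Fin N → B → ℝ)
    (hmean : ∀ i, ∑ b, p i b * e i b = 0) {v : ℝ} (hvar : ∀ i, ∑ b, p i b * e i b ^ 2 ≤ v)
    (a : Fin N → ℝ) {ε δ : ℝ} (hε : 0 < ε) (hδ : (∑ i, a i ^ 2) * v ≤ δ * ε ^ 2)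
    (good : (Fin N → B) → Prop) (hgood : ∀ o, |∑ i, a i * e i (o i)| ≤ ε → good o) :
    1 - δ ≤ ∑ o : Fin N → B, if good o then ∏ k, p k (o k) else 0 := by
  have htot : ∑ o : Fin N → B, ∏ k, p k (o k) = 1 := by
    rw [← Fintype.prod_sum]
    simp [hp1]
  have h2 := (sum_prod_mul_sq_le p hp1 e hmean hvar a).trans hδ
  -- Markov's inequality: outside the good outcomes the squared error exceeds ε².
  have h3 : (∑ o : Fin N → B, if good o then 0 else ∏ k, p k (o k)) * ε ^ 2 ≤ δ * ε ^ 2 := by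
    refine le_trans ?_ h2
    rw [Finset.sum_mul]
    refine Finset.sum_le_sum fun o _ => ?_
    have hpos : 0 ≤ ∏ k, p k (o k) := Finset.prod_nonneg fun k _ => hp0 k _
    split_ifs with h
    · rw [zero_mul]
      exact mul_nonneg hpos (sq_nonneg _)
    · refine mul_le_mul_of_nonneg_left ?_ hpos
      have : ε < |∑ i, a i * e i (o i)| := not_le.1 fun h' => h (hgood o h')
      rw [← sq_abs (∑ i, a i * e i (o i))]
      exact pow_le_pow_left₀ hε.le this.le 2
  have h4 := le_of_mul_le_mul_right h3 (by positivity)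
  have h5 : (∑ o : Fin N → B, if good o then ∏ k, p k (o k) else 0) +
      (∑ o : Fin N → B, if good o then 0 else ∏ k, p k (o k)) = 1 := by
    rw [← htot, ← Finset.sum_add_distrib]
    refine Finset.sum_congr rfl fun o _ => ?_
    split_ifs <;> simp
  linarith

end

/-! ### The real form of the Fourier approximation -/

theorem fourierCoef_neg (f : ℝ → ℝ) (a P : ℝ) (l : ℤ) :
    fourierCoef f a P (-l) = (starRingEnd ℂ) (fourierCoef f a P l) := by
  rw [fourierCoef, fourierCoef, map_mul, intervalIntegral.intervalIntegral_eq_integral_uIoc,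
    intervalIntegral.intervalIntegral_eq_integral_uIoc, Complex.real_smul, Complex.real_smul,
    map_mul, ← integral_conj, Complex.conj_ofReal]
  congr 1
  · simp
  · congr 2
    ext x
    rw [map_mul, Complex.conj_ofReal, ← Complex.exp_conj, map_mul, Complex.conj_I, map_neg,
      Complex.conj_ofReal]
    congr 2
    push_cast
    ring

theorem sum_Icc_neg {M : Type*} [AddCommMonoid M] (L : ℕ) (F : ℤ → M) :
    ∑ l ∈ (Finset.Icc (-(L : ℤ)) L).erase 0, F l =
      ∑ i : Fin L, (F ((i : ℤ) + 1) + F (-((i : ℤ) + 1))) := by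
  rw [Finset.sum_add_distrib]
  have hunion : (Finset.Icc (-(L : ℤ)) L).erase 0 =
      (Finset.univ.image fun i : Fin L => (i : ℤ) + 1) ∪
        (Finset.univ.image fun i : Fin L => -((i : ℤ) + 1)) := by
    ext l
    simp only [Finset.mem_erase, Finset.mem_Icc, Finset.mem_union, Finset.mem_image,
      Finset.mem_univ, true_and]
    constructor
    · rintro ⟨h0, h1, h2⟩
      rcases lt_or_gt_of_ne h0 with h | h
      · exact Or.inr ⟨⟨(-l - 1).toNat, by omega⟩, by simp; omega⟩
      · exact Or.inl ⟨⟨(l - 1).toNat, by omega⟩, by simp; omega⟩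
    · rintro (⟨i, rfl⟩ | ⟨i, rfl⟩) <;> have := i.isLt <;> omega
  rw [hunion, Finset.sum_union, Finset.sum_image, Finset.sum_image]
  · intro i _ j _ h
    apply Fin.ext
    simp only at h
    omega
  · intro i _ j _ h
    apply Fin.ext
    simp only at h
    omega
  · rw [Finset.disjoint_left]
    intro l h1 h2
    obtain ⟨i, -, rfl⟩ := Finset.mem_image.1 h1
    obtain ⟨j, -, h⟩ := Finset.mem_image.1 h2
    omega

/-- The coefficients of the cosines and sines in the real form of the Fourier approximation. -/
noncomputable def trigCoef (f : ℝ → ℝ) (a P : ℝ) (l : ℕ) (k : Bool) : ℝ :=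
  if k then -2 * (fourierCoef f a P l).im else 2 * (fourierCoef f a P l).re

/-- The cosine (`k = false`) or the sine (`k = true`). -/
noncomputable def trigFun (k : Bool) (x : ℝ) : ℝ := if k then Real.sin x else Real.cos x

/-- For real `f` the frequencies l and −l have conjugate coefficients, so each pair contributes 2
Re(c_l exp(iθ)). -/
theorem fourierApprox_eq (f : ℝ → ℝ) (a P : ℝ) (L : ℕ) (x : ℝ) :
    fourierApprox f a P L x = (((fourierCoef f a P 0).re + ∑ i : Fin L, ∑ k : Bool,
      trigCoef f a P (i + 1) k * trigFun k (2 * Real.pi * ((i + 1 : ℕ) : ℝ) / P * x) : ℝ) : ℂ) := by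
  have h0 : fourierCoef f a P 0 = ((fourierCoef f a P 0).re : ℂ) := by
    have := fourierCoef_neg f a P 0
    rw [neg_zero] at this
    exact (Complex.conj_eq_iff_re.1 this.symm).symm
  rw [fourierApprox, ← Finset.add_sum_erase (Finset.Icc (-(L : ℤ)) L) _ (a := 0) (by simp),
    sum_Icc_neg, Complex.ofReal_add, ← h0, Complex.ofReal_sum]
  congr 1
  · simp
  · refine Finset.sum_congr rfl fun i _ => ?_
    rw [fourierCoef_neg, Fintype.sum_bool, trigCoef, trigCoef, trigFun, trigFun]
    simp only [if_true, Bool.false_eq_true, if_false]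
    set c := fourierCoef f a P ((i : ℤ) + 1) with hc
    have hc' : fourierCoef f a P (((i : ℕ) + 1 : ℕ) : ℤ) = c := by rw [hc]; push_cast; rfl
    rw [hc']
    set θ := 2 * Real.pi * (((i : ℕ) + 1 : ℕ) : ℝ) / P * x with hθ
    have h1 : (2 * Real.pi * (((i : ℤ) + 1 : ℤ) : ℝ) * x / P : ℝ) = θ := by
      rw [hθ]; push_cast; ring
    have h2 : (2 * Real.pi * ((-((i : ℤ) + 1) : ℤ) : ℝ) * x / P : ℝ) = -θ := by
      rw [hθ]; push_cast; ring
    rw [h1, h2, Complex.exp_mul_I, Complex.exp_mul_I, ← Complex.ofReal_cos, ← Complex.ofReal_sin,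
      ← Complex.ofReal_cos, ← Complex.ofReal_sin, Real.cos_neg, Real.sin_neg]
    apply Complex.ext <;> simp <;> ring

/-- Each pair contributes 4|c_l|² = 2(|c_l|² + |c_{−l}|²). This connects the variance of the
estimate to the mean square fluctuation that `K` bounds. -/
theorem sum_trigCoef_sq (f : ℝ → ℝ) (a P : ℝ) (L : ℕ) :
    ∑ i : Fin L, ∑ k : Bool, trigCoef f a P (i + 1) k ^ 2 =
      2 * ∑ l ∈ (Finset.Icc (-(L : ℤ)) L).erase 0, ‖fourierCoef f a P l‖ ^ 2 := by
  rw [sum_Icc_neg, Finset.mul_sum]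
  refine Finset.sum_congr rfl fun i _ => ?_
  rw [fourierCoef_neg, RCLike.norm_conj, Fintype.sum_bool, trigCoef, trigCoef, Complex.sq_norm,
    Complex.normSq_apply]
  push_cast
  simp only [if_true]
  ring

/-! ### The estimator -/

section
variable {Q R S : Type} [Fintype Q] [DecidableEq Q] [Fintype R] [DecidableEq R]
  [Fintype S] [DecidableEq S] {n : ℕ}

/-- The estimator that runs phase estimation once for each cosine and each sine. -/
noncomputable def phaseEstimator (eQ : Q ↪ S) (eR : Fin n × R ↪ S) (t : S)
    (p : List (S × Finset S)) (ph : List (S × S × ℝ)) (f : ℝ → ℝ) (a P : ℝ) (L K : ℕ) :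
    Estimator Q R n where
  Wire := S ⊕ Fin (K + 1)
  fintypeWire := inferInstance
  decidableEqWire := inferInstance
  target := Sum.inl t
  -- The test reads 1 with probability (1 − cos(κJ + φ))/2 for each J: the phase φ = π yields the
  -- cosine and φ = π/2 the sine.
  evalCircuit l k := (evalInstrs eQ eR t p ph (2 * Real.pi * l / P)
    (if k then Real.pi / 2 else Real.pi)).map (EvalInstr.map Function.Embedding.inl)
  numRuns := L * 2
  run i := phaseRun K t ((finProdFinEquiv.symm i).1 + 1) (finTwoEquiv (finProdFinEquiv.symm i).2)
  estimate o := (fourierCoef f a P 0).re + ∑ i : Fin (L * 2),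
    trigCoef f a P ((finProdFinEquiv.symm i).1 + 1) (finTwoEquiv (finProdFinEquiv.symm i).2) *
      phaseEstimate fun j => o i (Sum.inr j)

variable (eQ : Q ↪ S) (eR : Fin n × R ↪ S) (t : S)
    (p : List (S × Finset S)) (ph : List (S × S × ℝ)) (f : ℝ → ℝ) (a P : ℝ) (L K : ℕ)

theorem sum_runs {M : Type*} [AddCommMonoid M] (F : ℕ → Bool → M) :
    ∑ i : Fin (L * 2), F ((finProdFinEquiv.symm i).1 + 1)
      (finTwoEquiv (finProdFinEquiv.symm i).2) = ∑ i : Fin L, ∑ k : Bool, F (i + 1) k := by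
  rw [Equiv.sum_comp finProdFinEquiv.symm fun x : Fin L × Fin 2 => F (x.1 + 1) (finTwoEquiv x.2),
    Fintype.sum_prod_type]
  refine Finset.sum_congr rfl fun i _ => ?_
  exact Equiv.sum_comp finTwoEquiv fun k => F (i + 1) k

theorem phaseEstimator_evalDepth (dp dq l : ℕ) (k : Bool) :
    (phaseEstimator eQ eR t p ph f a P L K).evalDepth dp dq l k =
      dp + dq + p.length + ph.length + 3 := by
  rw [← evalInstrs_depth eQ eR t p ph (2 * Real.pi * l / P)
    (if k then Real.pi / 2 else Real.pi) dp dq]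
  refine congrArg List.sum (List.map_map.trans (List.map_congr_left fun i _ => ?_))
  exact EvalInstr.map_depth _ _ _ _

/-- With D the evaluation depth, one initial evaluation and two per iterate cost at most
3·2^(K+1)·D. The Fourier transforms are quadratic in `K`, so together with the four layers per
iterate the rest fits into 11·2^(K+1). -/
theorem phaseEstimator_time_le (dp dq : ℕ) :
    (phaseEstimator eQ eR t p ph f a P L K).time dp dq ≤
      2 * L * (2 ^ (K + 1) * (3 * (dp + dq + p.length + ph.length + 3) + 11)) := by
  have hD := phaseEstimator_evalDepth eQ eR t p ph f a P L K dp dq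
  set D := dp + dq + p.length + ph.length + 3
  have hi : (phaseEstimator eQ eR t p ph f a P L K).instrDepth dp dq =
      runInstrDepth fun _ _ => D := by
    funext i
    cases i with
    | gates s => rfl
    | eval l k => exact hD l k
    | evalInv l k => exact hD l k
  have hK : (K + 1) * (K + 2) ≤ 2 * 2 ^ (K + 1) ∧ K + 2 ≤ 2 ^ (K + 1) := by
    clear hi hD
    induction K with
    | zero => simp
    | succ K ih =>
      obtain ⟨h1, h2⟩ := ih
      rw [pow_succ]
      constructor <;> nlinarith
  calc (phaseEstimator eQ eR t p ph f a P L K).time dp dq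
      ≤ ∑ _i : Fin (L * 2), 2 ^ (K + 1) * (3 * D + 11) := by
        refine Finset.sum_le_sum fun i _ => ?_
        rw [hi]
        refine (phaseRun_depth (K := K) t ((finProdFinEquiv.symm i).1 + 1)
          (finTwoEquiv (finProdFinEquiv.symm i).2) (fun _ _ => D)).trans ?_
        have h1 : 1 * D ≤ 2 ^ (K + 1) * D := Nat.mul_le_mul_right D Nat.one_le_two_pow
        obtain ⟨hK1, hK2⟩ := hK
        have h3 : 2 ^ (K + 1) * (3 * D + 11) = 3 * (2 ^ (K + 1) * D) + 11 * 2 ^ (K + 1) := by ring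
        have h4 : 2 ^ (K + 1) * (2 * D + 4) = 2 * (2 ^ (K + 1) * D) + 4 * 2 ^ (K + 1) := by ring
        rw [h3, h4]
        generalize (K + 1) * (K + 2) = x at *
        generalize 2 ^ (K + 1) * D = y at *
        omega
    _ = _ := by
        rw [Finset.sum_const, Finset.card_univ, Fintype.card_fin, smul_eq_mul]
        ring

theorem phaseEstimator_evalMatrix (U : Matrix (Q → Bool) (Q → Bool) ℂ)
    (V : Matrix (R → Bool) (R → Bool) ℂ) (l : ℕ) (k : Bool) :
    (phaseEstimator eQ eR t p ph f a P L K).evalMatrix U V l k =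
      embedMatrix Function.Embedding.inl (seqMatrix ((evalInstrs eQ eR t p ph
        (2 * Real.pi * l / P) (if k then Real.pi / 2 else Real.pi)).map
        (EvalInstr.matrix U V))) := by
  rw [embedMatrix_seqMatrix, List.map_map]
  refine congrArg seqMatrix (List.map_map.trans (List.map_congr_left fun i _ => ?_))
  exact EvalInstr.map_matrix _ _ _ _

theorem phaseEstimator_runMatrix (U : Matrix (Q → Bool) (Q → Bool) ℂ)
    (V : Matrix (R → Bool) (R → Bool) ℂ) (i : Fin (L * 2)) :
    (phaseEstimator eQ eR t p ph f a P L K).runMatrix U V i =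
      seqMatrix ((phaseRun K t ((finProdFinEquiv.symm i).1 + 1)
        (finTwoEquiv (finProdFinEquiv.symm i).2)).map
        (runInstrMatrix ((phaseEstimator eQ eR t p ph f a P L K).evalMatrix U V))) := by
  refine congrArg seqMatrix (List.map_congr_left fun i _ => ?_)
  cases i <;> rfl

theorem sum_target_embedMatrix (A : Matrix (S → Bool) (S → Bool) ℂ) :
    ∑ x : S ⊕ Fin (K + 1) → Bool, (if x (Sum.inl t) then
      outcomeProb (embedMatrix Function.Embedding.inl A) x else 0) =
      targetWeight t (A *ᵥ Pi.single (fun _ => false) 1) := by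
  have h1 : ∀ x : S ⊕ Fin (K + 1) → Bool,
      outcomeProb (embedMatrix Function.Embedding.inl A) x =
      if (fun j => x (Sum.inr j)) = fun _ => false then
        outcomeProb A fun s => x (Sum.inl s) else 0 := by
    intro x
    rw [outcomeProb]
    simp only [embedMatrix, Matrix.of_apply]
    have h2 : (∀ w, (∀ q : S, (Function.Embedding.inl : S ↪ S ⊕ Fin (K + 1)) q ≠ w) →
        x w = false) ↔ (fun j => x (Sum.inr j)) = fun _ => false := by
      constructor
      · intro h
        ext j
        rw [h (Sum.inr j) (by simp)]
      · intro h w hw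
        rcases w with s | j
        · exact absurd rfl (hw s)
        · exact congrFun h j
    rw [if_congr h2 rfl rfl]
    split_ifs
    · rfl
    · simp
  simp only [h1]
  rw [← Equiv.sum_comp (Equiv.sumArrowEquivProdArrow S (Fin (K + 1)) Bool).symm,
    Fintype.sum_prod_type, targetWeight]
  refine Finset.sum_congr rfl fun s _ => ?_
  have h3 : ∀ b : Fin (K + 1) → Bool,
      (if (Equiv.sumArrowEquivProdArrow S (Fin (K + 1)) Bool).symm (s, b) (Sum.inl t) = true then
        if (fun j => (Equiv.sumArrowEquivProdArrow S (Fin (K + 1)) Bool).symm (s, b) (Sum.inr j)) =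
          fun _ => false then outcomeProb A fun s' =>
          (Equiv.sumArrowEquivProdArrow S (Fin (K + 1)) Bool).symm (s, b) (Sum.inl s')
        else 0 else 0) = if b = fun _ => false then (if s t then outcomeProb A s else 0) else 0 := by
    intro b
    change (if s t = true then if b = fun _ => false then outcomeProb A s else 0 else 0) = _
    split_ifs <;> rfl
  rw [Finset.sum_congr rfl fun b _ => h3 b, Finset.sum_ite_eq' Finset.univ, if_pos (Finset.mem_univ _)]
  rw [mulVec_single_zero A s]
  rfl

end

/-! ### Accuracy and cost of the estimator -/

section
variable {Q R S : Type} [Fintype Q] [DecidableEq Q] [Fintype R] [DecidableEq R]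
  [Fintype S] [DecidableEq S] {n : ℕ}

theorem evalInstrs_mem_unitary (eQ : Q ↪ S) (eR : Fin n × R ↪ S) (t : S)
    (p : List (S × Finset S)) (ph : List (S × S × ℝ)) (κ φ : ℝ)
    {U : Matrix (Q → Bool) (Q → Bool) ℂ} {V : Matrix (R → Bool) (R → Bool) ℂ}
    (hU : U ∈ Matrix.unitaryGroup (Q → Bool) ℂ) (hV : V ∈ Matrix.unitaryGroup (R → Bool) ℂ) :
    seqMatrix ((evalInstrs eQ eR t p ph κ φ).map (EvalInstr.matrix U V)) ∈
      Matrix.unitaryGroup (S → Bool) ℂ := by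
  apply seqMatrix_mem_unitary
  intro N hN
  obtain ⟨i, -, rfl⟩ := List.mem_map.1 hN
  exact i.matrix_mem_unitary hU hV

theorem sum_outcomeProb {U : Matrix (Q → Bool) (Q → Bool) ℂ}
    (hU : U ∈ Matrix.unitaryGroup (Q → Bool) ℂ) : ∑ q, outcomeProb U q = 1 := by
  rw [← sum_norm_sq_column hU]
  refine Finset.sum_congr rfl fun q _ => ?_
  rw [mulVec_single_zero U q]
  rfl

/-- The mean of the Fourier approximation is a real linear combination of the means `c l k`, and the
estimate is the same combination of independent unbiased estimates, so Chebyshev's inequality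
applies with the total variance in `hvar`. All expectations are moved to the finite law of the
registers by `hlaw`. -/
theorem phaseEstimator_estimates (eQ : Q ↪ S) (eR : Fin n × R ↪ S) (t : S)
    (hQR : ∀ a b, eQ a ≠ eR b) (htR : ∀ b, eR b ≠ t)
    (p : List (S × Finset S)) (hp : ∀ g ∈ p, ∀ a, g.1 ≠ eQ a) (z : (Q → Bool) → S → Bool)
    (hz : ∀ q, runFlips p (Function.extend eQ q fun _ => false) = z q) (hzt : ∀ q, z q t = false)
    (ph : List (S × S × ℝ)) (hph : ∀ a ∈ ph, a.1 ≠ t ∧ a.2.1 ≠ t)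
    (prep : Circuit Q) (integral : Circuit R) (Jq : (Q → Bool) → ℝ)
    (hJ : ∀ q x, prep.matrix q (fun _ => false) ≠ 0 → (∀ a, x (eQ a) = q a) →
      (∀ j, integral.matrix (fun r => x (eR (j, r))) (fun r => z q (eR (j, r))) ≠ 0) →
        phaseSum ph x = Jq q)
    {Ω : Type*} [MeasurableSpace Ω] (μ : Measure Ω) (J : Ω → ℝ)
    (hlaw : ∀ φ : ℝ → ℂ, ∫ ω, φ (J ω) ∂μ = ∑ q, (outcomeProb prep.matrix q : ℂ) * φ (Jq q))
    (f : ℝ → ℝ) (a P : ℝ) (L K : ℕ) {ε δ : ℝ} (hε : 0 < ε) (hK : 1 ≤ K)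
    (hvar : (∑ i : Fin L, ∑ k : Bool, trigCoef f a P (i + 1) k ^ 2) *
      (2 * Real.tan (Real.pi / 2 ^ (K + 1)) ^ 2) ≤ δ * ε ^ 2) :
    (phaseEstimator eQ eR t p ph f a P L K).Estimates prep integral μ J f a P L ε δ := by
  have hU := prep.matrix_mem_unitary
  have hV := integral.matrix_mem_unitary
  set pr := outcomeProb prep.matrix with hpr
  have hpr1 : ∑ q, pr q = 1 := sum_outcomeProb hU
  have hpr0 : ∀ q, 0 ≤ pr q := fun q => sq_nonneg _
  have hlawR : ∀ φ : ℝ → ℝ, ∫ ω, φ (J ω) ∂μ = ∑ q, pr q * φ (Jq q) := by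
    intro φ
    have h := hlaw fun x => (φ x : ℂ)
    rw [integral_complex_ofReal] at h
    exact_mod_cast h
  set A : ℕ → Bool → Matrix (S → Bool) (S → Bool) ℂ := fun l k =>
    seqMatrix ((evalInstrs eQ eR t p ph (2 * Real.pi * l / P)
      (if k then Real.pi / 2 else Real.pi)).map (EvalInstr.matrix prep.matrix integral.matrix))
    with hA
  have hAu : ∀ l k, A l k ∈ Matrix.unitaryGroup (S → Bool) ℂ := fun l k =>
    evalInstrs_mem_unitary _ _ _ _ _ _ _ hU hV
  set c : ℕ → Bool → ℝ := fun l k => ∑ q, pr q * trigFun k (2 * Real.pi * l / P * Jq q) with hc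
  have htw : ∀ l k, targetWeight t (A l k *ᵥ Pi.single (fun _ => false) 1) = (1 + c l k) / 2 := by
    intro l k
    have h := evalInstrs_targetProb eQ eR t hQR htR hV p hp z hz hzt ph hph Jq hJ
      (2 * Real.pi * l / P) (if k then Real.pi / 2 else Real.pi)
    have h1 : targetWeight t (A l k *ᵥ Pi.single (fun _ => false) 1) =
        ∑ x, if x t then outcomeProb (A l k) x else 0 := by
      rw [targetWeight]
      refine Finset.sum_congr rfl fun x _ => ?_
      rw [mulVec_single_zero (A l k) x]
      rfl
    rw [h1]
    refine h.trans ?_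
    have h2 : 1 + c l k = ∑ q, (pr q + pr q * trigFun k (2 * Real.pi * l / P * Jq q)) := by
      rw [Finset.sum_add_distrib, hpr1]
    rw [eq_div_iff (two_ne_zero), Finset.sum_mul, h2]
    refine Finset.sum_congr rfl fun q _ => ?_
    rw [trigFun]
    change pr q * _ * 2 = _
    cases k
    · simp only [Bool.false_eq_true, if_false, Real.cos_add_pi]
      ring
    · simp only [if_true, Real.cos_add_pi_div_two]
      ring
  have htp : ∀ l k, (phaseEstimator eQ eR t p ph f a P L K).targetProb prep.matrix
      integral.matrix l k = (1 + c l k) / 2 := by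
    intro l k
    rw [← htw, ← sum_target_embedMatrix t K, Estimator.targetProb, phaseEstimator_evalMatrix]
    rfl
  refine ⟨fun l _ _ => ?_, fun l _ _ => ?_, ?_⟩
  · rw [htp, hlawR fun x => Real.cos (2 * Real.pi * l / P * x)]
    rfl
  · rw [htp, hlawR fun x => Real.sin (2 * Real.pi * l / P * x)]
    rfl
  · set cf : Fin (L * 2) → ℝ := fun i => trigCoef f a P ((finProdFinEquiv.symm i).1 + 1)
      (finTwoEquiv (finProdFinEquiv.symm i).2) with hcf
    set ci : Fin (L * 2) → ℝ := fun i => c ((finProdFinEquiv.symm i).1 + 1)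
      (finTwoEquiv (finProdFinEquiv.symm i).2) with hci
    set g : ℝ → ℝ := fun x => (fourierCoef f a P 0).re + ∑ i : Fin L, ∑ k : Bool,
      trigCoef f a P (i + 1) k * trigFun k (2 * Real.pi * ((i + 1 : ℕ) : ℝ) / P * x) with hg
    have hfa : ∀ x, fourierApprox f a P L x = (g x : ℂ) := fourierApprox_eq f a P L
    set E : ℝ := (fourierCoef f a P 0).re + ∑ i, cf i * ci i with hE
    have hEg : ∑ q, pr q * g (Jq q) = E := by
      rw [hE, sum_runs L fun l k => trigCoef f a P l k * c l k]
      simp only [hg, mul_add, Finset.sum_add_distrib, ← Finset.sum_mul, hpr1, one_mul]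
      congr 1
      simp only [Finset.mul_sum, hc]
      rw [Finset.sum_comm]
      refine Finset.sum_congr rfl fun i _ => ?_
      rw [Finset.sum_comm]
      refine Finset.sum_congr rfl fun k _ => Finset.sum_congr rfl fun q _ => ?_
      ring
    have hint1 : ∫ ω, fourierApprox f a P L (J ω) ∂μ = (E : ℂ) := by
      rw [hlaw, ← hEg]
      simp only [hfa]
      push_cast
      rfl
    have hint2 : ∫ ω, ‖(f (J ω) : ℂ) - fourierApprox f a P L (J ω)‖ ∂μ =
        ∑ q, pr q * |f (Jq q) - g (Jq q)| := by
      rw [hlawR fun x => ‖(f x : ℂ) - fourierApprox f a P L x‖]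
      simp only [hfa, ← Complex.ofReal_sub, Complex.norm_real, Real.norm_eq_abs]
    have hdiff : |E - ∑ q, pr q * f (Jq q)| ≤ ∑ q, pr q * |f (Jq q) - g (Jq q)| := by
      rw [← hEg, ← Finset.sum_sub_distrib]
      refine (Finset.abs_sum_le_sum_abs _ _).trans (Finset.sum_le_sum fun q _ => ?_)
      rw [← mul_sub, abs_mul, abs_of_nonneg (hpr0 q), abs_sub_comm]
    have hMl : ∀ l k, (phaseEstimator eQ eR t p ph f a P L K).evalMatrix prep.matrix
        integral.matrix l k = embedMatrix Function.Embedding.inl (A l k) := fun l k =>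
      phaseEstimator_evalMatrix eQ eR t p ph f a P L K _ _ l k
    have hci' : ∀ i : Fin (L * 2), 2 * targetWeight t (A ((finProdFinEquiv.symm i).1 + 1)
        (finTwoEquiv (finProdFinEquiv.symm i).2) *ᵥ Pi.single (fun _ => false) 1) - 1 = ci i := by
      intro i
      rw [htw]
      ring
    set ev := (phaseEstimator eQ eR t p ph f a P L K).evalMatrix prep.matrix integral.matrix
      with hev
    set D : Fin (L * 2) → Matrix (S ⊕ Fin (K + 1) → Bool) (S ⊕ Fin (K + 1) → Bool) ℂ := fun i =>
      seqMatrix ((phaseRun K t ((finProdFinEquiv.symm i).1 + 1)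
        (finTwoEquiv (finProdFinEquiv.symm i).2)).map (runInstrMatrix ev)) with hD
    have key := one_sub_le_sum_prod (B := S ⊕ Fin (K + 1) → Bool)
      (fun i => outcomeProb (D i)) (fun i b => sq_nonneg _)
      (fun i => sum_outcomeProb_phaseRun t (hAu _ _) (hMl _ _))
      (fun i b => phaseEstimate (fun j => b (Sum.inr j)) - ci i)
      (fun i => by
        rw [← hci']
        exact sum_phaseRun_sub t (hAu _ _) (hMl _ _) hK)
      (v := 2 * Real.tan (Real.pi / 2 ^ (K + 1)) ^ 2)
      (fun i => by
        rw [← hci']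
        exact sum_phaseRun_sub_sq t (hAu _ _) (hMl _ _) hK)
      cf hε (δ := δ) (by rw [sum_runs L fun l k => trigCoef f a P l k ^ 2]; exact hvar)
      (fun o => (phaseEstimator eQ eR t p ph f a P L K).estimate o ∈
        {y : ℝ | ‖(y : ℂ) - ∫ ω, fourierApprox f a P L (J ω) ∂μ‖ ≤ ε ∧
      |y - ∫ ω, f (J ω) ∂μ| ≤ ε + ∫ ω, ‖(f (J ω) : ℂ) - fourierApprox f a P L (J ω)‖ ∂μ})
      (fun o ho => by
        set y := (phaseEstimator eQ eR t p ph f a P L K).estimate o with hy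
        have hyE : y - E = ∑ i, cf i * (phaseEstimate (fun j => o i (Sum.inr j)) - ci i) := by
          rw [hE]
          simp only [mul_sub, Finset.sum_sub_distrib]
          change (_ + _) - _ = _
          ring
        rw [← hyE] at ho
        refine ⟨?_, ?_⟩
        · rw [hint1, ← Complex.ofReal_sub, Complex.norm_real]
          exact ho
        · rw [hint2, hlawR]
          have : y - ∑ q, pr q * f (Jq q) = (y - E) + (E - ∑ q, pr q * f (Jq q)) := by ring
          rw [this]
          exact (abs_add_le _ _).trans (add_le_add ho hdiff))
    refine key.trans_eq ?_
    refine Finset.sum_congr rfl fun o _ => ?_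
    have hprod := Finset.prod_congr (rfl : Finset.univ = (Finset.univ : Finset (Fin (L * 2))))
      fun i _ => congrArg (fun M => outcomeProb M (o i))
        (phaseEstimator_runMatrix eQ eR t p ph f a P L K prep.matrix integral.matrix i).symm
    by_cases ho : (phaseEstimator eQ eR t p ph f a P L K).estimate o ∈
      {y : ℝ | ‖(y : ℂ) - ∫ ω, fourierApprox f a P L (J ω) ∂μ‖ ≤ ε ∧
        |y - ∫ ω, f (J ω) ∂μ| ≤ ε + ∫ ω, ‖(f (J ω) : ℂ) - fourierApprox f a P L (J ω)‖ ∂μ}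
    · exact (if_pos ho).trans (hprod.trans (if_pos ho).symm)
    · exact (if_neg ho).trans (if_neg ho).symm

/-- N = 2^(K+1) is chosen in (r, 2r] with r = 9x/√δ. Since N ≥ 4 gives cos²(π/N) ≥ 1/2, one has
tan²(π/N) ≤ 2π²/N², and π² ≤ 10 bounds the left side by 80x²/N² ≤ (80/81)δ. It is used with x =
KP/ε. -/
theorem exists_register_size {x δ : ℝ} (hx : 1 ≤ x) (hδ0 : 0 < δ) (hδ1 : δ < 1) :
    ∃ K : ℕ, 1 ≤ K ∧ (2 : ℝ) ^ (K + 1) ≤ 18 * x / √δ ∧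
      4 * x ^ 2 * Real.tan (Real.pi / 2 ^ (K + 1)) ^ 2 ≤ δ := by
  have hs0 : 0 < √δ := Real.sqrt_pos.2 hδ0
  have hs1 : √δ ≤ 1 := Real.sqrt_le_one.2 hδ1.le
  have hss : √δ ^ 2 = δ := Real.sq_sqrt hδ0.le
  set r := 9 * x / √δ with hr
  have hr9 : 9 ≤ r := by
    rw [hr, le_div_iff₀ hs0]
    nlinarith
  obtain ⟨K, hK1, hK2⟩ := exists_nat_pow_near (by linarith : 1 ≤ r) (by norm_num : (1 : ℝ) < 2)
  have hK : 1 ≤ K := by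
    rcases Nat.eq_zero_or_pos K with rfl | h
    · norm_num at hK2
      linarith
    · exact h
  refine ⟨K, hK, ?_, ?_⟩
  · rw [pow_succ]
    have : 18 * x / √δ = r * 2 := by rw [hr]; ring
    linarith
  · set N : ℝ := 2 ^ (K + 1) with hN
    have hN0 : 0 < N := by positivity
    have hN4 : 4 ≤ N := by
      calc (4 : ℝ) = 2 ^ 2 := by norm_num
        _ ≤ N := pow_le_pow_right₀ (by norm_num) (by omega)
    have hpi := Real.pi_pos
    have hy0 : 0 < Real.pi / N := by positivity
    have hy1 : Real.pi / N ≤ Real.pi / 4 := by gcongr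
    have hcos : √2 / 2 ≤ Real.cos (Real.pi / N) := by
      rw [← Real.cos_pi_div_four]
      exact Real.cos_le_cos_of_nonneg_of_le_pi hy0.le (by linarith) hy1
    have hcos2 : 1 / 2 ≤ Real.cos (Real.pi / N) ^ 2 := by
      have h2 : √2 ^ 2 = (2 : ℝ) := Real.sq_sqrt (by norm_num)
      have h0 : (0 : ℝ) ≤ √2 := Real.sqrt_nonneg 2
      nlinarith
    have hsin : Real.sin (Real.pi / N) ^ 2 ≤ (Real.pi / N) ^ 2 :=
      pow_le_pow_left₀ (Real.sin_nonneg_of_nonneg_of_le_pi hy0.le (by linarith))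
        (Real.sin_lt hy0).le 2
    have htan : Real.tan (Real.pi / N) ^ 2 ≤ 2 * (Real.pi / N) ^ 2 := by
      rw [Real.tan_eq_sin_div_cos, div_pow, div_le_iff₀ (by linarith)]
      nlinarith [sq_nonneg (Real.pi / N)]
    have hpi2 : Real.pi ^ 2 ≤ 10 := by nlinarith [Real.pi_lt_d2]
    have hNr : r ^ 2 ≤ N ^ 2 := pow_le_pow_left₀ (by linarith) hK2.le 2
    have hr2 : r ^ 2 * δ = 81 * x ^ 2 := by
      rw [hr, div_pow, hss, mul_pow]
      field_simp
      norm_num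
    calc 4 * x ^ 2 * Real.tan (Real.pi / N) ^ 2 ≤ 4 * x ^ 2 * (2 * (Real.pi / N) ^ 2) := by gcongr
      _ = 8 * x ^ 2 * Real.pi ^ 2 / N ^ 2 := by rw [div_pow]; ring
      _ ≤ δ := by
        rw [div_le_iff₀ (by positivity)]
        have h1 : δ * r ^ 2 ≤ δ * N ^ 2 := by gcongr
        nlinarith [sq_nonneg x]

/-- This isolates what does not depend on the arithmetic. The algorithm is fixed by `p` and `ph`
before the two circuits are given. In the constant, 36 = 2·18 comes from two runs per frequency and
the register size, and 3c + 11 from the depth of a run, with the additive constants absorbed by 1 ≤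
m. -/
theorem exists_estimator (eQ : Q ↪ S) (eR : Fin n × R ↪ S) (t : S)
    (hQR : ∀ a b, eQ a ≠ eR b) (htR : ∀ b, eR b ≠ t)
    (p : List (S × Finset S)) (hp : ∀ g ∈ p, ∀ a, g.1 ≠ eQ a) (hp2 : ∀ g ∈ p, g.2.card ≤ 2)
    (z : (Q → Bool) → S → Bool)
    (hz : ∀ q, runFlips p (Function.extend eQ q fun _ => false) = z q) (hzt : ∀ q, z q t = false)
    (ph : List (S × S × ℝ)) (hph : ∀ a ∈ ph, a.1 ≠ t ∧ a.2.1 ≠ t)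
    {c m : ℕ} (hm : 1 ≤ m) (hlen : p.length + ph.length + 3 ≤ c * m)
    {δ : ℝ} (hδ0 : 0 < δ) (hδ1 : δ < 1)
    (f : ℝ → ℝ) (a P K ε : ℝ) (L : ℕ)
    (hK : ∑ l ∈ (Finset.Icc (-(L : ℤ)) L).erase 0, ‖fourierCoef f a P l‖ ^ 2 ≤ (K * P) ^ 2)
    (hε : 0 < ε) (hεK : ε ≤ K * P) :
    ∃ alg : Estimator Q R n, (∀ l k, ∀ s ∈ alg.evalCircuit l k, s.AtMostTwoControls) ∧
      ∀ (prep : Circuit Q) (integral : Circuit R),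
        (∀ l k, alg.evalDepth prep.depth integral.depth l k ≤
          prep.depth + integral.depth + c * m) ∧
        (alg.time prep.depth integral.depth : ℝ) ≤
          36 * (3 * c + 11) / √δ * K * (L * P / ε) * (prep.depth + integral.depth + m) ∧
        ∀ Jq : (Q → Bool) → ℝ,
          (∀ q x, prep.matrix q (fun _ => false) ≠ 0 → (∀ a, x (eQ a) = q a) →
            (∀ j, integral.matrix (fun r => x (eR (j, r))) (fun r => z q (eR (j, r))) ≠ 0) →
              phaseSum ph x = Jq q) →
          ∀ (Ω : Type*) [MeasurableSpace Ω] (μ : Measure Ω) (J : Ω → ℝ),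
            (∀ φ : ℝ → ℂ, ∫ ω, φ (J ω) ∂μ =
              ∑ q, (outcomeProb prep.matrix q : ℂ) * φ (Jq q)) →
            alg.Estimates prep integral μ J f a P L ε δ := by
  have hx : 1 ≤ K * P / ε := by rwa [one_le_div hε]
  obtain ⟨r, hr1, hr2, hr3⟩ := exists_register_size hx hδ0 hδ1
  refine ⟨phaseEstimator eQ eR t p ph f a P L r, ?_, fun prep integral => ⟨?_, ?_, ?_⟩⟩
  · intro l k s hs
    obtain ⟨s', hs', rfl⟩ := List.mem_map.1 hs
    exact EvalInstr.map_atMostTwoControls _ (evalInstrs_atMostTwoControls eQ eR t hp2 _ _ _ s' hs')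
  · intro l k
    rw [phaseEstimator_evalDepth]
    omega
  · have h1 := phaseEstimator_time_le eQ eR t p ph f a P L r prep.depth integral.depth
    have hs0 : 0 < √δ := Real.sqrt_pos.2 hδ0
    have h2 : 3 * (prep.depth + integral.depth + p.length + ph.length + 3) + 11 ≤
        (3 * c + 11) * (prep.depth + integral.depth + m) := by
      have hc : 1 ≤ c := by
        rcases Nat.eq_zero_or_pos c with rfl | h
        · omega
        · exact h
      nlinarith
    have h3 : ((2 * L * (2 ^ (r + 1) * (3 * (prep.depth + integral.depth + p.length +
        ph.length + 3) + 11)) : ℕ) : ℝ) ≤ 2 * L * (18 * (K * P / ε) / √δ *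
        ((3 * c + 11) * (prep.depth + integral.depth + m))) := by
      have h2' : ((3 * (prep.depth + integral.depth + p.length + ph.length + 3) + 11 : ℕ) : ℝ) ≤
          (3 * c + 11) * (prep.depth + integral.depth + m) := by exact_mod_cast h2
      rw [Nat.cast_mul, Nat.cast_mul (2 ^ (r + 1)), Nat.cast_mul, Nat.cast_pow]
      have h0 : 0 ≤ 18 * (K * P / ε) / √δ := by positivity
      push_cast at h2' ⊢
      gcongr
    calc _ ≤ _ := Nat.cast_le.2 h1
      _ ≤ _ := h3
      _ = _ := by ring
  · intro Jq hJ Ω _ μ J hlaw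
    refine phaseEstimator_estimates eQ eR t hQR htR p hp z hz hzt ph hph prep integral Jq hJ μ J
      hlaw f a P L r hε hr1 ?_
    rw [sum_trigCoef_sq]
    calc _ ≤ 2 * (K * P) ^ 2 * (2 * Real.tan (Real.pi / 2 ^ (r + 1)) ^ 2) := by gcongr
      _ = (4 * (K * P / ε) ^ 2 * Real.tan (Real.pi / 2 ^ (r + 1)) ^ 2) * ε ^ 2 := by
        field_simp
        ring
      _ ≤ δ * ε ^ 2 := by gcongr

end

/-! ### Numbers in binary and two's complement registers -/

theorem unsignedVal_eq_ofBits {l : ℕ} (v : Fin l → Bool) : unsignedVal v = Nat.ofBits v := by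
  induction l with
  | zero => rfl
  | succ l ih =>
    rw [Nat.ofBits_succ, ← ih, unsignedVal, Fin.sum_univ_succ, unsignedVal, Finset.mul_sum]
    have : ∀ i : Fin l, (if v i.succ then 2 ^ (i.succ : ℕ) else 0) =
        2 * (if (v ∘ Fin.succ) i then 2 ^ (i : ℕ) else 0) := by
      intro i
      simp only [Function.comp, Fin.val_succ, pow_succ']
      split_ifs <;> simp
    simp only [this]
    cases v 0 <;> simp [add_comm]

theorem unsignedVal_lt {l : ℕ} (v : Fin l → Bool) : unsignedVal v < 2 ^ l := by
  rw [unsignedVal_eq_ofBits]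
  exact Nat.ofBits_lt_two_pow v

theorem testBit_unsignedVal {l : ℕ} (v : Fin l → Bool) (i : Fin l) :
    (unsignedVal v).testBit i = v i := by
  rw [unsignedVal_eq_ofBits, Nat.testBit_ofBits_lt v i i.2]

theorem unsignedVal_testBit {l : ℕ} {m : ℕ} (hm : m < 2 ^ l) :
    unsignedVal (fun i : Fin l => m.testBit i) = m := by
  rw [unsignedVal_eq_ofBits, Nat.ofBits_testBit, Nat.mod_eq_of_lt hm]

theorem unsignedVal_injective {l : ℕ} : Function.Injective (unsignedVal (l := l)) := by
  intro v w h
  funext i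
  rw [← testBit_unsignedVal v i, h, testBit_unsignedVal]

theorem signedVal_injective {l : ℕ} : Function.Injective (signedVal (l := l)) := by
  intro v w h
  apply unsignedVal_injective
  have hv := unsignedVal_lt v
  have hw := unsignedVal_lt w
  rw [signedVal, signedVal] at h
  have h2 : ((2 ^ l : ℕ) : ℤ) = 2 ^ l := by push_cast; rfl
  rw [← h2] at h
  split_ifs at h <;> omega

/-- The weight of bit `i` of a two's complement register of `l` qubits. -/
def bitWeight (l : ℕ) (i : Fin l) : ℤ := if (i : ℕ) + 1 = l then -2 ^ (i : ℕ) else 2 ^ (i : ℕ)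

/-- Two's complement is linear in the bits, the top bit having negative weight; this makes products
bilinear in bits and hence sums of controlled phases. -/
theorem signedVal_eq_sum {l : ℕ} (hl : 1 ≤ l) (v : Fin l → Bool) :
    signedVal v = ∑ i, if v i then bitWeight l i else 0 := by
  obtain ⟨m, rfl⟩ : ∃ m, l = m + 1 := ⟨l - 1, by omega⟩
  have hlow := unsignedVal_lt fun i : Fin m => v i.castSucc
  have h1 : unsignedVal v = unsignedVal (fun i : Fin m => v i.castSucc) +
      if v (Fin.last m) then 2 ^ m else 0 := by
    rw [unsignedVal, Fin.sum_univ_castSucc]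
    rfl
  have h2 : ∑ i, (if v i then bitWeight (m + 1) i else 0) =
      (unsignedVal (fun i : Fin m => v i.castSucc) : ℤ) +
        if v (Fin.last m) then -2 ^ m else 0 := by
    rw [Fin.sum_univ_castSucc, unsignedVal]
    push_cast
    congr 1
    · refine Finset.sum_congr rfl fun i _ => ?_
      have : (i.castSucc : ℕ) + 1 ≠ m + 1 := by
        have := i.2
        simp only [Fin.val_castSucc]
        omega
      rw [bitWeight, if_neg this, Fin.val_castSucc]
    · simp [bitWeight]
  rw [h2, signedVal, h1]
  have h3 : ((2 ^ m : ℕ) : ℤ) = 2 ^ m := by push_cast; rfl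
  rw [pow_succ (2 : ℤ), pow_succ (2 : ℕ), ← h3]
  split_ifs <;> push_cast <;> omega

/-! ### The weighted integral as a sum over pieces -/

theorem sum_mul_sub_eq (w G : ℕ → ℝ) (h0 : w 0 = 0) (m : ℕ) :
    ∑ k ∈ Finset.range m, w (k + 1) * (G k - G (k + 1)) =
      ∑ k ∈ Finset.range m, (w (k + 1) - w k) * G k - w m * G m := by
  induction m with
  | zero => simp [h0]
  | succ m ih =>
    rw [Finset.sum_range_succ, Finset.sum_range_succ, ih]
    ring

section
variable {Ω : Type*} {X : ℝ → Ω → ℝ} {T n : ℕ} {Z : Fin n → Ω → ℝ} {S : Fin n → Ω → ℕ}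

theorem IsPieces.le (h : IsPieces X T Z S) (ω : Ω) (j : Fin n) : S j ω ≤ T := by
  have key : ∀ d (j : Fin n), (j : ℕ) + d + 1 = n → S j ω ≤ T := by
    intro d
    induction d with
    | zero => intro j hj; exact (h.last ω j (by omega)).le
    | succ d ih =>
      intro j hj
      have h1 := h.start_lt ω ⟨j + 1, by omega⟩
      have h2 : startTime S ⟨j + 1, by omega⟩ ω = S j ω := by simp [startTime]
      have h3 := ih ⟨j + 1, by omega⟩ (by simp only; omega)
      omega
  exact key (n - 1 - j) j (by have := j.2; omega)

theorem IsPieces.startTime_le (h : IsPieces X T Z S) (ω : Ω) (j : Fin n) :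
    startTime S j ω ≤ T :=
  (h.start_lt ω j).le.trans (h.le ω j)

/-- On each piece the integral is the value times a difference of tails of ∫ g; summation by parts
moves the difference to the values. Both boundary terms vanish: the value before the first piece is
0 by convention, and the tail from T is empty. -/
theorem IsPieces.weightedIntegral_eq (h : IsPieces X T Z S) (hn : 1 ≤ n) {g : ℝ → ℝ}
    (hg : IntervalIntegrable g volume 0 T) (ω : Ω) :
    weightedIntegral g X T ω =
      ∑ j, (Z j ω - prevValue Z j ω) * ∫ t in (startTime S j ω : ℝ)..T, g t := by
  -- Ending times and values are shifted by one and extended to all of ℕ, with 0 at index 0, so that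
  -- sums over ranges apply; the entries past `n` are never used.
  set u : ℕ → ℕ := fun k => if hk : k - 1 < n then (if k = 0 then 0 else S ⟨k - 1, hk⟩ ω) else T
    with hu
  set w : ℕ → ℝ := fun k => if hk : k - 1 < n then (if k = 0 then 0 else Z ⟨k - 1, hk⟩ ω) else 0
    with hw
  have hu0 : u 0 = 0 := by simp only [hu, if_true, dite_eq_ite, ite_eq_left_iff]; omega
  have hw0 : w 0 = 0 := by simp only [hw, if_true, dite_eq_ite, ite_eq_left_iff]; omega
  have hus : ∀ j : Fin n, u (j + 1) = S j ω := by
    intro j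
    simp only [hu]
    rw [dif_pos (by simp), if_neg (by omega)]
    simp
  have hws : ∀ j : Fin n, w (j + 1) = Z j ω := by
    intro j
    simp only [hw]
    rw [dif_pos (by simp), if_neg (by omega)]
    simp
  have hut : ∀ j : Fin n, u j = startTime S j ω := by
    intro j
    have := j.2
    simp only [hu]
    rw [dif_pos (by omega), startTime]
  have hwt : ∀ j : Fin n, w j = prevValue Z j ω := by
    intro j
    have := j.2
    simp only [hw]
    rw [dif_pos (by omega), prevValue]
  have hun : u n = T := by
    have := hus ⟨n - 1, by omega⟩
    simp only [Nat.sub_add_cancel hn] at this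
    rw [this]
    exact h.last ω _ (by simp only; omega)
  have hle : ∀ k ≤ n, u k ≤ T := by
    intro k hk
    rcases Nat.lt_or_ge k n with hk | hk'
    · rw [hut ⟨k, hk⟩]
      exact h.startTime_le ω _
    · rw [le_antisymm hk hk', hun]
  have hgi : ∀ k ≤ n, ∀ m ≤ n, IntervalIntegrable g volume (u k) (u m) := by
    intro k hk m hm
    refine hg.mono_set ?_
    rw [Set.uIcc_of_le (Nat.cast_nonneg T)]
    refine Set.uIcc_subset_Icc ⟨Nat.cast_nonneg _, Nat.cast_le.2 (hle k hk)⟩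
      ⟨Nat.cast_nonneg _, Nat.cast_le.2 (hle m hm)⟩
  -- Nothing is assumed about the measurability of paths: integrability of g·X comes from its
  -- agreement with a multiple of g on the open pieces.
  have hEq : ∀ k < n, Set.EqOn (fun t => w (k + 1) * g t) (fun t => g t * X t ω)
      (Set.uIoo (u k : ℝ) (u (k + 1))) := by
    intro k hk t ht
    have h1 := hut ⟨k, hk⟩
    have h2 := hus ⟨k, hk⟩
    have h3 := hws ⟨k, hk⟩
    have h4 := h.start_lt ω ⟨k, hk⟩
    simp only at h1 h2 h3
    rw [h1, h2, Set.uIoo_of_le (Nat.cast_le.2 h4.le)] at ht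
    simp only
    rw [h3, h.value ω ⟨k, hk⟩ t ht.1.le ht.2, mul_comm]
  have hsplit := intervalIntegral.sum_integral_adjacent_intervals (μ := volume)
    (f := fun t => g t * X t ω) (a := fun k => (u k : ℝ)) (n := n) fun k hk =>
      ((hgi k hk.le (k + 1) hk).const_mul (w (k + 1))).congr_uIoo (hEq k hk)
  rw [weightedIntegral]
  simp only [hu0, hun, Nat.cast_zero] at hsplit
  rw [← hsplit]
  have hpiece : ∀ k ∈ Finset.range n, ∫ t in (u k : ℝ)..(u (k + 1) : ℕ), g t * X t ω =
      w (k + 1) * ((∫ t in (u k : ℝ)..T, g t) - ∫ t in (u (k + 1) : ℝ)..T, g t) := by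
    intro k hk
    have hk := Finset.mem_range.1 hk
    rw [← intervalIntegral.integral_congr_uIoo (hEq k hk), intervalIntegral.integral_const_mul]
    congr 1
    rw [← hun, eq_sub_iff_add_eq]
    exact intervalIntegral.integral_add_adjacent_intervals (hgi _ hk.le _ hk) (hgi _ hk _ le_rfl)
  rw [Finset.sum_congr rfl hpiece, sum_mul_sub_eq w (fun k => ∫ t in (u k : ℝ)..T, g t) hw0,
    hun, intervalIntegral.integral_same, mul_zero, sub_zero,
    ← Fin.sum_univ_eq_sum_range fun k => (w (k + 1) - w k) * ∫ t in (u k : ℝ)..T, g t]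
  refine Finset.sum_congr rfl fun j _ => ?_
  rw [hws, hwt, hut]

theorem startTime_eq_sum {τ : Fin n → Ω → ℕ} (h : ∀ j ω, S j ω = startTime S j ω + τ j ω) (ω : Ω)
    (j : Fin n) : startTime S j ω = ∑ i ∈ Finset.Iio j, τ i ω := by
  obtain ⟨j, hj⟩ := j
  induction j with
  | zero =>
    rw [startTime, if_pos rfl]
    refine (Finset.sum_eq_zero fun i hi => ?_).symm
    exact absurd (Fin.lt_def.1 (Finset.mem_Iio.1 hi)) (Nat.not_lt_zero _)
  | succ j ih =>
    have h1 : startTime S ⟨j + 1, hj⟩ ω = S ⟨j, by omega⟩ ω := by simp [startTime]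
    have h2 : Finset.Iio (⟨j + 1, hj⟩ : Fin n) =
        insert ⟨j, by omega⟩ (Finset.Iio (⟨j, by omega⟩ : Fin n)) := by
      ext i
      simp only [Finset.mem_Iio, Finset.mem_insert, Fin.lt_def, Fin.ext_iff]
      omega
    rw [h1, h, ih, h2, Finset.sum_insert (by simp), add_comm]

/-- The remaining time T − T_{j−1} is a suffix sum of holding times. This is the argument at which F
is evaluated, so an adder can produce it without knowing T. -/
theorem startTime_add_sum {τ : Fin n → Ω → ℕ} (hP : IsPieces X T Z S)
    (h : ∀ j ω, S j ω = startTime S j ω + τ j ω) (ω : Ω) (j : Fin n) :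
    startTime S j ω + ∑ i ∈ Finset.Ici j, τ i ω = T := by
  have hn : 0 < n := j.pos
  have h1 := hP.last ω ⟨n - 1, by omega⟩ (by simp only; omega)
  rw [h, startTime_eq_sum h] at h1
  rw [startTime_eq_sum h, ← h1, ← Finset.sum_union
    (by
      rw [Finset.disjoint_left]
      intro i hi hi'
      rw [Finset.mem_Iio] at hi
      rw [Finset.mem_Ici] at hi'
      exact absurd hi (not_lt.2 hi')), add_comm (∑ i ∈ _, τ i ω) (τ _ ω),
    ← Finset.sum_insert (f := fun i => τ i ω) (by simp)]
  refine Finset.sum_congr ?_ fun _ _ => rfl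
  ext i
  have := i.2
  simp only [Finset.mem_union, Finset.mem_Iio, Finset.mem_Ici, Finset.mem_insert, Fin.lt_def,
    Fin.le_def, Fin.ext_iff]
  omega

end

/-! ### The law of the registers and the law of the process -/

section
variable {Ω : Type*} [MeasurableSpace Ω] {Q : Type} [Fintype Q] [DecidableEq Q]
  {n lv lt : ℕ} {reg : (Fin n × Fin lv) ⊕ (Fin n × Fin lt) ↪ Q} {r : ℝ} {prep : Circuit Q}
  {μ : Measure Ω} {V : Fin n → Ω → ℝ} {S : Fin n → Ω → ℕ}

/-- The outcome `ω` of the process is the one described by the registers of the basis state `q`. -/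
def Realizes (reg : (Fin n × Fin lv) ⊕ (Fin n × Fin lt) ↪ Q) (r : ℝ) (V : Fin n → Ω → ℝ)
    (S : Fin n → Ω → ℕ) (q : Q → Bool) (ω : Ω) : Prop :=
  ∀ j, V j ω = r * signedVal (fun i => q (reg (Sum.inl (j, i)))) ∧
    S j ω = unsignedVal fun i => q (reg (Sum.inr (j, i)))

/-- Nonzero amplitude gives the register contents positive probability, so some outcome has them. In
this way properties of all paths, such as times being at most T, pass to every basis state in the
support. -/
theorem PreparesProcess.exists_realizes (h : PreparesProcess reg r prep μ V S) {q : Q → Bool}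
    (hq : prep.matrix q (fun _ => false) ≠ 0) : ∃ ω, Realizes reg r V S q ω := by
  by_contra hne
  have h1 := h (fun j i => q (reg (Sum.inl (j, i)))) fun j i => q (reg (Sum.inr (j, i)))
  have h2 : {ω | ∀ j, V j ω = r * signedVal (fun i => q (reg (Sum.inl (j, i)))) ∧
      S j ω = unsignedVal fun i => q (reg (Sum.inr (j, i)))} = ∅ :=
    Set.eq_empty_iff_forall_notMem.2 fun ω hω => hne ⟨ω, hω⟩
  rw [h2, measureReal_empty, Finset.sum_eq_zero_iff_of_nonneg
    (fun b _ => by split_ifs; exacts [sq_nonneg _, le_rfl])] at h1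
  have h3 := h1 q (Finset.mem_univ q)
  rw [if_pos ⟨fun _ _ => rfl, fun _ _ => rfl⟩, outcomeProb] at h3
  exact hq (by simpa using h3)

/-- `J` need not be assumed measurable: it is constant on each of the finitely many disjoint
measurable events given by register contents, and these events have total probability 1 because the
prepared state has norm 1. -/
theorem PreparesProcess.integral_comp [IsProbabilityMeasure μ]
    (h : PreparesProcess reg r prep μ V S) (hr : 0 < r) (hV : ∀ j, Measurable (V j))
    (hS : ∀ j, Measurable (S j)) (J : Ω → ℝ) (Jq : (Q → Bool) → ℝ)
    (hJ : ∀ q ω, Realizes reg r V S q ω → J ω = Jq q) (φ : ℝ → ℂ) :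
    ∫ ω, φ (J ω) ∂μ = ∑ q, (outcomeProb prep.matrix q : ℂ) * φ (Jq q) := by
  classical
  set A := (Fin n → Fin lv → Bool) × (Fin n → Fin lt → Bool)
  set E : A → Set Ω := fun a => {ω | ∀ j, V j ω = r * signedVal (a.1 j) ∧
    S j ω = unsignedVal (a.2 j)} with hE
  set rd : (Q → Bool) → A := fun q =>
    (fun j i => q (reg (Sum.inl (j, i))), fun j i => q (reg (Sum.inr (j, i)))) with hrd
  have hEm : ∀ a, MeasurableSet (E a) := by
    intro a
    simp only [hE, Set.ofPred_forall]
    refine MeasurableSet.iInter fun j => ?_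
    exact (measurableSet_eq_fun (hV j) measurable_const).inter
      (measurableSet_eq_fun (hS j) measurable_const)
  have hEd : Pairwise (Function.onFun Disjoint E) := by
    intro a b hab
    rw [Function.onFun, Set.disjoint_left]
    intro ω ha hb
    refine hab (Prod.ext (funext fun j => ?_) (funext fun j => ?_))
    · apply signedVal_injective
      have := (ha j).1.symm.trans (hb j).1
      exact_mod_cast mul_left_cancel₀ hr.ne' this
    · exact unsignedVal_injective ((ha j).2.symm.trans (hb j).2)
  have hsum : ∀ a, ∑ q, (if rd q = a then outcomeProb prep.matrix q else 0) = μ.real (E a) := by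
    intro a
    rw [hE, ← h a.1 a.2]
    refine Finset.sum_congr rfl fun q _ => if_congr ?_ rfl rfl
    refine Prod.ext_iff.trans ?_
    simp only [hrd, funext_iff]
  have htot : μ.real (⋃ a, E a) = 1 := by
    rw [measureReal_iUnion_fintype hEd hEm, ← sum_outcomeProb prep.matrix_mem_unitary]
    refine (Finset.sum_congr rfl fun a _ => (hsum a).symm).trans ?_
    rw [Finset.sum_comm]
    refine Finset.sum_congr rfl fun q _ => ?_
    rw [Finset.sum_ite_eq, if_pos (Finset.mem_univ _)]
  have hae : ∀ᵐ ω ∂μ, ω ∈ ⋃ a, E a := by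
    refine (mem_ae_iff_prob_eq_one (MeasurableSet.iUnion hEm)).2 ?_
    rwa [measureReal_def, ENNReal.toReal_eq_one_iff] at htot
  have hconst : ∀ a, ∀ ω₀ ∈ E a, Set.EqOn (fun ω => φ (J ω)) (fun _ => φ (J ω₀)) (E a) := by
    intro a ω₀ h₀ ω hω
    set q : Q → Bool := Function.extend reg
      (Sum.elim (fun x => a.1 x.1 x.2) fun x => a.2 x.1 x.2) fun _ => false with hq
    have hqa : rd q = a := by
      refine Prod.ext (funext fun j => funext fun i => ?_) (funext fun j => funext fun i => ?_)
      · simp only [hrd, hq, reg.injective.extend_apply, Sum.elim_inl]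
      · simp only [hrd, hq, reg.injective.extend_apply, Sum.elim_inr]
    have h1 : ∀ ω' ∈ E a, J ω' = Jq q := by
      intro ω' h'
      rw [← hqa] at h'
      exact hJ q ω' h'
    simp only [h1 ω hω, h1 ω₀ h₀]
  have hpiece : ∀ a, ∫ ω in E a, φ (J ω) ∂μ =
      ∑ q, if rd q = a then (outcomeProb prep.matrix q : ℂ) * φ (Jq q) else 0 := by
    intro a
    -- Contents that no outcome realizes also have zero amplitude, so both sides vanish there.
    rcases (E a).eq_empty_or_nonempty with he | ⟨ω₀, h₀⟩
    · rw [he, setIntegral_empty]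
      refine (Finset.sum_eq_zero fun q _ => ?_).symm
      split_ifs with hqa
      · have hq0 : prep.matrix q (fun _ => false) = 0 := by
          by_contra hne
          obtain ⟨ω, hω⟩ := h.exists_realizes hne
          have : ω ∈ E (rd q) := hω
          rw [hqa, he] at this
          exact this
        simp [outcomeProb, hq0]
      · rfl
    · rw [setIntegral_congr_fun (hEm a) (hconst a ω₀ h₀), setIntegral_const, ← hsum,
        Complex.real_smul, Complex.ofReal_sum, Finset.sum_mul]
      refine Finset.sum_congr rfl fun q _ => ?_
      split_ifs with hqa
      · rw [hJ q ω₀ (show ω₀ ∈ E (rd q) by rw [hqa]; exact h₀)]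
      · simp
  rw [← Measure.restrict_eq_self_of_ae_mem hae, integral_iUnion_fintype hEm hEd]
  · refine (Finset.sum_congr rfl fun a _ => hpiece a).trans ?_
    rw [Finset.sum_comm]
    refine Finset.sum_congr rfl fun q _ => ?_
    rw [Finset.sum_ite_eq, if_pos (Finset.mem_univ _)]
  · intro a
    rcases (E a).eq_empty_or_nonempty with he | ⟨ω₀, h₀⟩
    · rw [he]
      exact integrableOn_empty
    · exact (integrableOn_congr_fun (hconst a ω₀ h₀) (hEm a)).2 (integrableOn_const)

end

/-! ### Bit polynomials of an adder and phases of a product -/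

section
variable {W : Type} [Fintype W] [DecidableEq W]

/-- The monomials of the sum bit of three bits, the last two of which may be missing. -/
def sumMonomials (a : W) (b c : Option W) : List (Finset W) :=
  {a} :: (b.toList.map singleton ++ c.toList.map singleton)

/-- The monomials of the carry (majority) of three bits, the last two of which may be missing. -/
def carryMonomials (a : W) (b c : Option W) : List (Finset W) :=
  b.toList.map (fun w => {a, w}) ++ c.toList.map (fun w => {a, w}) ++
    b.toList.flatMap fun v => c.toList.map fun w => {v, w}

theorem xorOfAnds_sumMonomials (a : W) (b c : Option W) (z : W → Bool) :
    xorOfAnds (sumMonomials a b c) z = (z a ^^ (b.elim false z ^^ c.elim false z)) := by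
  cases b <;> cases c <;> simp [sumMonomials, xorOfAnds]

/-- Majority is ab + ac + bc modulo 2, a missing bit counting as 0. -/
theorem xorOfAnds_carryMonomials (a : W) (b c : Option W) (z : W → Bool) :
    xorOfAnds (carryMonomials a b c) z =
      Bool.atLeastTwo (z a) (b.elim false z) (c.elim false z) := by
  rcases b with - | b <;> rcases c with - | c <;>
    simp [carryMonomials, xorOfAnds, Bool.atLeastTwo]
  cases z a <;> cases z b <;> cases z c <;> rfl

theorem mem_sumMonomials {a w : W} {b c : Option W} {s : Finset W} (hs : s ∈ sumMonomials a b c)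
    (hw : w ∈ s) : w = a ∨ b = some w ∨ c = some w := by
  rcases b with - | b <;> rcases c with - | c <;> simp [sumMonomials] at hs <;> aesop

theorem mem_carryMonomials {a w : W} {b c : Option W} {s : Finset W}
    (hs : s ∈ carryMonomials a b c) (hw : w ∈ s) : w = a ∨ b = some w ∨ c = some w := by
  rcases b with - | b <;> rcases c with - | c <;> simp [carryMonomials] at hs <;> aesop

theorem length_sumMonomials_le (a : W) (b c : Option W) : (sumMonomials a b c).length ≤ 3 := by
  cases b <;> cases c <;> simp [sumMonomials]

theorem length_carryMonomials_le (a : W) (b c : Option W) :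
    (carryMonomials a b c).length ≤ 3 := by
  cases b <;> cases c <;> simp [carryMonomials]

theorem card_le_of_mem_sumMonomials {a : W} {b c : Option W} {s : Finset W}
    (hs : s ∈ sumMonomials a b c) : s.card ≤ 2 := by
  rcases b with - | b <;> rcases c with - | c <;> simp [sumMonomials] at hs <;> aesop

theorem card_le_of_mem_carryMonomials {a : W} {b c : Option W} {s : Finset W}
    (hs : s ∈ carryMonomials a b c) : s.card ≤ 2 := by
  have h2 := @Finset.card_le_two W _
  rcases b with - | b <;> rcases c with - | c <;> simp [carryMonomials] at hs <;> aesop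

theorem length_programFlips_le (p : List (W × List (Finset W))) {c : ℕ}
    (h : ∀ b ∈ p, b.2.length ≤ c) : (programFlips p).length ≤ c * p.length := by
  induction p with
  | nil => simp [programFlips]
  | cons b p ih =>
    have h1 := ih fun b hb => h b (List.mem_cons_of_mem _ hb)
    have h2 := h b List.mem_cons_self
    simp only [programFlips, List.flatMap_cons, List.length_append, List.length_map,
      List.length_cons] at h1 ⊢
    linarith

theorem mem_programFlips {p : List (W × List (Finset W))} {g : W × Finset W} :
    g ∈ programFlips p ↔ ∃ b ∈ p, g.1 = b.1 ∧ g.2 ∈ b.2 := by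
  simp only [programFlips, List.mem_flatMap, List.mem_map]
  constructor
  · rintro ⟨b, hb, c, hc, rfl⟩
    exact ⟨b, hb, rfl, hc⟩
  · rintro ⟨b, hb, h1, h2⟩
    exact ⟨b, hb, g.2, h2, by rw [← h1]⟩

/-- The phases of the product of two registers in two's complement: bit `a` of the first register
of `x` is `v x a`, bit `b` of the second is `w x b`; the product has the coefficient `r x`. -/
noncomputable def productPhases {I : Type} [Fintype I] (r : I → ℝ) (l m : ℕ) (v : I → Fin l → W)
    (w : I → Fin m → W) : List (W × W × ℝ) :=
  (Finset.univ : Finset (I × Fin l × Fin m)).toList.map fun x =>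
    (v x.1 x.2.1, w x.1 x.2.2, r x.1 * bitWeight l x.2.1 * bitWeight m x.2.2)

theorem length_productPhases {I : Type} [Fintype I] (r : I → ℝ) (l m : ℕ) (v : I → Fin l → W)
    (w : I → Fin m → W) : (productPhases r l m v w).length = Fintype.card I * (l * m) := by
  simp [productPhases]

theorem mem_productPhases {I : Type} [Fintype I] {r : I → ℝ} {l m : ℕ} {v : I → Fin l → W}
    {w : I → Fin m → W} {x : W × W × ℝ} (hx : x ∈ productPhases r l m v w) :
    ∃ i a b, x.1 = v i a ∧ x.2.1 = w i b := by
  obtain ⟨y, -, rfl⟩ := List.mem_map.1 hx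
  exact ⟨_, _, _, rfl, rfl⟩

/-- The product of two linear forms in the bits expands over pairs of bits, with one controlled
phase for each pair and no product register. -/
theorem phaseSum_productPhases {I : Type} [Fintype I] (r : I → ℝ) {l m : ℕ} (hl : 1 ≤ l)
    (hm : 1 ≤ m) (v : I → Fin l → W) (w : I → Fin m → W) (x : W → Bool) :
    phaseSum (productPhases r l m v w) x =
      ∑ i, r i * signedVal (fun a => x (v i a)) * signedVal (fun b => x (w i b)) := by
  rw [phaseSum, productPhases, List.map_map, Finset.sum_map_toList, Fintype.sum_prod_type]
  refine Finset.sum_congr rfl fun i _ => ?_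
  rw [signedVal_eq_sum hl, signedVal_eq_sum hm, Fintype.sum_prod_type]
  push_cast
  rw [mul_assoc, Finset.sum_mul_sum, Finset.mul_sum]
  refine Finset.sum_congr rfl fun a _ => ?_
  rw [Finset.mul_sum]
  refine Finset.sum_congr rfl fun b _ => ?_
  simp only [Function.comp]
  split_ifs <;> simp_all [mul_assoc]

theorem phaseSum_append (p q : List (W × W × ℝ)) (x : W → Bool) :
    phaseSum (p ++ q) x = phaseSum p x + phaseSum q x := by
  simp [phaseSum]

end

/-! ### Programs scheduled by a linear order -/

section
variable {W : Type} [Fintype W] [DecidableEq W] {I : Type} [Fintype I] [LinearOrder I]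

/-- The program that computes the polynomial `mon x` on the wire `tgt x`, in the order of `x`. -/
def orderedProgram (tgt : I → W) (mon : I → List (Finset W)) : List (W × List (Finset W)) :=
  (Finset.univ.sort (· ≤ ·)).map fun x => (tgt x, mon x)

theorem length_orderedProgram (tgt : I → W) (mon : I → List (Finset W)) :
    (orderedProgram tgt mon).length = Fintype.card I := by
  simp [orderedProgram]

theorem mem_orderedProgram {tgt : I → W} {mon : I → List (Finset W)} {b : W × List (Finset W)} :
    b ∈ orderedProgram tgt mon ↔ ∃ x, b = (tgt x, mon x) := by
  simp [orderedProgram, eq_comm]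

/-- The order on `I` encodes the dependencies: each step reads only smaller targets, so sorting
gives an admissible schedule. -/
theorem runFlips_orderedProgram {tgt : I → W} {mon : I → List (Finset W)}
    (hinj : Function.Injective tgt) (hlt : ∀ x, ∀ c ∈ mon x, ∀ y, tgt y ∈ c → y < x)
    {z z₀ : W → Bool} (hz : ∀ x, z (tgt x) = xorOfAnds (mon x) z)
    (h0 : ∀ x, z₀ (tgt x) = false) (h1 : ∀ w, (∀ x, tgt x ≠ w) → z₀ w = z w) :
    runFlips (programFlips (orderedProgram tgt mon)) z₀ = z := by
  have hmem : ∀ w, w ∈ (orderedProgram tgt mon).map Prod.fst ↔ ∃ x, tgt x = w := by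
    intro w
    simp [orderedProgram]
  have hz₀ : z₀ = fun w => if w ∈ (orderedProgram tgt mon).map Prod.fst then false else z w := by
    funext w
    split_ifs with hw
    · obtain ⟨x, rfl⟩ := (hmem w).1 hw
      exact h0 x
    · exact h1 w fun x hx => hw ((hmem w).2 ⟨x, hx⟩)
  rw [hz₀]
  refine runFlips_programFlips ?_ ?_ ?_
  · intro b hb
    obtain ⟨x, rfl⟩ := mem_orderedProgram.1 hb
    exact hz x
  · intro b hb c hc hmem'
    obtain ⟨x, rfl⟩ := mem_orderedProgram.1 hb
    exact lt_irrefl _ (hlt x c hc x hmem')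
  · rw [orderedProgram, List.pairwise_map]
    have hs := (Finset.sortedLT_sort (Finset.univ : Finset I)).pairwise
    refine hs.imp fun {x y} hxy => ⟨fun h => hxy.ne (hinj h), fun c hc hy => ?_⟩
    exact lt_asymm hxy (hlt x c hc y hy)

end

/-- The sum of the entries from position `k` on. -/
def suffixSum {n : ℕ} (τ : Fin n → ℕ) (k : ℕ) : ℕ := ∑ i with k ≤ (i : Fin n).val, τ i

theorem suffixSum_eq_add {n : ℕ} (τ : Fin n → ℕ) (j : Fin n) :
    suffixSum τ j = τ j + suffixSum τ (j + 1) := by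
  rw [suffixSum, suffixSum, ← Finset.sum_insert (f := τ) (by simp)]
  refine Finset.sum_congr ?_ fun _ _ => rfl
  ext i
  simp only [Finset.mem_filter, Finset.mem_univ, true_and, Finset.mem_insert, Fin.ext_iff]
  omega

theorem suffixSum_of_le {n : ℕ} (τ : Fin n → ℕ) {k : ℕ} (hk : n ≤ k) : suffixSum τ k = 0 := by
  refine Finset.sum_eq_zero fun i hi => ?_
  have := (Finset.mem_filter.1 hi).2
  omega

theorem suffixSum_eq_sum_Ici {n : ℕ} (τ : Fin n → ℕ) (j : Fin n) :
    suffixSum τ j = ∑ i ∈ Finset.Ici j, τ i := by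
  have h : (Finset.univ.filter fun i : Fin n => (j : ℕ) ≤ i) = Finset.Ici j := by
    ext i
    rw [Finset.mem_filter, Finset.mem_Ici, Fin.le_def]
    exact and_iff_right (Finset.mem_univ i)
  rw [suffixSum, h]

/-- The wires of an evaluation circuit: the preparation circuit, `n` copies of the integral circuit,
work qubits `A` and the target. -/
abbrev EvalWire (Q R A : Type) (n : ℕ) : Type := Q ⊕ (Fin n × R) ⊕ A ⊕ Unit

/-- The wires of the copies of the integral circuit. -/
def integralWires (Q R A : Type) (n : ℕ) : Fin n × R ↪ EvalWire Q R A n :=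
  ⟨fun x => Sum.inr (Sum.inl x), fun _ _ h => Sum.inl_injective (Sum.inr_injective h)⟩

/-! ### Loading the arguments of the integral circuits -/

section
variable {Q R : Type} [Fintype Q] [DecidableEq Q] [Fintype R] [DecidableEq R] {n lv l : ℕ}
  (reg : (Fin n × Fin lv) ⊕ (Fin n × Fin l) ↪ Q) (inp : Fin l ↪ R)

/-- The number in the time register `j`. -/
def timeValue (q : Q → Bool) (j : Fin n) : ℕ := unsignedVal fun i => q (reg (Sum.inr (j, i)))

/-- The number in the value register `j`. -/
def dataValue (q : Q → Bool) (j : Fin n) : ℤ := signedVal fun i => q (reg (Sum.inl (j, i)))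

/-- The qubits of the ripple adder that computes the sums of the last time registers. -/
def adderTarget (j : Fin n) (i : Fin l) (k : Bool) : EvalWire Q R (Fin n × Fin l) n :=
  if k then Sum.inr (Sum.inr (Sum.inl (j, i))) else Sum.inr (Sum.inl (j, inp i))

/-- A full adder for τ_j plus the suffix sum from j + 1. The second summand is read from the input
register of copy j + 1 of the integral circuit, where it was just computed; it is absent for the
last piece, as is the incoming carry at bit 0. -/
def adderMonomials (j : Fin n) (i : Fin l) (k : Bool) :
    List (Finset (EvalWire Q R (Fin n × Fin l) n)) :=
  (if k then carryMonomials else sumMonomials) (Sum.inl (reg (Sum.inr (j, i))))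
    (if h : (j : ℕ) + 1 < n then some (adderTarget inp ⟨j + 1, h⟩ i false) else none)
    (if (i : ℕ) = 0 then none else
      some (adderTarget inp j ⟨i - 1, lt_of_le_of_lt (Nat.sub_le _ _) i.isLt⟩ true))

/-- The contents of the wires after the addition. -/
noncomputable def adderState (q : Q → Bool) : EvalWire Q R (Fin n × Fin l) n → Bool
  | Sum.inl a => q a
  | Sum.inr (Sum.inl (j, r)) =>
    Function.extend inp (fun i : Fin l => (suffixSum (timeValue reg q) j).testBit i)
      (fun _ => false) r
  | Sum.inr (Sum.inr (Sum.inl (j, i))) =>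
    BitVec.carry (i + 1) (BitVec.ofNat l (timeValue reg q j))
      (BitVec.ofNat l (suffixSum (timeValue reg q) (j + 1))) false
  | Sum.inr (Sum.inr (Sum.inr _)) => false

/-- The steps of the adder, in their order: from the last register to the first one, and from the
least significant qubit to the most significant one. -/
abbrev AdderStep (n l : ℕ) : Type := (Fin n)ᵒᵈ ×ₗ (Fin l ×ₗ Bool)

def adderProgram : List (EvalWire Q R (Fin n × Fin l) n × Finset (EvalWire Q R (Fin n × Fin l) n)) :=
  programFlips (orderedProgram
    (fun x : AdderStep n l => adderTarget inp (OrderDual.ofDual (ofLex x).1)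
      (ofLex (ofLex x).2).1 (ofLex (ofLex x).2).2)
    (fun x => adderMonomials reg inp (OrderDual.ofDual (ofLex x).1)
      (ofLex (ofLex x).2).1 (ofLex (ofLex x).2).2))

/-- These are the equations of binary addition, taken from `BitVec.carry_succ` and
`BitVec.getLsbD_add`. They hold modulo 2^l for every `q`, so overflow on contents that never occur
needs no attention. -/
theorem adderState_adderTarget (q : Q → Bool) (j : Fin n) (i : Fin l) (k : Bool) :
    adderState reg inp q (adderTarget inp j i k) =
      xorOfAnds (adderMonomials reg inp j i k) (adderState reg inp q) := by
  have ha : adderState reg inp q (Sum.inl (reg (Sum.inr (j, i)))) =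
      (BitVec.ofNat l (timeValue reg q j)).getLsbD i := by
    rw [BitVec.getLsbD_ofNat, timeValue, testBit_unsignedVal]
    simp [adderState]
  have hb : (if h : (j : ℕ) + 1 < n then some (adderTarget inp ⟨j + 1, h⟩ i false)
      else none).elim false (adderState reg inp q) =
      (BitVec.ofNat l (suffixSum (timeValue reg q) (j + 1))).getLsbD i := by
    rw [BitVec.getLsbD_ofNat]
    split_ifs with h
    · simp [adderTarget, adderState, inp.injective.extend_apply]
    · rw [suffixSum_of_le _ (not_lt.1 h)]
      simp
  have hc : (if (i : ℕ) = 0 then none else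
      some (adderTarget inp j ⟨i - 1, lt_of_le_of_lt (Nat.sub_le _ _) i.isLt⟩ true)).elim false
        (adderState reg inp q) =
      BitVec.carry i (BitVec.ofNat l (timeValue reg q j))
        (BitVec.ofNat l (suffixSum (timeValue reg q) (j + 1))) false := by
    split_ifs with h
    · rw [h, BitVec.carry_zero]
      rfl
    · simp only [Option.elim_some, adderTarget, if_true, adderState]
      rw [Nat.sub_add_cancel (by omega)]
  rw [adderMonomials]
  cases k
  · rw [if_neg (by simp), xorOfAnds_sumMonomials, ha, hb, hc, ← BitVec.getLsbD_add i.2,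
      ← BitVec.ofNat_add, ← suffixSum_eq_add, BitVec.getLsbD_ofNat]
    simp [adderTarget, adderState, inp.injective.extend_apply]
  · rw [if_pos rfl, xorOfAnds_carryMonomials, ha, hb, hc, ← BitVec.carry_succ]
    rfl

theorem adderTarget_injective {j j' : Fin n} {i i' : Fin l} {k k' : Bool}
    (h : (adderTarget inp j i k : EvalWire Q R _ n) = adderTarget inp j' i' k') :
    j = j' ∧ i = i' ∧ k = k' := by
  cases k <;> cases k' <;> simp [adderTarget] at h <;> simp [h]

theorem adderTarget_ne_inl (j : Fin n) (i : Fin l) (k : Bool) (a : Q) :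
    (adderTarget inp j i k : EvalWire Q R _ n) ≠ Sum.inl a := by
  cases k <;> simp [adderTarget]

/-- A step reads preparation wires, later registers, or lower qubits of the same register; these
dependencies decrease in the lexicographic order with reversed first coordinate. -/
theorem mem_adderMonomials {j : Fin n} {i : Fin l} {k : Bool}
    {s : Finset (EvalWire Q R (Fin n × Fin l) n)} {w : EvalWire Q R (Fin n × Fin l) n}
    (hs : s ∈ adderMonomials reg inp j i k) (hw : w ∈ s) :
    (∃ a, w = Sum.inl a) ∨ (∃ j' k', j < j' ∧ w = adderTarget inp j' i k') ∨
      ∃ i' k', i' < i ∧ w = adderTarget inp j i' k' := by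
  have h : w = Sum.inl (reg (Sum.inr (j, i))) ∨
      (if h : (j : ℕ) + 1 < n then some (adderTarget inp ⟨j + 1, h⟩ i false) else none) = some w ∨
      (if (i : ℕ) = 0 then none else
        some (adderTarget inp j ⟨i - 1, lt_of_le_of_lt (Nat.sub_le _ _) i.isLt⟩ true)) =
          some w := by
    cases k
    · exact mem_sumMonomials hs hw
    · exact mem_carryMonomials hs hw
  rcases h with h | h | h
  · exact Or.inl ⟨_, h⟩
  · split_ifs at h with hj
    exact Or.inr (Or.inl ⟨_, _, Fin.lt_def.2 (Nat.lt_succ_self _), (Option.some_injective _ h).symm⟩)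
  · split_ifs at h with hi
    exact Or.inr (Or.inr ⟨_, _, Fin.lt_def.2 (Nat.sub_lt (Nat.pos_of_ne_zero hi) one_pos),
      (Option.some_injective _ h).symm⟩)

theorem runFlips_adderProgram (q : Q → Bool) :
    runFlips (adderProgram reg inp) (Function.extend (Function.Embedding.inl : Q ↪ _) q
      fun _ => false) = adderState reg inp q := by
  refine runFlips_orderedProgram ?_ ?_ ?_ ?_ ?_
  · intro x y h
    obtain ⟨h1, h2, h3⟩ := adderTarget_injective inp h
    exact Prod.ext h1 (Prod.ext h2 h3)
  · rintro ⟨j, i, k⟩ c hc ⟨j', i', k'⟩ hy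
    rcases mem_adderMonomials reg inp hc hy with ⟨a, ha⟩ | ⟨j'', k'', hlt, h⟩ | ⟨i'', k'', hlt, h⟩
    · exact absurd ha (adderTarget_ne_inl _ _ _ _ _)
    · obtain ⟨rfl, -, -⟩ := adderTarget_injective inp h
      exact Prod.Lex.toLex_lt_toLex.2 (Or.inl hlt)
    · obtain ⟨h1, rfl, -⟩ := adderTarget_injective inp h
      exact Prod.Lex.toLex_lt_toLex.2 (Or.inr ⟨h1, Prod.Lex.toLex_lt_toLex.2 (Or.inl hlt)⟩)
  · rintro ⟨j, i, k⟩
    exact adderState_adderTarget reg inp q _ _ _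
  · rintro ⟨j, i, k⟩
    rw [Function.extend_apply']
    rintro ⟨a, ha⟩
    exact adderTarget_ne_inl _ _ _ _ _ ha.symm
  · intro w hw
    rcases w with a | ⟨j, r⟩ | ⟨j, i⟩ | u
    · exact Function.Embedding.inl.injective.extend_apply _ _ a
    · rw [Function.extend_apply' _ _ _ (by rintro ⟨a, ha⟩; exact Sum.inl_ne_inr ha), adderState,
        Function.extend_apply']
      rintro ⟨i, rfl⟩
      exact hw (toLex (OrderDual.toDual j, toLex (i, false))) rfl
    · exact absurd rfl (hw (toLex (OrderDual.toDual j, toLex (i, true))))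
    · rw [Function.extend_apply' _ _ _ (by rintro ⟨a, ha⟩; exact Sum.inl_ne_inr ha), adderState]

theorem length_adderProgram_le : (adderProgram reg inp).length ≤ 6 * (n * l) := by
  refine (length_programFlips_le _ (c := 3) ?_).trans ?_
  · intro b hb
    obtain ⟨⟨j, i, k⟩, rfl⟩ := mem_orderedProgram.1 hb
    cases k
    · exact length_sumMonomials_le _ _ _
    · exact length_carryMonomials_le _ _ _
  · rw [length_orderedProgram]
    have : Fintype.card (AdderStep n l) = n * (l * 2) := by
      rw [Fintype.card_congr (ofLex : AdderStep n l ≃ _), Fintype.card_prod,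
        Fintype.card_congr (ofLex : Fin l ×ₗ Bool ≃ _), Fintype.card_prod,
        Fintype.card_congr (OrderDual.ofDual : (Fin n)ᵒᵈ ≃ _)]
      simp
    rw [this]
    exact le_of_eq (by ring)

theorem mem_adderProgram {g} (hg : g ∈ adderProgram reg inp) :
    (∃ j i k, g.1 = adderTarget inp j i k) ∧ g.2.card ≤ 2 := by
  obtain ⟨b, hb, h1, h2⟩ := mem_programFlips.1 hg
  obtain ⟨⟨j, i, k⟩, rfl⟩ := mem_orderedProgram.1 hb
  refine ⟨⟨_, _, _, h1⟩, ?_⟩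
  cases k
  · exact card_le_of_mem_sumMonomials h2
  · exact card_le_of_mem_carryMonomials h2

/-- The beginning time of piece `j` according to the time registers holding the ending times. -/
def startValue (q : Q → Bool) (j : Fin n) : ℕ :=
  if (j : ℕ) = 0 then 0 else
    timeValue reg q ⟨(j : ℕ) - 1, lt_of_le_of_lt (Nat.sub_le _ _) j.isLt⟩

/-- A piece begins when the previous one ends; the first begins at 0, and its input register stays
cleared. -/
def copyMonomials (x : Fin n ×ₗ Fin l) : List (Finset (EvalWire Q R Empty n)) :=
  if ((ofLex x).1 : ℕ) = 0 then [] else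
    [{Sum.inl (reg (Sum.inr (⟨(ofLex x).1 - 1, lt_of_le_of_lt (Nat.sub_le _ _) (ofLex x).1.isLt⟩,
      (ofLex x).2)))}]

noncomputable def copyState (q : Q → Bool) : EvalWire Q R Empty n → Bool
  | Sum.inl a => q a
  | Sum.inr (Sum.inl (j, r)) =>
    Function.extend inp (fun i : Fin l => (startValue reg q j).testBit i) (fun _ => false) r
  | Sum.inr (Sum.inr _) => false

def copyProgram : List (EvalWire Q R Empty n × Finset (EvalWire Q R Empty n)) :=
  programFlips (orderedProgram
    (fun x : Fin n ×ₗ Fin l => Sum.inr (Sum.inl ((ofLex x).1, inp (ofLex x).2)))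
    (copyMonomials reg))

theorem runFlips_copyProgram (q : Q → Bool) :
    runFlips (copyProgram reg inp) (Function.extend (Function.Embedding.inl : Q ↪ _) q
      fun _ => false) = copyState reg inp q := by
  refine runFlips_orderedProgram ?_ ?_ ?_ ?_ ?_
  · intro x y h
    have h1 := Prod.ext_iff.1 (Sum.inl_injective (Sum.inr_injective h))
    exact Prod.ext h1.1 (inp.injective h1.2)
  · intro x c hc y hy
    rw [copyMonomials] at hc
    split_ifs at hc
    · simp at hc
    · simp only [List.mem_singleton] at hc
      simp [hc] at hy
  · rintro ⟨j, i⟩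
    change copyState reg inp q (Sum.inr (Sum.inl (j, inp i))) = xorOfAnds (if (j : ℕ) = 0 then []
      else [{Sum.inl (reg (Sum.inr (⟨j - 1, lt_of_le_of_lt (Nat.sub_le _ _) j.isLt⟩, i)))}]) _
    rw [copyState, inp.injective.extend_apply, startValue]
    split_ifs
    · simp [xorOfAnds]
    · rw [timeValue, testBit_unsignedVal]
      simp [xorOfAnds, copyState]
  · intro x
    rw [Function.extend_apply']
    rintro ⟨a, ha⟩
    exact Sum.inl_ne_inr ha
  · intro w hw
    rcases w with a | ⟨j, r⟩ | u
    · exact Function.Embedding.inl.injective.extend_apply _ _ a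
    · rw [Function.extend_apply' _ _ _ (by rintro ⟨a, ha⟩; exact Sum.inl_ne_inr ha), copyState,
        Function.extend_apply']
      rintro ⟨i, rfl⟩
      exact hw (toLex (j, i)) rfl
    · rw [Function.extend_apply' _ _ _ (by rintro ⟨a, ha⟩; exact Sum.inl_ne_inr ha), copyState]

theorem length_copyProgram_le : (copyProgram reg inp).length ≤ n * l := by
  refine (length_programFlips_le _ (c := 1) ?_).trans ?_
  · intro b hb
    obtain ⟨x, rfl⟩ := mem_orderedProgram.1 hb
    simp only [copyMonomials]
    split_ifs <;> simp
  · rw [length_orderedProgram, Fintype.card_congr (ofLex : Fin n ×ₗ Fin l ≃ _), Fintype.card_prod]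
    simp

theorem mem_copyProgram {g} (hg : g ∈ copyProgram reg inp) :
    (∃ x, g.1 = Sum.inr (Sum.inl x)) ∧ g.2.card ≤ 2 := by
  obtain ⟨b, hb, h1, h2⟩ := mem_programFlips.1 hg
  obtain ⟨x, rfl⟩ := mem_orderedProgram.1 hb
  refine ⟨⟨_, h1⟩, ?_⟩
  simp only [copyMonomials] at h2
  split_ifs at h2
  · simp at h2
  · simp only [List.mem_singleton] at h2
    simp [h2]

end

/-! ### The estimators for the two representations -/

section
variable {Q R : Type} [Fintype Q] [DecidableEq Q] [Fintype R] [DecidableEq R] {n lv l : ℕ}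
  (reg : (Fin n × Fin lv) ⊕ (Fin n × Fin l) ↪ Q) (inp out : Fin l ↪ R)

/-- The value before piece `j` according to the value registers. -/
def prevDataValue (q : Q → Bool) (j : Fin n) : ℤ :=
  if (j : ℕ) = 0 then 0 else
    dataValue reg q ⟨(j : ℕ) - 1, lt_of_le_of_lt (Nat.sub_le _ _) j.isLt⟩

/-- No subtraction circuit is needed: X_j − X_{j−1} enters through two families of phases with
opposite coefficients. In the constant 9, the adder takes 6nl gates and the three extra gates of the
Hadamard test are at most 3nl, both charged to n max(lv, l); the 2·n·lv·l phases are charged to the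
other term. -/
theorem exists_estimator_holdingTime (hn : 1 ≤ n) (hlv : 1 ≤ lv) (hl : 1 ≤ l) (rX rF : ℝ)
    (hrX : 0 < rX) {δ : ℝ} (hδ0 : 0 < δ) (hδ1 : δ < 1) (f : ℝ → ℝ) (a P K ε : ℝ) (L : ℕ)
    (hK : ∑ l ∈ (Finset.Icc (-(L : ℤ)) L).erase 0, ‖fourierCoef f a P l‖ ^ 2 ≤ (K * P) ^ 2)
    (hε : 0 < ε) (hεK : ε ≤ K * P) :
    ∃ alg : Estimator Q R n, (∀ l k, ∀ s ∈ alg.evalCircuit l k, s.AtMostTwoControls) ∧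
      ∀ (prep : Circuit Q) (integral : Circuit R),
        (∀ i k, alg.evalDepth prep.depth integral.depth i k ≤
          prep.depth + integral.depth + 9 * (n * lv * l + n * max lv l)) ∧
        (alg.time prep.depth integral.depth : ℝ) ≤
          36 * (3 * (9 : ℕ) + 11) / √δ * K * (L * P / ε) *
            (prep.depth + integral.depth + (n * lv * l + n * max lv l : ℕ)) ∧
        ∀ (Ω : Type*) [MeasurableSpace Ω] (μ : Measure Ω) [IsProbabilityMeasure μ]
          (X : ℝ → Ω → ℝ) (T : ℕ) (Z : Fin n → Ω → ℝ) (τ : Fin n → Ω → ℕ) (g : ℝ → ℝ),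
          (∀ j, Measurable (Z j)) → (∀ j, Measurable (τ j)) →
          IsHoldingTimeRep X T Z τ → T < 2 ^ l →
          PreparesProcess reg rX prep μ Z τ →
          IntervalIntegrable g volume 0 T →
          PreparesFunction inp out rF integral T (fun s => ∫ t in ((T : ℝ) - s)..T, g t) →
          (∀ ω, weightedIntegral g X T ω = ∑ j, (Z j ω - prevValue Z j ω) *
              ∫ t in ((∑ i ∈ Finset.Iio j, τ i ω : ℕ) : ℝ)..T, g t) ∧
          alg.Estimates prep integral μ (weightedIntegral g X T) f a P L ε δ := by
  set S := EvalWire Q R (Fin n × Fin l) n with hS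
  set v : Fin n → Fin lv → S := fun j i => Sum.inl (reg (Sum.inl (j, i))) with hv
  -- For the first piece truncated subtraction makes this register 0 itself; its coefficient in `ph`
  -- is 0 there.
  set v' : Fin n → Fin lv → S := fun j => v ⟨j - 1, lt_of_le_of_lt (Nat.sub_le _ _) j.isLt⟩
    with hv'
  set w : Fin n → Fin l → S := fun j i => integralWires Q R _ n (j, out i) with hw
  set ph := productPhases (fun _ : Fin n => rX * rF) lv l v w ++
    productPhases (fun j : Fin n => if (j : ℕ) = 0 then 0 else -(rX * rF)) lv l v' w with hph
  have hlen : (adderProgram reg inp).length + ph.length + 3 ≤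
      9 * (n * lv * l + n * max lv l) := by
    have h1 := length_adderProgram_le reg inp
    have h2 : n * l ≤ n * max lv l := Nat.mul_le_mul_left _ (le_max_right _ _)
    have h3 : 1 ≤ n * l := Nat.mul_pos hn hl
    rw [hph, List.length_append, length_productPhases, length_productPhases, Fintype.card_fin,
      ← mul_assoc]
    omega
  have hm : 1 ≤ n * lv * l + n * max lv l :=
    Nat.le_add_right_of_le (Nat.mul_pos (Nat.mul_pos hn hlv) hl)
  obtain ⟨alg, h2, halg⟩ := exists_estimator (Function.Embedding.inl : Q ↪ S)
    (integralWires Q R _ n) (Sum.inr (Sum.inr (Sum.inr ()))) (fun _ _ => Sum.inl_ne_inr)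
    (fun b h => Sum.inl_ne_inr (Sum.inr_injective h)) (adderProgram reg inp)
    (fun g hg a => by
      obtain ⟨⟨j, i, k, h⟩, -⟩ := mem_adderProgram reg inp hg
      rw [h]
      exact adderTarget_ne_inl _ _ _ _ _)
    (fun g hg => (mem_adderProgram reg inp hg).2) (adderState reg inp)
    (runFlips_adderProgram reg inp) (fun q => rfl) ph
    (fun x hx => by
      rcases List.mem_append.1 hx with hx | hx <;>
      · obtain ⟨i, a, b, h1, h2⟩ := mem_productPhases hx
        rw [h1, h2]
        exact ⟨Sum.inl_ne_inr, fun h => Sum.inl_ne_inr (Sum.inr_injective h)⟩)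
    hm hlen hδ0 hδ1 f a P K ε L hK hε hεK
  refine ⟨alg, h2, fun prep integral => ⟨(halg prep integral).1, (halg prep integral).2.1, ?_⟩⟩
  intro Ω _ μ _ X T Z τ g hZ hτ hrep hT hprep hg hfun
  obtain ⟨S', hP, hSτ⟩ := hrep
  have hpath : ∀ ω, weightedIntegral g X T ω = ∑ j, (Z j ω - prevValue Z j ω) *
      ∫ t in ((∑ i ∈ Finset.Iio j, τ i ω : ℕ) : ℝ)..T, g t := by
    intro ω
    rw [hP.weightedIntegral_eq hn hg]
    refine Finset.sum_congr rfl fun j _ => ?_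
    rw [startTime_eq_sum hSτ]
  have htime : ∀ q ω, Realizes reg rX Z τ q ω → ∀ j : Fin n,
      ∑ i ∈ Finset.Iio j, τ i ω + suffixSum (timeValue reg q) j = T := by
    intro q ω hq j
    rw [suffixSum_eq_sum_Ici, ← startTime_eq_sum hSτ, ← startTime_add_sum hP hSτ ω j]
    congr 1
    exact Finset.sum_congr rfl fun i _ => (hq i).2.symm
  set Jq : (Q → Bool) → ℝ := fun q => ∑ j, (rX * dataValue reg q j - rX * prevDataValue reg q j) *
    ∫ t in ((T : ℝ) - suffixSum (timeValue reg q) j)..T, g t with hJq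
  refine ⟨hpath, (halg prep integral).2.2 Jq ?_ Ω μ _ ?_⟩
  · intro q x hq hx hint
    obtain ⟨ω, hω⟩ := hprep.exists_realizes hq
    have hF : ∀ j : Fin n, (∫ t in ((T : ℝ) - suffixSum (timeValue reg q) j)..T, g t) =
        rF * signedVal fun i => x (w j i) := by
      intro j
      have hle : suffixSum (timeValue reg q) j ≤ T := by
        have := htime q ω hω j
        omega
      -- The only place where T < 2^l is used: the suffix sum fits into the input register.
      have hval := unsignedVal_testBit (hle.trans_lt hT)
      have h := hfun (fun i : Fin l => (suffixSum (timeValue reg q) j).testBit i)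
        (fun r => x (integralWires Q R _ n (j, r))) (by rw [hval]; exact hle) (hint j)
      rw [hval] at h
      exact h
    have hd : ∀ j, (signedVal fun a => x (v j a)) = dataValue reg q j := fun j =>
      congrArg signedVal (funext fun i => hx _)
    rw [hph, phaseSum_append, phaseSum_productPhases _ hlv hl, phaseSum_productPhases _ hlv hl,
      ← Finset.sum_add_distrib]
    refine Finset.sum_congr rfl fun j _ => ?_
    rw [hF, hd, hd, prevDataValue]
    split_ifs <;> push_cast <;> ring
  · refine hprep.integral_comp hrX hZ hτ _ _ fun q ω hq => ?_
    rw [hpath]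
    refine Finset.sum_congr rfl fun j _ => ?_
    have h1 := htime q ω hq j
    have h2 : ((∑ i ∈ Finset.Iio j, τ i ω : ℕ) : ℝ) = T - suffixSum (timeValue reg q) j := by
      rw [← h1]
      push_cast
      ring
    rw [h2, (hq j).1, prevValue, prevDataValue]
    split_ifs
    · simp [dataValue]
    · rw [(hq _).1]
      rfl

/-- The phases are already linear in the increments, and G is evaluated at copied ending times, so
no addition takes place and the phases dominate the depth. -/
theorem exists_estimator_increment (hn : 1 ≤ n) (hlv : 1 ≤ lv) (hl : 1 ≤ l) (rY rG : ℝ)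
    (hrY : 0 < rY) {δ : ℝ} (hδ0 : 0 < δ) (hδ1 : δ < 1) (f : ℝ → ℝ) (a P K ε : ℝ) (L : ℕ)
    (hK : ∑ l ∈ (Finset.Icc (-(L : ℤ)) L).erase 0, ‖fourierCoef f a P l‖ ^ 2 ≤ (K * P) ^ 2)
    (hε : 0 < ε) (hεK : ε ≤ K * P) :
    ∃ alg : Estimator Q R n, (∀ l k, ∀ s ∈ alg.evalCircuit l k, s.AtMostTwoControls) ∧
      ∀ (prep : Circuit Q) (integral : Circuit R),
        (∀ i k, alg.evalDepth prep.depth integral.depth i k ≤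
          prep.depth + integral.depth + 9 * (n * lv * l)) ∧
        (alg.time prep.depth integral.depth : ℝ) ≤
          36 * (3 * (9 : ℕ) + 11) / √δ * K * (L * P / ε) *
            (prep.depth + integral.depth + (n * lv * l : ℕ)) ∧
        ∀ (Ω : Type*) [MeasurableSpace Ω] (μ : Measure Ω) [IsProbabilityMeasure μ]
          (X : ℝ → Ω → ℝ) (T : ℕ) (Y : Fin n → Ω → ℝ) (S : Fin n → Ω → ℕ) (g : ℝ → ℝ),
          (∀ j, Measurable (Y j)) → (∀ j, Measurable (S j)) →
          IsIncrementRep X T Y S →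
          PreparesProcess reg rY prep μ Y S →
          IntervalIntegrable g volume 0 T →
          PreparesFunction inp out rG integral T (fun s => ∫ t in (s : ℝ)..T, g t) →
          (∀ ω, weightedIntegral g X T ω =
            ∑ j, Y j ω * ∫ t in (startTime S j ω : ℝ)..T, g t) ∧
          alg.Estimates prep integral μ (weightedIntegral g X T) f a P L ε δ := by
  set v : Fin n → Fin lv → EvalWire Q R Empty n := fun j i => Sum.inl (reg (Sum.inl (j, i)))
    with hv
  set w : Fin n → Fin l → EvalWire Q R Empty n := fun j i => integralWires Q R _ n (j, out i)
    with hw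
  set ph := productPhases (fun _ : Fin n => rY * rG) lv l v w with hph
  have hm : 1 ≤ n * lv * l := Nat.mul_pos (Nat.mul_pos hn hlv) hl
  -- The bound holds with 5; 9 agrees with the holding time case, so that one constant serves both.
  have hlen : (copyProgram reg inp).length + ph.length + 3 ≤ 9 * (n * lv * l) := by
    have h1 := length_copyProgram_le reg inp
    have h2 : n * l ≤ n * lv * l := Nat.mul_le_mul_right _ (Nat.le_mul_of_pos_right _ hlv)
    rw [hph, length_productPhases, Fintype.card_fin, ← mul_assoc]
    omega
  obtain ⟨alg, h2, halg⟩ := exists_estimator (Function.Embedding.inl : Q ↪ EvalWire Q R Empty n)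
    (integralWires Q R _ n) (Sum.inr (Sum.inr (Sum.inr ()))) (fun _ _ => Sum.inl_ne_inr)
    (fun b h => Sum.inl_ne_inr (Sum.inr_injective h)) (copyProgram reg inp)
    (fun g hg a => by
      obtain ⟨⟨x, h⟩, -⟩ := mem_copyProgram reg inp hg
      rw [h]
      exact Sum.inr_ne_inl)
    (fun g hg => (mem_copyProgram reg inp hg).2) (copyState reg inp)
    (runFlips_copyProgram reg inp) (fun q => rfl) ph
    (fun x hx => by
      obtain ⟨i, a, b, h1, h2⟩ := mem_productPhases hx
      rw [h1, h2]
      exact ⟨Sum.inl_ne_inr, fun h => Sum.inl_ne_inr (Sum.inr_injective h)⟩)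
    hm hlen hδ0 hδ1 f a P K ε L hK hε hεK
  refine ⟨alg, h2, fun prep integral => ⟨(halg prep integral).1, (halg prep integral).2.1, ?_⟩⟩
  intro Ω _ μ _ X T Y S g hY hS hrep hprep hg hfun
  obtain ⟨Z, hP, hYZ⟩ := hrep
  have hpath : ∀ ω, weightedIntegral g X T ω =
      ∑ j, Y j ω * ∫ t in (startTime S j ω : ℝ)..T, g t := by
    intro ω
    rw [hP.weightedIntegral_eq hn hg]
    refine Finset.sum_congr rfl fun j _ => ?_
    rw [hYZ]
  have htime : ∀ q ω, Realizes reg rY Y S q ω → ∀ j : Fin n,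
      startTime S j ω = startValue reg q j := by
    intro q ω hq j
    rw [startTime, startValue]
    split_ifs
    · rfl
    · exact (hq _).2
  set Jq : (Q → Bool) → ℝ := fun q => ∑ j, rY * dataValue reg q j *
    ∫ t in (startValue reg q j : ℝ)..T, g t with hJq
  refine ⟨hpath, (halg prep integral).2.2 Jq ?_ Ω μ _ ?_⟩
  · intro q x hq hx hint
    obtain ⟨ω, hω⟩ := hprep.exists_realizes hq
    have hF : ∀ j : Fin n, (∫ t in (startValue reg q j : ℝ)..T, g t) =
        rG * signedVal fun i => x (w j i) := by
      intro j
      have hle : startValue reg q j ≤ T := by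
        rw [← htime q ω hω]
        exact hP.startTime_le ω j
      -- A beginning time is 0 or the content of a time register, so it fits without any assumption
      -- on T.
      have hlt : startValue reg q j < 2 ^ l := by
        rw [startValue]
        split_ifs
        · positivity
        · exact unsignedVal_lt _
      have hval := unsignedVal_testBit hlt
      have h := hfun (fun i : Fin l => (startValue reg q j).testBit i)
        (fun r => x (integralWires Q R _ n (j, r))) (by rw [hval]; exact hle) (hint j)
      rw [hval] at h
      exact h
    have hd : ∀ j, (signedVal fun a => x (v j a)) = dataValue reg q j := fun j =>
      congrArg signedVal (funext fun i => hx _)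
    rw [hph, phaseSum_productPhases _ hlv hl]
    refine Finset.sum_congr rfl fun j _ => ?_
    rw [hF, hd]
    ring
  · refine hprep.integral_comp hrY hY hS _ _ fun q ω hq => ?_
    rw [hpath]
    refine Finset.sum_congr rfl fun j _ => ?_
    rw [htime q ω hq, (hq j).1]
    rfl

end

end QCTSP

/-! ### The theorem -/

theorem mainTheorem8 (δ : ℝ) (hδ0 : 0 < δ) (hδ1 : δ < 1) :
    ∃ C : ℝ, 0 < C ∧
    -- holding time representation
    (∀ (n lx lτ : ℕ), 1 ≤ n → 1 ≤ lx → 1 ≤ lτ →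
      ∀ (Q R : Type) [Fintype Q] [DecidableEq Q] [Fintype R] [DecidableEq R]
        (reg : (Fin n × Fin lx) ⊕ (Fin n × Fin lτ) ↪ Q) (inp out : Fin lτ ↪ R)
        (rX rF : ℝ), 0 < rX → 0 < rF →
      ∀ (f : ℝ → ℝ) (a P K ε : ℝ) (L : ℕ), 0 < P →
        IntervalIntegrable f volume a (a + P) →
        ∑ l ∈ (Finset.Icc (-(L : ℤ)) L).erase 0, ‖QCTSP.fourierCoef f a P l‖ ^ 2 ≤ (K * P) ^ 2 →
        0 < ε → ε ≤ K * P →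
      ∃ alg : QCTSP.Estimator Q R n,
        (∀ l k, ∀ s ∈ alg.evalCircuit l k, s.AtMostTwoControls) ∧
        ∀ (prep : QCTSP.Circuit Q) (integral : QCTSP.Circuit R),
        (∀ l k, (alg.evalDepth prep.depth integral.depth l k : ℝ) ≤
          prep.depth + integral.depth + C * (n * lx * lτ + n * max lx lτ)) ∧
        (alg.time prep.depth integral.depth : ℝ) ≤
          C * K * (L * P / ε) *
            (prep.depth + integral.depth + n * lx * lτ + n * max lx lτ) ∧
        ∀ (Ω : Type*) [MeasurableSpace Ω] (μ : Measure Ω) [IsProbabilityMeasure μ]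
          (X : ℝ → Ω → ℝ) (T : ℕ) (Z : Fin n → Ω → ℝ) (τ : Fin n → Ω → ℕ) (g : ℝ → ℝ),
          (∀ j, Measurable (Z j)) → (∀ j, Measurable (τ j)) →
          QCTSP.IsHoldingTimeRep X T Z τ → T < 2 ^ lτ →
          QCTSP.PreparesProcess reg rX prep μ Z τ →
          IntervalIntegrable g volume 0 T →
          QCTSP.PreparesFunction inp out rF integral T (fun s => ∫ t in ((T : ℝ) - s)..T, g t) →
          (∀ ω, QCTSP.weightedIntegral g X T ω =
            ∑ j, (Z j ω - QCTSP.prevValue Z j ω) *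
              ∫ t in ((∑ i ∈ Finset.Iio j, τ i ω : ℕ) : ℝ)..T, g t) ∧
          alg.Estimates prep integral μ (QCTSP.weightedIntegral g X T) f a P L ε δ) ∧
    -- increment representation
    (∀ (n lY lT : ℕ), 1 ≤ n → 1 ≤ lY → 1 ≤ lT →
      ∀ (Q R : Type) [Fintype Q] [DecidableEq Q] [Fintype R] [DecidableEq R]
        (reg : (Fin n × Fin lY) ⊕ (Fin n × Fin lT) ↪ Q) (inp out : Fin lT ↪ R)
        (rY rG : ℝ), 0 < rY → 0 < rG →
      ∀ (f : ℝ → ℝ) (a P K ε : ℝ) (L : ℕ), 0 < P →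
        IntervalIntegrable f volume a (a + P) →
        ∑ l ∈ (Finset.Icc (-(L : ℤ)) L).erase 0, ‖QCTSP.fourierCoef f a P l‖ ^ 2 ≤ (K * P) ^ 2 →
        0 < ε → ε ≤ K * P →
      ∃ alg : QCTSP.Estimator Q R n,
        (∀ l k, ∀ s ∈ alg.evalCircuit l k, s.AtMostTwoControls) ∧
        ∀ (prep : QCTSP.Circuit Q) (integral : QCTSP.Circuit R),
        (∀ l k, (alg.evalDepth prep.depth integral.depth l k : ℝ) ≤
          prep.depth + integral.depth + C * (n * lY * lT)) ∧
        (alg.time prep.depth integral.depth : ℝ) ≤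
          C * K * (L * P / ε) * (prep.depth + integral.depth + n * lY * lT) ∧
        ∀ (Ω : Type*) [MeasurableSpace Ω] (μ : Measure Ω) [IsProbabilityMeasure μ]
          (X : ℝ → Ω → ℝ) (T : ℕ) (Y : Fin n → Ω → ℝ) (S : Fin n → Ω → ℕ) (g : ℝ → ℝ),
          (∀ j, Measurable (Y j)) → (∀ j, Measurable (S j)) →
          QCTSP.IsIncrementRep X T Y S →
          QCTSP.PreparesProcess reg rY prep μ Y S →
          IntervalIntegrable g volume 0 T →
          QCTSP.PreparesFunction inp out rG integral T (fun s => ∫ t in (s : ℝ)..T, g t) →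
          (∀ ω, QCTSP.weightedIntegral g X T ω =
            ∑ j, Y j ω * ∫ t in (QCTSP.startTime S j ω : ℝ)..T, g t) ∧
          alg.Estimates prep integral μ (QCTSP.weightedIntegral g X T) f a P L ε δ) := by
  have hs : 0 < √δ := Real.sqrt_pos.2 hδ0
  set D : ℝ := 36 * (3 * (9 : ℕ) + 11) / √δ with hD
  have hD0 : 0 < D := by positivity
  have htime : ∀ {K P ε u v : ℝ} {L : ℕ}, 0 < P → 0 < ε → ε ≤ K * P → 0 ≤ v →
      u ≤ D * K * (L * P / ε) * v → u ≤ (D + 9) * K * (L * P / ε) * v := by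
    intro K P ε u v L hP hε hεK hv hu
    -- Positivity of `K`, forced by 0 < ε ≤ K P, allows the constant to be enlarged.
    have hK : 0 < K := pos_of_mul_pos_left (hε.trans_le hεK) hP.le
    refine hu.trans ?_
    gcongr
    linarith
  -- `D` bounds the time and 9 the depth; their sum dominates both.
  refine ⟨D + 9, by positivity, ?_, ?_⟩
  · intro n lx lτ hn hlx hlτ Q R _ _ _ _ reg inp out rX rF hrX hrF f a P K ε L hP hf hK hε hεK
    obtain ⟨alg, h1, h2⟩ := QCTSP.exists_estimator_holdingTime reg inp out hn hlx hlτ rX rF hrX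
      hδ0 hδ1 f a P K ε L hK hε hεK
    refine ⟨alg, h1, fun prep integral => ⟨fun l k => ?_, ?_, (h2 prep integral).2.2⟩⟩
    · have h3 : (alg.evalDepth prep.depth integral.depth l k : ℝ) ≤
          prep.depth + integral.depth + 9 * (n * lx * lτ + n * max lx lτ) := by
        exact_mod_cast (h2 prep integral).1 l k
      refine h3.trans ?_
      gcongr
      linarith
    · refine htime hP hε hεK (by positivity) ((h2 prep integral).2.1.trans_eq ?_)
      push_cast
      ring
  · intro n lY lT hn hlY hlT Q R _ _ _ _ reg inp out rY rG hrY hrG f a P K ε L hP hf hK hε hεK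
    obtain ⟨alg, h1, h2⟩ := QCTSP.exists_estimator_increment reg inp out hn hlY hlT rY rG hrY
      hδ0 hδ1 f a P K ε L hK hε hεK
    refine ⟨alg, h1, fun prep integral => ⟨fun l k => ?_, ?_, (h2 prep integral).2.2⟩⟩
    · have h3 : (alg.evalDepth prep.depth integral.depth l k : ℝ) ≤
          prep.depth + integral.depth + 9 * (n * lY * lT) := by
        exact_mod_cast (h2 prep integral).1 l k
      refine h3.trans ?_
      gcongr
      linarith
    · refine htime hP hε hεK (by positivity) ((h2 prep integral).2.1.trans_eq ?_)
      push_cast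
      ring
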